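/- Let $H$ be a complex Hilbert space, let $A$, $B$, $C$ be densely defined linear operators in $H$ with $A$ closed and $B$, $C$ symmetric and nonnegative, and let $0\le p<1$. Assume that $C$ is $p$-subordinate to $A$ and $B$ is $p$-subordinate to $A^*$, i.e. $\mathcal D(A)\subset\mathcal D(C)$, $\mathcal D(A^*)\subset\mathcal D(B)$ and there is $c\ge 0$ with $$\|Cu\|\le c\|u\|^{1-p}\|Au\|^p\ (u\in\mathcal D(A)),\qquad \|Bv\|\le c\|v\|^{1-p}\|A^*v\|^p\ (v\in\mathcal D(A^*)).$$ Assume further that $i\mathbb R\subset\varrho(A)$ and $\bigcap_{t\in\mathbb R}\ker\bigl(B(A^*+it)^{-1}\bigr)=\{0\}$. Let $$T=\begin{pmatrix}A&B\\ C&-A^*\end{pmatrix}\quad\text{in } H\times H,\qquad \mathcal D(T)=\mathcal D(A)\times\mathcal D(A^*).$$ A densely defined operator $S$ in a Banach space is called *sectorial with angle* $\theta\in[0,\pi)$ if $\sigma(S)\subset\Sigma_\theta=\{z:|\arg z|\le\theta\}$ (where $-\pi<\arg z\le\pi$, $\arg 0=0$) and for every $\theta'\in(\theta,\pi]$ there is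 $M>0$ with $\|(S-z)^{-1}\|\le M/|z|$ for all $z\neq 0$ with $|\arg z|\ge\theta'$. Suppose that $A$ or $-A$ is sectorial with some angle $\theta<\pi/2$. Then $T$ is dichotomous, with spectral subspaces $V_\pm$ that are graphs of linear operators $X_\pm$ in $H$. That is: $H\times H=V_+\oplus V_-$ with closed $T$-invariant subspaces $V_\pm$, $\{|\mathrm{Re}\,z|<h\}\subset\varrho(T)$ for some $h>0$, $\sigma(T|_{V_+})\subset\{\mathrm{Re}\,z>0\}$, $\sigma(T|_{V_-})\subset\{\mathrm{Re}\,z<0\}$, and the projections $P_\pm$ onto $V_\pm$ belonging to this decomposition satisfy $$\frac1{\pi i}\lim_{N\to\infty}\int_{-iN}^{iN}(T-z)^{-1}x\,dz=P_+x-P_-x,\qquad x\in H\times H$$ (which determines $V_\pm$ uniquely); and $V_\pm=\{(u,X_\pm u): u\in\mathcal D(X_\pm)\}$. The operators $X_\pm$ are selfadjoint, $X_+$ is nonnegative, $X_-$ is nonpositive, $\mathcal D(A)\cap X_\pm^{-1}\mathcal D(A^*)$ is a core for $X_\pm$, and $$(A^*X_\pm+X_\pm(A+BX_\pm)-C)u=0,\qquad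 u\in\mathcal D(A)\cap X_\pm^{-1}\mathcal D(A^*).$$ Moreover: (i) If $A$ is sectorial with angle $\theta<\pi/2$, then $X_+$ is bounded and everywhere defined, $X_+\mathcal D(A)\subset\mathcal D(A^*)$, and $$(A^*X+XA+XBX-C)u=0,\qquad u\in\mathcal D(A),$$ holds for $X=X_+$. Furthermore, $X_+$ is the only bounded nonnegative operator $X$ on $H$ such that $X\mathcal D(A)\subset\mathcal D(A^*)$ and this equation holds. (ii) If $-A$ is sectorial with angle $\theta<\pi/2$, then $X_-$ is bounded and everywhere defined, $X_-\mathcal D(A)\subset\mathcal D(A^*)$, and the equation in (i) holds for $X=X_-$. Furthermore, $X_-$ is the only bounded nonpositive operator $X$ on $H$ such that $X\mathcal D(A)\subset\mathcal D(A^*)$ and the equation in (i) holds. -/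

import Mathlib

open Filter Topology

noncomputable section

namespace Hamiltonian

section BanachSpace

variable {V : Type*} [NormedAddCommGroup V] [NormedSpace ℂ V]

/-- `R` is the bounded, everywhere defined inverse `(S - z)⁻¹` of `S - z : D(S) → V`. -/
structure IsResolventAt (S : V →ₗ.[ℂ] V) (z : ℂ) (R : V →L[ℂ] V) : Prop where
  mem_domain : ∀ v : V, R v ∈ S.domain
  right_inv : ∀ v : V, S ⟨R v, mem_domain v⟩ - z • R v = v
  left_inv : ∀ x : S.domain, R (S x - z • (x : V)) = x

theorem IsResolventAt.unique {S : V →ₗ.[ℂ] V} {z : ℂ} {R R' : V →L[ℂ] V}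
    (h : IsResolventAt S z R) (h' : IsResolventAt S z R') : R = R' := by
  ext v
  have h1 := h'.left_inv ⟨R v, h.mem_domain v⟩
  rw [h.right_inv v] at h1
  exact h1.symm

/-- The resolvent set `ϱ(S)`. -/
def resolventSet (S : V →ₗ.[ℂ] V) : Set ℂ := {z | ∃ R, IsResolventAt S z R}

/-- The spectrum `σ(S)`. -/
def spectrum (S : V →ₗ.[ℂ] V) : Set ℂ := (resolventSet S)ᶜ

open Classical in
/-- The resolvent `(S - z)⁻¹` for `z ∈ ϱ(S)` (and `0` for `z ∉ ϱ(S)`). -/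
def resolvent (S : V →ₗ.[ℂ] V) (z : ℂ) : V →L[ℂ] V :=
  if h : z ∈ resolventSet S then h.choose else 0

theorem isResolventAt_resolvent {S : V →ₗ.[ℂ] V} {z : ℂ} (h : z ∈ resolventSet S) :
    IsResolventAt S z (resolvent S z) := by
  rw [resolvent, dif_pos h]
  exact h.choose_spec

/-- The closed sector `{z | |arg z| ≤ θ}` (with `arg z ∈ (-π, π]` and `arg 0 = 0`). -/
def sector (θ : ℝ) : Set ℂ := {z | |Complex.arg z| ≤ θ}

/-- `S` is sectorial with angle `θ ∈ [0, π)` (and radius `0`). -/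
structure IsSectorial (S : V →ₗ.[ℂ] V) (θ : ℝ) : Prop where
  dense : Dense (S.domain : Set V)
  angle_nonneg : 0 ≤ θ
  angle_lt : θ < Real.pi
  spectrum_subset : spectrum S ⊆ sector θ
  resolvent_bound : ∀ θ' : ℝ, θ < θ' → θ' ≤ Real.pi → ∃ M : ℝ, 0 < M ∧
    ∀ z : ℂ, θ' ≤ |Complex.arg z| → 0 < ‖z‖ → ‖resolvent S z‖ ≤ M / ‖z‖

/-- `U` is invariant under `S`, i.e. `S (D(S) ∩ U) ⊆ U`. -/
def IsInvariant (S : V →ₗ.[ℂ] V) (U : Submodule ℂ V) : Prop :=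
  ∀ x : S.domain, (x : V) ∈ U → S x ∈ U

/-- The restriction `S|_U` of `S` to an invariant subspace `U`, an operator in `U` with domain
`D(S) ∩ U`. -/
def restrict (S : V →ₗ.[ℂ] V) (U : Submodule ℂ V) (hU : IsInvariant S U) : U →ₗ.[ℂ] U where
  domain := S.domain.comap U.subtype
  toFun :=
    { toFun := fun x => ⟨S ⟨((x : U) : V), x.2⟩, hU _ (x : U).2⟩
      map_add' := fun x y => Subtype.ext (S.map_add ⟨((x : U) : V), x.2⟩ ⟨((y : U) : V), y.2⟩)
      map_smul' := fun c x => Subtype.ext (S.map_smul c ⟨((x : U) : V), x.2⟩) }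

/-- `S` is dichotomous with respect to the decomposition `V = V₊ ⊕ V₋`. -/
structure IsDichotomousWith (S : V →ₗ.[ℂ] V) (Vp Vm : Submodule ℂ V) : Prop where
  dense : Dense (S.domain : Set V)
  isClosed_pos : IsClosed (Vp : Set V)
  isClosed_neg : IsClosed (Vm : Set V)
  isCompl : IsCompl Vp Vm
  gap : ∃ h : ℝ, 0 < h ∧ {z : ℂ | |z.re| < h} ⊆ resolventSet S
  invariant_pos : IsInvariant S Vp
  invariant_neg : IsInvariant S Vm
  spectrum_pos : spectrum (restrict S Vp invariant_pos) ⊆ {z | 0 < z.re}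
  spectrum_neg : spectrum (restrict S Vm invariant_neg) ⊆ {z | z.re < 0}

/-- `V₊`, `V₋` are the spectral subspaces of the dichotomous operator `S`, given by the resolvent
integral along the imaginary axis: `S` is dichotomous with respect to `V = V₊ ⊕ V₋`, and the
projections `P₊`, `P₋` belonging to this direct sum satisfy
`(1 / π i) ∫'_{iℝ} (S - z)⁻¹ x dz = P₊ x - P₋ x` for all `x`, the integral being a Cauchy principal
value at infinity. Here `x = u + v`, `P₊ x = u`, `P₋ x = v`. -/
structure IsSpectralDecomposition (S : V →ₗ.[ℂ] V) (Vp Vm : Submodule ℂ V) : Prop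
    extends IsDichotomousWith S Vp Vm where
  integral : ∀ u ∈ Vp, ∀ v ∈ Vm,
    Tendsto (fun N : ℝ => ((Real.pi : ℂ) * Complex.I)⁻¹ •
        ∫ t in (-N)..N, Complex.I • resolvent S ((t : ℂ) * Complex.I) (u + v))
      atTop (𝓝 (u - v))

/-- The spectral subspaces are uniquely determined. -/
theorem IsSpectralDecomposition.unique {S : V →ₗ.[ℂ] V} {Vp Vm Vp' Vm' : Submodule ℂ V}
    (h : IsSpectralDecomposition S Vp Vm) (h' : IsSpectralDecomposition S Vp' Vm') :
    Vp = Vp' ∧ Vm = Vm' := by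
  have key : ∀ {Wp Wm Wp' Wm' : Submodule ℂ V}, IsSpectralDecomposition S Wp Wm →
      IsSpectralDecomposition S Wp' Wm' → Wp ≤ Wp' ∧ Wm ≤ Wm' := by
    intro Wp Wm Wp' Wm' h h'
    have two : ∀ x y : V, x + y = x - y → y = 0 := fun x y e => by
      have e2 : (2 : ℂ) • y = 0 := by
        rw [two_smul]
        have := sub_eq_zero.2 e
        rw [← this]
        abel
      simpa using e2
    have dec : ∀ x : V, ∃ u ∈ Wp', ∃ v ∈ Wm', u + v = x := fun x =>
      Submodule.mem_sup.1 (h'.isCompl.sup_eq_top ▸ Submodule.mem_top)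
    constructor
    · intro x hx
      obtain ⟨u, hu, v, hv, rfl⟩ := dec x
      have l := h.integral _ hx 0 (Submodule.zero_mem _)
      rw [add_zero, sub_zero] at l
      have hv0 := two u v (tendsto_nhds_unique l (h'.integral u hu v hv))
      simpa [hv0] using hu
    · intro x hx
      obtain ⟨u, hu, v, hv, rfl⟩ := dec x
      have l := h.integral 0 (Submodule.zero_mem _) _ hx
      rw [zero_add, zero_sub] at l
      have e := tendsto_nhds_unique l (h'.integral u hu v hv)
      have hu0 := two v u (by rw [add_comm, ← neg_sub u v, ← e, neg_neg])
      simpa [hu0] using hv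
  exact ⟨le_antisymm (key h h').1 (key h' h).1, le_antisymm (key h h').2 (key h' h).2⟩

end BanachSpace

section Subordinate

variable {V W₁ W₂ : Type*} [NormedAddCommGroup V] [NormedSpace ℂ V]
  [NormedAddCommGroup W₁] [NormedSpace ℂ W₁] [NormedAddCommGroup W₂] [NormedSpace ℂ W₂]

/-- `R` is `p`-subordinate to `S`: `D(S) ⊆ D(R)` and `‖R x‖ ≤ c ‖x‖^(1-p) ‖S x‖^p` on `D(S)`. -/
def IsSubordinate (R : V →ₗ.[ℂ] W₁) (S : V →ₗ.[ℂ] W₂) (p : ℝ) : Prop :=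
  ∃ hD : S.domain ≤ R.domain, ∃ c : ℝ, 0 ≤ c ∧ ∀ x : S.domain,
    ‖R ⟨(x : V), hD x.2⟩‖ ≤ c * ‖(x : V)‖ ^ (1 - p) * ‖S x‖ ^ p

end Subordinate

section HilbertSpace

variable {H : Type*} [NormedAddCommGroup H] [InnerProductSpace ℂ H]

/-- The block operator matrix `(A, B; C, D)` in `H × H`, with its natural domain
`(D(A) ∩ D(C)) × (D(B) ∩ D(D))`. (The norm of `H × H` enters below only through its topology,
so it does not matter which of the equivalent product norms is used.) -/
def blockMatrix (A B C D : H →ₗ.[ℂ] H) : H × H →ₗ.[ℂ] H × H where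
  domain := (A.domain ⊓ C.domain).prod (B.domain ⊓ D.domain)
  toFun :=
    { toFun := fun x =>
        (A ⟨(x : H × H).1, x.2.1.1⟩ + B ⟨(x : H × H).2, x.2.2.1⟩,
          C ⟨(x : H × H).1, x.2.1.2⟩ + D ⟨(x : H × H).2, x.2.2.2⟩)
      map_add' := fun x y => by
        have hA := A.map_add ⟨(x : H × H).1, x.2.1.1⟩ ⟨(y : H × H).1, y.2.1.1⟩
        have hB := B.map_add ⟨(x : H × H).2, x.2.2.1⟩ ⟨(y : H × H).2, y.2.2.1⟩
        have hC := C.map_add ⟨(x : H × H).1, x.2.1.2⟩ ⟨(y : H × H).1, y.2.1.2⟩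
        have hD := D.map_add ⟨(x : H × H).2, x.2.2.2⟩ ⟨(y : H × H).2, y.2.2.2⟩
        exact Prod.ext ((congrArg₂ (· + ·) hA hB).trans (add_add_add_comm _ _ _ _))
          ((congrArg₂ (· + ·) hC hD).trans (add_add_add_comm _ _ _ _))
      map_smul' := fun c x => by
        have hA := A.map_smul c ⟨(x : H × H).1, x.2.1.1⟩
        have hB := B.map_smul c ⟨(x : H × H).2, x.2.2.1⟩
        have hC := C.map_smul c ⟨(x : H × H).1, x.2.1.2⟩
        have hD := D.map_smul c ⟨(x : H × H).2, x.2.2.2⟩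
        exact Prod.ext ((congrArg₂ (· + ·) hA hB).trans (smul_add _ _ _).symm)
          ((congrArg₂ (· + ·) hC hD).trans (smul_add _ _ _).symm) }

/-- The block operator matrix `(A, B; C, D)` is diagonally `p`-dominant, `p ∈ [0, 1]`. -/
structure IsDiagonallyDominant (A B C D : H →ₗ.[ℂ] H) (p : ℝ) : Prop where
  dense_A : Dense (A.domain : Set H)
  dense_B : Dense (B.domain : Set H)
  dense_C : Dense (C.domain : Set H)
  dense_D : Dense (D.domain : Set H)
  exponent_nonneg : 0 ≤ p
  exponent_le_one : p ≤ 1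
  subordinate_C : IsSubordinate C A p
  subordinate_B : IsSubordinate B D p

/-- `⟨S x, x⟩ ≥ 0` on `D(S)` (used for symmetric `S`). -/
def IsNonneg (S : H →ₗ.[ℂ] H) : Prop := ∀ x : S.domain, 0 ≤ (inner ℂ (S x) (x : H)).re

/-- `⟨S x, x⟩ ≤ 0` on `D(S)` (used for symmetric `S`). -/
def IsNonpos (S : H →ₗ.[ℂ] H) : Prop := ∀ x : S.domain, (inner ℂ (S x) (x : H)).re ≤ 0

variable [CompleteSpace H]

/-- The Hamiltonian `T = (A, B; C, -A*)`. -/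
def hamiltonian (A B C : H →ₗ.[ℂ] H) : H × H →ₗ.[ℂ] H × H := blockMatrix A B C (-A.adjoint)

/-- `(A, B; C, -A*)` is a nonnegative diagonally `p`-dominant Hamiltonian. -/
structure IsNonnegHamiltonian (A B C : H →ₗ.[ℂ] H) (p : ℝ) : Prop where
  dominant : IsDiagonallyDominant A B C (-A.adjoint) p
  closed_A : A.IsClosed
  symmetric_B : B.IsFormalAdjoint B
  symmetric_C : C.IsFormalAdjoint C
  nonneg_B : IsNonneg B
  nonneg_C : IsNonneg C

/-- The kernel of `B (A* + i t)⁻¹`. -/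
def kernelAt (A B : H →ₗ.[ℂ] H) (t : ℝ) : Set H :=
  {w | ∃ b : B.domain, (b : H) = resolvent A.adjoint (-((t : ℂ) * Complex.I)) w ∧ B b = 0}

/-- The subspace `D(A) ∩ X⁻¹ D(A*) = {u ∈ D(A) ∩ D(X) | X u ∈ D(A*)}`. -/
def riccatiDomain (A X : H →ₗ.[ℂ] H) : Submodule ℂ H :=
  A.domain ⊓ (A.adjoint.domain.comap X.toFun).map X.domain.subtype

/-- `(A* X + X (A + B X) - C) u = 0` for all `u ∈ D(A) ∩ X⁻¹ D(A*)`; in particular,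
`X u ∈ D(B)`, `u ∈ D(C)` and `(A + B X) u ∈ D(X)` for all such `u`. -/
def SolvesRiccati (A B C X : H →ₗ.[ℂ] H) : Prop :=
  ∀ (u : A.domain) (x : X.domain) (y : A.adjoint.domain), (x : H) = u → X x = y →
    ∃ (b : B.domain) (c : C.domain) (w : X.domain),
      (b : H) = X x ∧ (c : H) = u ∧ (w : H) = A u + B b ∧ A.adjoint y + X w - C c = 0

/-- `X₊` and `X₋` are the two solutions of the Riccati equation attached to the spectral
subspaces `V₊`, `V₋` of the dichotomous Hamiltonian `T`: `V₊` and `V₋` are the graphs of `X₊` and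
`X₋`, which are selfadjoint, nonnegative and nonpositive, respectively, and solve the Riccati
equation on `D(A) ∩ X⁻¹ D(A*)`, a core. -/
structure IsRiccatiPair (A B C Xp Xm : H →ₗ.[ℂ] H) : Prop where
  decomposition : IsSpectralDecomposition (hamiltonian A B C) Xp.graph Xm.graph
  selfAdjoint_pos : IsSelfAdjoint Xp
  selfAdjoint_neg : IsSelfAdjoint Xm
  nonneg : IsNonneg Xp
  nonpos : IsNonpos Xm
  core_pos : Xp.HasCore (riccatiDomain A Xp)
  core_neg : Xm.HasCore (riccatiDomain A Xm)
  riccati_pos : SolvesRiccati A B C Xp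
  riccati_neg : SolvesRiccati A B C Xm

/-- The bounded operator `X` satisfies `X D(A) ⊆ D(A*)` and
`(A* X + X A + X B X - C) u = 0` for all `u ∈ D(A)`. -/
structure IsBoundedSolution (A B C : H →ₗ.[ℂ] H) (X : H →L[ℂ] H) : Prop where
  mem_adjoint_domain : ∀ u : A.domain, X u ∈ A.adjoint.domain
  riccati : ∀ u : A.domain, ∃ (b : B.domain) (c : C.domain), (b : H) = X u ∧ (c : H) = u ∧
    A.adjoint ⟨X u, mem_adjoint_domain u⟩ + X (A u) + X (B b) - C c = 0

end HilbertSpace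

end Hamiltonian

end

/-! ### Resolvents: identities, perturbation, holomorphy. -/

noncomputable section

namespace Hamiltonian

section Resolvent

variable {V : Type*} [NormedAddCommGroup V] [NormedSpace ℂ V]

/-! Everything is read off the resolvent on the imaginary axis. Sectoriality lets one close the
contour in a half-plane, so the principal value of `∫ (A - it)⁻¹ x dt` is `π σ x` with `σ = 1` if
`A` is sectorial and `σ = -1` if `-A` is; for `-A*` the sign is opposite
(`tendsto_integral_resolvent`, `IsSectorial.axis`).

Regard `T` as the diagonal operator `diag(A, -A*)` plus an off-diagonal part. Subordination makes
that part small of order `|t|^(p-1)` relative to the diagonal. Since `Re ⟨f, v⟩ + Re ⟨g, u⟩ = ⟨Bv,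
v⟩ + ⟨Cu, u⟩` for `(f, g) = (T - it)(u, v)`, nonnegativity yields an a priori bound of order
`1/(1+|t|)` for all `t` (`AxisHamiltonian.norm_le`). Hence the axis lies in `ϱ(T)`, the resolvents
of `T` and of its diagonal differ by an integrable `O(|t|^(p-2))`, and the principal value for `T`
exists; it is `π Q` (`exists_axis`). Cauchy integrals along the axis and Liouville's theorem give
`Q² = 1` (`involutive`), and the eigenspaces `V±` of `Q` are the spectral subspaces
(`isSpectralDecomposition`).

Two forms govern `V±`. `T` is skew for `⟨u, v'⟩ - ⟨v, u'⟩`, so `V±` are Lagrangian. For `x = (u, v)`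
in `V±`, the integral of `⟨Bv(t), v(t)⟩ + ⟨Cu(t), u(t)⟩` along `(u(t), v(t)) = (T - it)⁻¹ x` is `±2π
Re ⟨u, v⟩`, which fixes the sign of this form. If it vanishes, so does the integrand, and the
resolvent of `T` acts on `x` as that of the diagonal (`isotropic`). With `u = 0` the kernel
condition then forces `v = 0`, so `V±` are graphs; Lagrangian graphs are those of selfadjoint
operators, and invariance under `T` is the Riccati equation (`exists_graph`).

On the subspace `V_s` with `s = σ`, the second components of the diagonal and the full resolvent
have principal values `-π s v` and `π s v`. Their difference `-2π s v` is controlled by `u`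
(`norm_snd_bound`), so the operator is bounded. It maps `D(A)` into `D(A*)` because `A + BX` is a
small perturbation of `A` (`mem_adjoint_domain`). For uniqueness, the graph of another solution is
invariant under `Q`; its component in `V_{-s}` is isotropic by the two signs, and comparing
principal values there kills it (`graph_subset_eigen`). -/

theorem IsResolventAt.mem {S : V →ₗ.[ℂ] V} {z : ℂ} {R : V →L[ℂ] V} (h : IsResolventAt S z R) :
    z ∈ resolventSet S := ⟨R, h⟩

theorem IsResolventAt.resolvent_eq {S : V →ₗ.[ℂ] V} {z : ℂ} {R : V →L[ℂ] V}
    (h : IsResolventAt S z R) : resolvent S z = R :=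
  (isResolventAt_resolvent h.mem).unique h

theorem IsResolventAt.apply_eq {S : V →ₗ.[ℂ] V} {z : ℂ} {R : V →L[ℂ] V}
    (h : IsResolventAt S z R) (v : V) : S ⟨R v, h.mem_domain v⟩ = v + z • R v :=
  sub_eq_iff_eq_add.1 (h.right_inv v)

theorem IsResolventAt.injective {S : V →ₗ.[ℂ] V} {z : ℂ} {R : V →L[ℂ] V}
    (h : IsResolventAt S z R) : Function.Injective R := by
  intro x y hxy
  rw [← h.right_inv x, ← h.right_inv y]
  simp only [hxy]

/-- The first resolvent identity. -/
theorem IsResolventAt.identity {S : V →ₗ.[ℂ] V} {z w : ℂ} {R R' : V →L[ℂ] V}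
    (h : IsResolventAt S z R) (h' : IsResolventAt S w R') (v : V) :
    R v = R' v + (z - w) • R' (R v) := by
  have h1 := h'.left_inv ⟨R v, h.mem_domain v⟩
  rw [h.apply_eq] at h1
  simp only at h1
  conv_lhs => rw [← h1]
  rw [add_sub_assoc, ← sub_smul, map_add, map_smul]

theorem IsResolventAt.commute {S : V →ₗ.[ℂ] V} {z w : ℂ} {R R' : V →L[ℂ] V}
    (h : IsResolventAt S z R) (h' : IsResolventAt S w R') (v : V) : R (R' v) = R' (R v) := by
  rcases eq_or_ne z w with rfl | hzw
  · rw [h.unique h']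
  · have h1 := h.identity h' v
    have h2 := h'.identity h v
    have h3 : (z - w) • R' (R v) = (z - w) • R (R' v) := by
      have e1 : (z - w) • R' (R v) = R v - R' v := by
        rw [eq_sub_iff_add_eq', ← h1]
      have e2 : (w - z) • R (R' v) = R' v - R v := by
        rw [eq_sub_iff_add_eq', ← h2]
      rw [e1, ← neg_sub w z, neg_smul, e2, neg_sub]
    exact (smul_right_injective V (sub_ne_zero.2 hzw) h3).symm

theorem IsResolventAt.norm_le {S : V →ₗ.[ℂ] V} {z : ℂ} {R : V →L[ℂ] V}
    (h : IsResolventAt S z R) {M : ℝ} (hM : 0 ≤ M)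
    (hb : ∀ x : S.domain, ‖(x : V)‖ ≤ M * ‖S x - z • (x : V)‖) : ‖R‖ ≤ M :=
  R.opNorm_le_bound hM fun v => by
    have := hb ⟨R v, h.mem_domain v⟩
    rwa [h.right_inv v] at this

/-- A bounded operator commuting with the resolvent leaves the domain invariant and commutes
with `S`. -/
theorem IsResolventAt.commute_apply {S : V →ₗ.[ℂ] V} {z : ℂ} {R L : V →L[ℂ] V}
    (h : IsResolventAt S z R) (hL : ∀ v, L (R v) = R (L v)) (x : S.domain) :
    ∃ y : S.domain, (y : V) = L x ∧ S y = L (S x) := by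
  have h1 := h.left_inv x
  refine ⟨⟨R (L (S x - z • (x : V))), h.mem_domain _⟩, ?_, ?_⟩
  · change R (L (S x - z • (x : V))) = L x
    rw [← hL, h1]
  · rw [h.apply_eq, ← hL, h1, ← map_smul, ← map_add, sub_add_cancel]

variable [CompleteSpace V]

/-- Perturbation of resolvents: if `(T - S) (S - z)⁻¹` has norm `< 1`, then `z ∈ ϱ(T)`. -/
theorem IsResolventAt.perturb {S T : V →ₗ.[ℂ] V} {z : ℂ} {R : V →L[ℂ] V}
    (h : IsResolventAt S z R) (hD : S.domain = T.domain) {k : ℝ} (hk0 : 0 ≤ k) (hk : k < 1)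
    (hb : ∀ x : S.domain, ‖T ⟨x, hD.le x.2⟩ - S x‖ ≤ k * ‖S x - z • (x : V)‖) :
    ∃ L : V →L[ℂ] V, IsResolventAt T z (R ∘L L) ∧ ∀ v, ‖L v‖ ≤ (1 - k)⁻¹ * ‖v‖ := by
  have hmem : ∀ v, R v ∈ T.domain := fun v => hD.le (h.mem_domain v)
  let K₀ : V →ₗ[ℂ] V :=
    { toFun := fun v => T ⟨R v, hmem v⟩ - S ⟨R v, h.mem_domain v⟩
      map_add' := fun v w => by
        have h1 := T.map_add ⟨R v, hmem v⟩ ⟨R w, hmem w⟩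
        have h2 := S.map_add ⟨R v, h.mem_domain v⟩ ⟨R w, h.mem_domain w⟩
        simp only [AddMemClass.mk_add_mk, ← map_add] at h1 h2
        rw [h1, h2]; abel
      map_smul' := fun c v => by
        have h1 := T.map_smul c ⟨R v, hmem v⟩
        have h2 := S.map_smul c ⟨R v, h.mem_domain v⟩
        simp only [SetLike.mk_smul_mk, ← map_smul] at h1 h2
        rw [h1, h2, smul_sub]; rfl }
  have hK₀ : ∀ v, ‖K₀ v‖ ≤ k * ‖v‖ := fun v => by
    have := hb ⟨R v, h.mem_domain v⟩
    rwa [h.right_inv v] at this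
  let K : V →L[ℂ] V := K₀.mkContinuous k hK₀
  have hK : ‖-K‖ < 1 := by
    rw [norm_neg]
    exact (LinearMap.mkContinuous_norm_le _ hk0 _).trans_lt hk
  let U := Units.oneSub (-K) hK
  have hU : ∀ v, (U : V →L[ℂ] V) v = v + K v := fun v => by
    simp [U, Units.val_oneSub]
  have hL1 : ∀ v, (U : V →L[ℂ] V) ((↑U⁻¹ : V →L[ℂ] V) v) = v := fun v => by
    rw [← mul_apply_eq_comp, Units.mul_inv]; rfl
  have hL2 : ∀ v, (↑U⁻¹ : V →L[ℂ] V) ((U : V →L[ℂ] V) v) = v := fun v => by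
    rw [← mul_apply_eq_comp, Units.inv_mul]; rfl
  -- This is the factorisation `T - z = (1 + K)(S - z)`, so the new resolvent is `R (1 + K)⁻¹`.
  have key : ∀ v, T ⟨R v, hmem v⟩ - z • R v = (U : V →L[ℂ] V) v := fun v => by
    rw [hU]
    change _ = v + (T ⟨R v, hmem v⟩ - S ⟨R v, h.mem_domain v⟩)
    rw [h.apply_eq]; abel
  refine ⟨(↑U⁻¹ : V →L[ℂ] V), ⟨fun v => hmem _, fun v => ?_, fun x => ?_⟩, fun v => ?_⟩
  · exact (key _).trans (hL1 v)
  · have h1 := h.left_inv ⟨x, hD.ge x.2⟩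
    set y := S ⟨x, hD.ge x.2⟩ - z • (x : V) with hy
    have h2 := key y
    have h3 : (⟨R y, hmem y⟩ : T.domain) = x := Subtype.ext h1
    rw [h3] at h2
    simp only at h1
    rw [h1] at h2
    rw [ContinuousLinearMap.comp_apply, h2, hL2, h1]
  · have h1 := hL1 v
    rw [hU] at h1
    set y := (↑U⁻¹ : V →L[ℂ] V) v
    have h2 : ‖y‖ ≤ ‖v‖ + k * ‖y‖ := by
      calc ‖y‖ = ‖v - K y‖ := by rw [← h1, add_sub_cancel_right]
        _ ≤ ‖v‖ + ‖K y‖ := norm_sub_le _ _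
        _ ≤ ‖v‖ + k * ‖y‖ := by gcongr; exact hK₀ y
    rw [inv_mul_eq_div, le_div_iff₀ (by linarith)]
    linarith

/-- Neumann series, from `S - w = (1 - (w - z) R)(S - z)`. The unit is kept explicit so that the
resolvent near `z` can be written through `Ring.inverse`. -/
theorem IsResolventAt.nearby {S : V →ₗ.[ℂ] V} {z w : ℂ} {R : V →L[ℂ] V}
    (h : IsResolventAt S z R) (hw : ‖w - z‖ * ‖R‖ < 1) :
    ∃ U : (V →L[ℂ] V)ˣ, (U : V →L[ℂ] V) = 1 - (w - z) • R ∧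
      IsResolventAt S w (R * (↑U⁻¹ : V →L[ℂ] V)) := by
  have hn : ‖(w - z) • R‖ < 1 := by rwa [norm_smul]
  let U := Units.oneSub ((w - z) • R) hn
  have hU : ∀ v, (U : V →L[ℂ] V) v = v - (w - z) • R v := fun v => by
    simp [U, Units.val_oneSub]
  have hL1 : ∀ v, (U : V →L[ℂ] V) ((↑U⁻¹ : V →L[ℂ] V) v) = v := fun v => by
    rw [← mul_apply_eq_comp, Units.mul_inv]; rfl
  have hL2 : ∀ v, (↑U⁻¹ : V →L[ℂ] V) ((U : V →L[ℂ] V) v) = v := fun v => by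
    rw [← mul_apply_eq_comp, Units.inv_mul]; rfl
  refine ⟨U, rfl, fun v => h.mem_domain _, fun v => ?_, fun x => ?_⟩
  · refine Eq.trans ?_ (hL1 v)
    simp only [mul_apply_eq_comp]
    rw [h.apply_eq, hU, sub_smul]; abel
  · have h1 := h.left_inv x
    have h2 : S x - w • (x : V) = (U : V →L[ℂ] V) (S x - z • (x : V)) := by
      rw [hU, h1, sub_smul]; abel
    rw [mul_apply_eq_comp, h2, hL2, h1]

theorem isOpen_resolventSet (S : V →ₗ.[ℂ] V) : IsOpen (resolventSet S) := by
  rw [isOpen_iff_mem_nhds]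
  rintro z ⟨R, h⟩
  have : Tendsto (fun w : ℂ => ‖w - z‖ * ‖R‖) (𝓝 z) (𝓝 (‖z - z‖ * ‖R‖)) :=
    Continuous.tendsto (by fun_prop) z
  filter_upwards [this.eventually_lt_const (by simp : ‖z - z‖ * ‖R‖ < 1)] with w hw
  obtain ⟨U, -, hU⟩ := h.nearby hw
  exact hU.mem

/-- Near `z` the resolvent is a fixed operator times the inverse of an affine function of `w`, and
inversion is differentiable at `1`. -/
theorem differentiableAt_resolvent {S : V →ₗ.[ℂ] V} {z : ℂ} (hz : z ∈ resolventSet S) :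
    DifferentiableAt ℂ (resolvent S) z := by
  have h := isResolventAt_resolvent hz
  have key : ∀ᶠ w in 𝓝 z, resolvent S w =
      resolvent S z * Ring.inverse (1 - (w - z) • resolvent S z) := by
    have : Tendsto (fun w : ℂ => ‖w - z‖ * ‖resolvent S z‖) (𝓝 z)
        (𝓝 (‖z - z‖ * ‖resolvent S z‖)) := Continuous.tendsto (by fun_prop) z
    filter_upwards [this.eventually_lt_const (by simp : ‖z - z‖ * ‖resolvent S z‖ < 1)] with w hw
    obtain ⟨U, hU, hR⟩ := h.nearby hw
    rw [hR.resolvent_eq, ← hU, Ring.inverse_unit]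
  refine DifferentiableAt.congr_of_eventuallyEq ?_ key
  refine (differentiableAt_const _).mul ?_
  have h1 : DifferentiableAt ℂ (fun w : ℂ => (1 : V →L[ℂ] V) - (w - z) • resolvent S z) z := by
    fun_prop
  have h2 : DifferentiableAt ℂ (Ring.inverse : (V →L[ℂ] V) → (V →L[ℂ] V))
      ((1 : V →L[ℂ] V) - (z - z) • resolvent S z) := by
    rw [sub_self, zero_smul, sub_zero]
    exact differentiableAt_inverse (R := V →L[ℂ] V) (x := 1) isUnit_one
  exact DifferentiableAt.comp z h2 h1

theorem continuous_resolvent_imaginary {S : V →ₗ.[ℂ] V}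
    (hS : ∀ t : ℝ, (t : ℂ) * Complex.I ∈ resolventSet S) :
    Continuous fun t : ℝ => resolvent S ((t : ℂ) * Complex.I) := by
  rw [continuous_iff_continuousAt]
  intro t
  exact ContinuousAt.comp (f := fun t : ℝ => (t : ℂ) * Complex.I)
    (differentiableAt_resolvent (hS t)).continuousAt (by fun_prop)

/-- The resolvent set is open and, as long as `S - it` is uniformly bounded below, closed along
the imaginary axis. -/
theorem imaginary_mem_resolventSet {S : V →ₗ.[ℂ] V} {M : ℝ} (hM : 0 < M)
    (hb : ∀ (t : ℝ) (x : S.domain), ‖(x : V)‖ ≤ M * ‖S x - ((t : ℂ) * Complex.I) • (x : V)‖)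
    {t₀ : ℝ} (h₀ : (t₀ : ℂ) * Complex.I ∈ resolventSet S) (t : ℝ) :
    (t : ℂ) * Complex.I ∈ resolventSet S := by
  let s : Set ℝ := {t : ℝ | (t : ℂ) * Complex.I ∈ resolventSet S}
  have hs : IsClopen s := by
    constructor
    · rw [← closure_subset_iff_isClosed]
      intro a ha
      rw [Metric.mem_closure_iff] at ha
      -- The lower bound gives every point of `s` a Neumann radius of at least `M⁻¹`, so some point
      -- of `s` reaches the limit point `a`.
      obtain ⟨b, ⟨R, hR⟩, hab⟩ := ha M⁻¹ (by positivity)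
      obtain ⟨U, -, hU⟩ := hR.nearby (w := (a : ℂ) * Complex.I) (by
        have h1 := hR.norm_le hM.le (hb b)
        have h2 : ‖(a : ℂ) * Complex.I - (b : ℂ) * Complex.I‖ = dist a b := by
          rw [← sub_mul, norm_mul, Complex.norm_I, mul_one, ← Complex.ofReal_sub,
            Complex.norm_real, Real.dist_eq, Real.norm_eq_abs]
        rw [h2]
        calc dist a b * ‖R‖ ≤ dist a b * M := by gcongr
          _ < M⁻¹ * M := by gcongr
          _ = 1 := inv_mul_cancel₀ hM.ne')
      exact hU.mem
    · exact (isOpen_resolventSet S).preimage (f := fun t : ℝ => (t : ℂ) * Complex.I) (by fun_prop)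
  have : s = Set.univ := hs.eq_univ ⟨t₀, h₀⟩
  exact this.ge (Set.mem_univ t)

end Resolvent

end Hamiltonian

end

/-! ### Contour integrals in the left half-plane. -/

noncomputable section

namespace Hamiltonian

section Contour

variable {E : Type*} [NormedAddCommGroup E] [NormedSpace ℂ E]

/-- Cauchy's theorem on the rectangle `[-N, 0] × [-N, N]`: the other three sides have total length
`4 N` and stay outside the disc of radius `N`. -/
theorem norm_integral_imaginary_le {g : ℂ → E}
    (hg : ∀ z : ℂ, z.re ≤ 0 → DifferentiableAt ℂ g z) {N K : ℝ} (hN : 0 < N)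
    (hK : ∀ z : ℂ, z.re ≤ 0 → N ≤ ‖z‖ → ‖g z‖ ≤ K) :
    ‖∫ t in (-N)..N, g ((t : ℂ) * Complex.I)‖ ≤ 4 * N * K := by
  have h := Complex.integral_boundary_rect_eq_zero_of_differentiableOn g
    (⟨-N, -N⟩ : ℂ) (⟨0, N⟩ : ℂ) (fun z hz => by
      have h1 : z.re ∈ Set.uIcc (-N) 0 := hz.1
      rw [Set.uIcc_of_le (by linarith)] at h1
      exact (hg z h1.2).differentiableWithinAt)
  simp only [Complex.ofReal_zero, zero_add] at h
  have b1 : ‖∫ x in (-N)..0, g ((x : ℂ) + ((-N : ℝ) : ℂ) * Complex.I)‖ ≤ K * N := by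
    have := intervalIntegral.norm_integral_le_of_norm_le_const (a := -N) (b := 0) (C := K)
      (f := fun x : ℝ => g ((x : ℂ) + ((-N : ℝ) : ℂ) * Complex.I)) (fun x hx => by
        rw [Set.uIoc_of_le (by linarith)] at hx
        refine hK _ (by simpa using hx.2) ?_
        have := Complex.abs_im_le_norm ((x : ℂ) + ((-N : ℝ) : ℂ) * Complex.I)
        simpa [abs_of_pos hN] using this)
    simpa [abs_of_pos hN] using this
  have b2 : ‖∫ x in (-N)..0, g ((x : ℂ) + (N : ℂ) * Complex.I)‖ ≤ K * N := by
    have := intervalIntegral.norm_integral_le_of_norm_le_const (a := -N) (b := 0) (C := K)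
      (f := fun x : ℝ => g ((x : ℂ) + (N : ℂ) * Complex.I)) (fun x hx => by
        rw [Set.uIoc_of_le (by linarith)] at hx
        refine hK _ (by simpa using hx.2) ?_
        have := Complex.abs_im_le_norm ((x : ℂ) + (N : ℂ) * Complex.I)
        simpa [abs_of_pos hN] using this)
    simpa [abs_of_pos hN] using this
  have b3 : ‖∫ y in (-N)..N, g (((-N : ℝ) : ℂ) + (y : ℂ) * Complex.I)‖ ≤ K * (2 * N) := by
    have := intervalIntegral.norm_integral_le_of_norm_le_const (a := -N) (b := N) (C := K)
      (f := fun y : ℝ => g (((-N : ℝ) : ℂ) + (y : ℂ) * Complex.I)) (fun x hx => by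
        refine hK _ (by simpa using hN.le) ?_
        have := Complex.abs_re_le_norm (((-N : ℝ) : ℂ) + (x : ℂ) * Complex.I)
        simpa [abs_of_pos hN] using this)
    have e : |N - -N| = 2 * N := by rw [abs_of_pos (by linarith)]; ring
    rwa [e] at this
  set J := ∫ t in (-N)..N, g ((t : ℂ) * Complex.I) with hJ
  set J1 := ∫ x in (-N)..0, g ((x : ℂ) + ((-N : ℝ) : ℂ) * Complex.I)
  set J2 := ∫ x in (-N)..0, g ((x : ℂ) + (N : ℂ) * Complex.I)
  set J3 := ∫ y in (-N)..N, g (((-N : ℝ) : ℂ) + (y : ℂ) * Complex.I)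
  have e : Complex.I • J = Complex.I • J3 + J2 - J1 := by
    rw [sub_eq_zero] at h
    rw [← h]; abel
  have n1 : ‖J‖ = ‖Complex.I • J‖ := by rw [norm_smul, Complex.norm_I, one_mul]
  have n2 : ‖Complex.I • J3‖ = ‖J3‖ := by rw [norm_smul, Complex.norm_I, one_mul]
  have n3 := norm_sub_le (Complex.I • J3 + J2) J1
  have n4 := norm_add_le (Complex.I • J3) J2
  rw [n1, e]
  linarith

theorem tendsto_integral_imaginary_zero {g : ℂ → E}
    (hg : ∀ z : ℂ, z.re ≤ 0 → DifferentiableAt ℂ g z) {C r : ℝ}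
    (hC : ∀ z : ℂ, z.re ≤ 0 → r ≤ ‖z‖ → ‖g z‖ ≤ C / ‖z‖ ^ 2) :
    Tendsto (fun N : ℝ => ∫ t in (-N)..N, g ((t : ℂ) * Complex.I)) atTop (𝓝 0) := by
  have hl : Tendsto (fun N : ℝ => 4 * |C| * N⁻¹) atTop (𝓝 0) := by
    simpa using tendsto_inv_atTop_zero.const_mul (4 * |C|)
  refine squeeze_zero_norm' ?_ hl
  filter_upwards [eventually_ge_atTop r, eventually_gt_atTop 0] with N hr hN
  refine (norm_integral_imaginary_le hg hN (K := |C| / N ^ 2) fun z hz hNz => ?_).trans ?_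
  · refine (hC z hz (hr.trans hNz)).trans ?_
    calc C / ‖z‖ ^ 2 ≤ |C| / ‖z‖ ^ 2 := by gcongr; exact le_abs_self C
      _ ≤ |C| / N ^ 2 := by gcongr
  · apply le_of_eq; field_simp

/-- The imaginary part of the integrand is odd and not absolutely integrable; in the explicit
primitive its logarithm is even and drops out of the symmetric integral. -/
theorem tendsto_integral_inv_sub_one :
    Tendsto (fun N : ℝ => ∫ t in (-N)..N, ((t : ℂ) * Complex.I - 1)⁻¹) atTop
      (𝓝 (-(Real.pi : ℂ))) := by
  have hne : ∀ t : ℝ, (t : ℂ) * Complex.I - 1 ≠ 0 := fun t h => by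
    have := congrArg Complex.re h
    simp at this
  have hpos : ∀ t : ℝ, 0 < 1 + t ^ 2 := fun t => by positivity
  have key : ∀ N : ℝ, ∫ t in (-N)..N, ((t : ℂ) * Complex.I - 1)⁻¹ =
      ((-(2 * Real.arctan N) : ℝ) : ℂ) := by
    intro N
    have hd : ∀ t ∈ Set.uIcc (-N) N, HasDerivAt (fun t : ℝ => ((-Real.arctan t : ℝ) : ℂ) -
        Complex.I / 2 * ((Real.log (1 + t ^ 2) : ℝ) : ℂ)) (((t : ℂ) * Complex.I - 1)⁻¹) t := by
      intro t _
      have h1 : HasDerivAt (fun t : ℝ => ((-Real.arctan t : ℝ) : ℂ))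
          ((-(1 / (1 + t ^ 2)) : ℝ) : ℂ) t := (Real.hasDerivAt_arctan t).neg.ofReal_comp
      have h2 : HasDerivAt (fun t : ℝ => ((Real.log (1 + t ^ 2) : ℝ) : ℂ))
          ((2 * t / (1 + t ^ 2) : ℝ) : ℂ) t := by
        have h3 : HasDerivAt (fun t : ℝ => 1 + t ^ 2) (2 * t) t := by
          simpa using (hasDerivAt_pow 2 t).const_add 1
        exact (h3.log (hpos t).ne').ofReal_comp
      refine (h1.sub (h2.const_mul (Complex.I / 2))).congr_deriv ?_
      have h4 : ((1 + t ^ 2 : ℝ) : ℂ) ≠ 0 := by exact_mod_cast (hpos t).ne'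
      apply eq_inv_of_mul_eq_one_left
      push_cast at h4 ⊢
      field_simp
      linear_combination (-(t : ℂ) ^ 2) * Complex.I_sq
    have hc : Continuous fun t : ℝ => ((t : ℂ) * Complex.I - 1)⁻¹ :=
      Continuous.inv₀ (by fun_prop) hne
    rw [intervalIntegral.integral_eq_sub_of_hasDerivAt hd (hc.intervalIntegrable _ _)]
    simp only [Real.arctan_neg, neg_neg, neg_sq]
    push_cast
    ring
  simp only [key]
  rw [← Complex.ofReal_neg]
  refine (Complex.continuous_ofReal.tendsto _).comp ?_
  have h1 : Tendsto Real.arctan atTop (𝓝 (Real.pi / 2)) :=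
    tendsto_nhds_of_tendsto_nhdsWithin Real.tendsto_arctan_atTop
  have h2 := (h1.const_mul 2).neg
  rwa [mul_div_cancel₀ _ (two_ne_zero)] at h2

theorem tendsto_integral_inv_sub_of_pos {w : ℂ} (hw : 0 < w.re) :
    Tendsto (fun N : ℝ => ∫ t in (-N)..N, ((t : ℂ) * Complex.I - w)⁻¹) atTop
      (𝓝 (-(Real.pi : ℂ))) := by
  have hne : ∀ (u : ℂ), 0 < u.re → ∀ z : ℂ, z.re ≤ 0 → z - u ≠ 0 := fun u hu z hz h => by
    have := congrArg Complex.re h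
    rw [Complex.sub_re, Complex.zero_re] at this
    linarith
  have h1 : (0 : ℝ) < (1 : ℂ).re := by simp
  have hd : ∀ (u : ℂ), 0 < u.re → ∀ z : ℂ, z.re ≤ 0 →
      DifferentiableAt ℂ (fun z : ℂ => (z - u)⁻¹) z := fun u hu z hz =>
    DifferentiableAt.inv (by fun_prop) (hne u hu z hz)
  -- The difference of the two kernels is holomorphic on the left and decays quadratically. Beyond
  -- radius `2 * (‖w‖ + 1)` both `z - w` and `z - 1` have norm at least `‖z‖ / 2`, whence the factor
  -- `4`.
  have h0 := tendsto_integral_imaginary_zero (g := fun z : ℂ => (z - w)⁻¹ - (z - 1)⁻¹)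
    (C := 4 * ‖w - 1‖) (r := 2 * (‖w‖ + 1))
    (fun z hz => (hd w hw z hz).sub (hd 1 h1 z hz)) (fun z hz hr => by
      have n1 : ‖z‖ / 2 ≤ ‖z - w‖ := by
        have := norm_sub_norm_le z w
        linarith [norm_nonneg w]
      have n2 : ‖z‖ / 2 ≤ ‖z - 1‖ := by
        have := norm_sub_norm_le z 1
        rw [norm_one] at this
        linarith [norm_nonneg w]
      have n0 : 0 < ‖z‖ := by linarith [norm_nonneg w]
      rw [inv_sub_inv (hne w hw z hz) (hne 1 h1 z hz), norm_div, norm_mul,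
        show z - 1 - (z - w) = w - 1 by ring]
      calc ‖w - 1‖ / (‖z - w‖ * ‖z - 1‖) ≤ ‖w - 1‖ / (‖z‖ / 2 * (‖z‖ / 2)) := by gcongr
        _ = 4 * ‖w - 1‖ / ‖z‖ ^ 2 := by field_simp; norm_num)
  have hc : ∀ (u : ℂ), 0 < u.re → Continuous fun t : ℝ => ((t : ℂ) * Complex.I - u)⁻¹ :=
    fun u hu => Continuous.inv₀ (by fun_prop) fun t => hne u hu _ (by simp)
  have h2 := h0.add tendsto_integral_inv_sub_one
  rw [zero_add] at h2
  refine h2.congr fun N => ?_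
  rw [intervalIntegral.integral_sub ((hc w hw).intervalIntegrable _ _)
    ((hc 1 h1).intervalIntegrable _ _), sub_add_cancel]

theorem tendsto_integral_inv_sub_of_neg {w : ℂ} (hw : w.re < 0) :
    Tendsto (fun N : ℝ => ∫ t in (-N)..N, ((t : ℂ) * Complex.I - w)⁻¹) atTop
      (𝓝 (Real.pi : ℂ)) := by
  have h := (tendsto_integral_inv_sub_of_pos (w := -w) (by simpa using hw)).neg
  rw [neg_neg] at h
  refine h.congr fun N => ?_
  have h1 := intervalIntegral.integral_comp_neg (a := -N) (b := N)
    (fun t : ℝ => ((t : ℂ) * Complex.I - w)⁻¹)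
  rw [neg_neg] at h1
  rw [← h1, ← intervalIntegral.integral_neg]
  refine intervalIntegral.integral_congr fun t _ => ?_
  rw [← inv_neg]
  congr 1
  push_cast
  ring

/-- The principal value of the resolvent integral of an operator whose resolvent decays in the
left half-plane. -/
theorem tendsto_integral_resolvent [CompleteSpace E] {S : E →ₗ.[ℂ] E}
    (hS : Dense (S.domain : Set E)) (hρ : ∀ z : ℂ, z.re ≤ 0 → z ∈ resolventSet S) {M : ℝ}
    (hM : ∀ z : ℂ, z.re ≤ 0 → z ≠ 0 → ‖resolvent S z‖ ≤ M / ‖z‖) (x : E) :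
    Tendsto (fun N : ℝ => ∫ t in (-N)..N, resolvent S ((t : ℂ) * Complex.I) x) atTop
      (𝓝 ((Real.pi : ℂ) • x)) := by
  have hd : ∀ (y : E) (z : ℂ), z.re ≤ 0 → DifferentiableAt ℂ (fun z => resolvent S z y) z :=
    fun y z hz => (differentiableAt_resolvent (hρ z hz)).clm_apply (differentiableAt_const y)
  have hcont : ∀ y : E, Continuous fun t : ℝ => resolvent S ((t : ℂ) * Complex.I) y := fun y =>
    (continuous_resolvent_imaginary fun t => hρ _ (by simp)).clm_apply continuous_const
  have hM0 : 0 ≤ M := by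
    have h1 := (norm_nonneg _).trans (hM (-1) (by simp) (by simp))
    simpa using h1
  have hne : ∀ z : ℂ, z.re ≤ 0 → z - 1 ≠ 0 := fun z hz h => by
    have := congrArg Complex.re h
    rw [Complex.sub_re, Complex.zero_re, Complex.one_re] at this
    linarith
  -- The truncated integrals are bounded uniformly in `N`, so it suffices to find the limit on the
  -- dense domain.
  have hbd : ∀ (y : E) (N : ℝ), 0 < N →
      ‖∫ t in (-N)..N, resolvent S ((t : ℂ) * Complex.I) y‖ ≤ 4 * M * ‖y‖ := fun y N hN => by
    refine (norm_integral_imaginary_le (hd y) hN (K := M / N * ‖y‖) fun z hz hNz => ?_).trans ?_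
    · refine (ContinuousLinearMap.le_opNorm _ _).trans ?_
      gcongr
      refine (hM z hz (norm_pos_iff.1 (hN.trans_le hNz))).trans ?_
      gcongr
    · apply le_of_eq; field_simp
  have hdom : ∀ y ∈ S.domain,
      Tendsto (fun N : ℝ => ∫ t in (-N)..N, resolvent S ((t : ℂ) * Complex.I) y) atTop
      (𝓝 ((Real.pi : ℂ) • y)) := by
    intro y hy
    set η := S ⟨y, hy⟩ - y with hη
    -- On the domain one more power of decay is available: up to the scalar kernel, `(S - z)⁻¹ y`
    -- equals `(z - 1)⁻¹ (S - z)⁻¹ (S - 1) y = O(|z|⁻²)`.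
    have hid : ∀ z : ℂ, z.re ≤ 0 →
        resolvent S z y + (z - 1)⁻¹ • y = (z - 1)⁻¹ • resolvent S z η := fun z hz => by
      have h1 := (isResolventAt_resolvent (hρ z hz)).left_inv ⟨y, hy⟩
      have h2 : η = (S ⟨y, hy⟩ - z • y) + (z - 1) • y := by
        rw [hη, sub_smul, one_smul]; abel
      simp only at h1
      rw [h2, map_add, h1, map_smul, smul_add, smul_smul, inv_mul_cancel₀ (hne z hz), one_smul,
        add_comm]
    have hdi : ∀ z : ℂ, z.re ≤ 0 → DifferentiableAt ℂ (fun z : ℂ => (z - 1)⁻¹ • y) z :=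
      fun z hz => by
        have : DifferentiableAt ℂ (fun z : ℂ => (z - 1)⁻¹) z :=
          DifferentiableAt.inv (by fun_prop) (hne z hz)
        exact this.smul_const y
    have h0 := tendsto_integral_imaginary_zero
      (g := fun z : ℂ => resolvent S z y + (z - 1)⁻¹ • y) (C := 2 * M * ‖η‖) (r := 2)
      (fun z hz => (hd y z hz).add (hdi z hz)) (fun z hz hr => by
        rw [hid z hz, norm_smul, norm_inv]
        have n2 : ‖z‖ / 2 ≤ ‖z - 1‖ := by
          have := norm_sub_norm_le z 1
          rw [norm_one] at this
          linarith
        have n0 : 0 < ‖z‖ := by linarith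
        have n3 : ‖resolvent S z η‖ ≤ M / ‖z‖ * ‖η‖ := by
          refine (ContinuousLinearMap.le_opNorm _ _).trans ?_
          gcongr
          exact hM z hz (norm_pos_iff.1 n0)
        calc ‖z - 1‖⁻¹ * ‖resolvent S z η‖ ≤ (‖z‖ / 2)⁻¹ * (M / ‖z‖ * ‖η‖) := by gcongr
          _ = 2 * M * ‖η‖ / ‖z‖ ^ 2 := by field_simp)
    have h1 := h0.sub (tendsto_integral_inv_sub_one.smul_const y)
    rw [zero_sub, neg_smul, neg_neg] at h1
    refine h1.congr fun N => ?_
    have hci : Continuous fun t : ℝ => ((t : ℂ) * Complex.I - 1)⁻¹ :=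
      Continuous.inv₀ (by fun_prop) fun t => hne _ (by simp)
    have hcy : Continuous fun t : ℝ => ((t : ℂ) * Complex.I - 1)⁻¹ • y := hci.smul continuous_const
    rw [intervalIntegral.integral_add ((hcont y).intervalIntegrable _ _)
      (hcy.intervalIntegrable _ _), intervalIntegral.integral_smul_const,
      add_sub_cancel_right]
  rw [Metric.tendsto_atTop]
  intro ε hε
  -- Replacing `x` by `y` costs `4 * M` in the integral and `π` in the limit; the extra `1` leaves
  -- room.
  have hK : 0 < 4 * M + Real.pi + 1 := by positivity
  obtain ⟨y, hy, hxy⟩ := Metric.mem_closure_iff.1 (hS x) (ε / 2 / (4 * M + Real.pi + 1))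
    (by positivity)
  obtain ⟨N₀, hN₀⟩ := Metric.tendsto_atTop.1 (hdom y hy) (ε / 2) (by positivity)
  refine ⟨max N₀ 1, fun N hN => ?_⟩
  have hNpos : 0 < N := one_pos.trans_le ((le_max_right _ _).trans hN)
  have h1 := hN₀ N ((le_max_left _ _).trans hN)
  have h2 := hbd (x - y) N hNpos
  rw [dist_eq_norm] at h1 hxy ⊢
  have h3 : ∫ t in (-N)..N, resolvent S ((t : ℂ) * Complex.I) (x - y) =
      (∫ t in (-N)..N, resolvent S ((t : ℂ) * Complex.I) x) -
        ∫ t in (-N)..N, resolvent S ((t : ℂ) * Complex.I) y := by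
    simp only [map_sub]
    exact intervalIntegral.integral_sub ((hcont x).intervalIntegrable _ _)
      ((hcont y).intervalIntegrable _ _)
  rw [h3] at h2
  set I₁ := ∫ t in (-N)..N, resolvent S ((t : ℂ) * Complex.I) x
  set I₂ := ∫ t in (-N)..N, resolvent S ((t : ℂ) * Complex.I) y
  have h4 : ‖(Real.pi : ℂ) • (x - y)‖ = Real.pi * ‖x - y‖ := by
    rw [norm_smul, Complex.norm_real, Real.norm_of_nonneg Real.pi_pos.le]
  have h5 : I₁ - (Real.pi : ℂ) • x =
      (I₁ - I₂) - (Real.pi : ℂ) • (x - y) + (I₂ - (Real.pi : ℂ) • y) := by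
    rw [smul_sub]; abel
  rw [lt_div_iff₀ hK] at hxy
  have h6 : ‖I₁ - (Real.pi : ℂ) • x‖ ≤
      ‖I₁ - I₂‖ + ‖(Real.pi : ℂ) • (x - y)‖ + ‖I₂ - (Real.pi : ℂ) • y‖ := by
    rw [h5]
    exact (norm_add_le _ _).trans (by gcongr; exact norm_sub_le _ _)
  nlinarith [norm_nonneg (x - y)]

end Contour

end Hamiltonian

end

/-! ### Cauchy integrals of the resolvent along the imaginary axis. -/

noncomputable section

namespace Hamiltonian

section Dichotomy

variable {V : Type*} [NormedAddCommGroup V] [NormedSpace ℂ V]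

/-- The imaginary axis belongs to `ϱ(T)`, the resolvent decays like `1 / |t|` there, and its
principal value integral is `π Q`. -/
structure HasAxisIntegral (T : V →ₗ.[ℂ] V) (M : ℝ) (Q : V →L[ℂ] V) : Prop where
  mem : ∀ t : ℝ, (t : ℂ) * Complex.I ∈ resolventSet T
  bound : ∀ t : ℝ, ‖resolvent T ((t : ℂ) * Complex.I)‖ ≤ M / (1 + |t|)
  lim : ∀ x : V, Tendsto (fun N : ℝ => ∫ t in (-N)..N, resolvent T ((t : ℂ) * Complex.I) x) atTop
    (𝓝 ((Real.pi : ℂ) • Q x))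

/-- The Cauchy integral of the resolvent along the imaginary axis. -/
def axisCauchy (T : V →ₗ.[ℂ] V) (w : ℂ) : V →L[ℂ] V :=
  (2 * Real.pi : ℂ)⁻¹ • ∫ t : ℝ, ((t : ℂ) * Complex.I - w)⁻¹ • resolvent T ((t : ℂ) * Complex.I)

/-- Only the action of `L` on `U` matters, so `L` may be a Cauchy integral that does not invert `S -
z` on the whole space. -/
theorem IsResolventAt.mem_restrict {S : V →ₗ.[ℂ] V} {z : ℂ} {U : Submodule ℂ V}
    (hU : IsInvariant S U) {L : V →L[ℂ] V} (hL : ∀ v ∈ U, L v ∈ U)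
    (hr : ∀ v ∈ U, ∃ y : S.domain, (y : V) = L v ∧ S y - z • (y : V) = v)
    (hl : ∀ x : S.domain, (x : V) ∈ U → L (S x - z • (x : V)) = x) :
    z ∈ resolventSet (restrict S U hU) := by
  refine ⟨(L.comp U.subtypeL).codRestrict U fun v => hL v v.2, fun v => ?_, fun v => ?_,
    fun x => ?_⟩
  · obtain ⟨y, hy, -⟩ := hr v v.2
    change L v ∈ S.domain
    exact hy ▸ y.2
  · obtain ⟨y, hy, hy'⟩ := hr v v.2
    apply Subtype.ext
    have h1 : (⟨L v, hy ▸ y.2⟩ : S.domain) = y := Subtype.ext hy.symm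
    change S ⟨L v, _⟩ - z • L v = v
    rw [h1, ← hy, hy']
  · exact Subtype.ext (hl ⟨((x : U) : V), x.2⟩ (x : U).2)

theorem norm_axis_sub_sq (t : ℝ) (w : ℂ) :
    ‖(t : ℂ) * Complex.I - w‖ ^ 2 = w.re ^ 2 + (t - w.im) ^ 2 := by
  rw [← Complex.normSq_eq_norm_sq, Complex.normSq_apply]
  simp
  ring

theorem axis_sub_ne_zero (t : ℝ) {w : ℂ} (hw : w.re ≠ 0) : (t : ℂ) * Complex.I - w ≠ 0 := by
  intro h
  have := congrArg Complex.re h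
  simp at this
  exact hw this

/-- The bound is a translate of one integrable function, with a factor depending only on `δ`. Its
integral is therefore uniform on `δ ≤ |w.re|`, as Liouville's theorem will require. -/
theorem inv_norm_axis_sub_sq_le (t : ℝ) {w : ℂ} {δ : ℝ} (hδ : 0 < δ) (hw : δ ≤ |w.re|) :
    (‖(t : ℂ) * Complex.I - w‖ ^ 2)⁻¹ ≤ (1 + (δ ^ 2)⁻¹) * (1 + (t - w.im) ^ 2)⁻¹ := by
  rw [norm_axis_sub_sq]
  have h1 : δ ^ 2 ≤ w.re ^ 2 := by rw [← sq_abs w.re]; gcongr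
  have h2 : 0 < δ ^ 2 := by positivity
  have h3 : 0 < w.re ^ 2 + (t - w.im) ^ 2 := by nlinarith [sq_nonneg (t - w.im)]
  rw [← div_eq_mul_inv, le_div_iff₀ (by positivity), inv_mul_le_iff₀ h3]
  have h4 : 1 ≤ (δ ^ 2)⁻¹ * w.re ^ 2 := by
    rw [inv_mul_eq_div, le_div_iff₀ h2]; linarith
  have h5 : 0 ≤ (δ ^ 2)⁻¹ * (t - w.im) ^ 2 := by positivity
  nlinarith [sq_nonneg w.re]

theorem integrable_inv_one_add_sub_sq (b : ℝ) :
    MeasureTheory.Integrable fun t : ℝ => (1 + (t - b) ^ 2)⁻¹ :=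
  integrable_inv_one_add_sq.comp_sub_right b

namespace HasAxisIntegral

variable {T : V →ₗ.[ℂ] V} {M : ℝ} {Q : V →L[ℂ] V} (h : HasAxisIntegral T M Q)
include h

theorem nonneg : 0 ≤ M := by
  have := (norm_nonneg _).trans (h.bound 0)
  simpa using this

theorem isResolventAt (t : ℝ) :
    IsResolventAt T ((t : ℂ) * Complex.I) (resolvent T ((t : ℂ) * Complex.I)) :=
  isResolventAt_resolvent (h.mem t)

/-- Both the kernel and the resolvent bound are square integrable in `t`; the product is split by
the arithmetic-geometric inequality. -/
theorem norm_cauchy_integrand_le (t : ℝ) {w : ℂ} {δ : ℝ} (hδ : 0 < δ) (hw : δ ≤ |w.re|) :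
    ‖((t : ℂ) * Complex.I - w)⁻¹ • resolvent T ((t : ℂ) * Complex.I)‖ ≤
      M / 2 * (1 + (δ ^ 2)⁻¹) * ((1 + (t - 0) ^ 2)⁻¹ + (1 + (t - w.im) ^ 2)⁻¹) := by
  have h1 := inv_norm_axis_sub_sq_le t hδ hw
  have h2 : ((1 + |t|) ^ 2)⁻¹ ≤ (1 + (t - 0) ^ 2)⁻¹ := by
    gcongr
    rw [sub_zero, ← sq_abs]
    nlinarith [abs_nonneg t]
  rw [norm_smul, norm_inv]
  have h3 := h.bound t
  have hM := h.nonneg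
  have h0 : 0 ≤ ‖(t : ℂ) * Complex.I - w‖⁻¹ := by positivity
  rw [← inv_pow] at h1 h2
  have h4 : ‖(t : ℂ) * Complex.I - w‖⁻¹ * (1 + |t|)⁻¹ ≤
      ((1 + |t|)⁻¹ ^ 2 + ‖(t : ℂ) * Complex.I - w‖⁻¹ ^ 2) / 2 := by
    nlinarith [sq_nonneg (‖(t : ℂ) * Complex.I - w‖⁻¹ - (1 + |t|)⁻¹)]
  have h6 : 0 ≤ (δ ^ 2)⁻¹ * (1 + (t - 0) ^ 2)⁻¹ := by positivity
  calc ‖(t : ℂ) * Complex.I - w‖⁻¹ * ‖resolvent T ((t : ℂ) * Complex.I)‖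
      ≤ ‖(t : ℂ) * Complex.I - w‖⁻¹ * (M / (1 + |t|)) := by gcongr
    _ = M * (‖(t : ℂ) * Complex.I - w‖⁻¹ * (1 + |t|)⁻¹) := by ring
    _ ≤ M * ((1 + (δ ^ 2)⁻¹) * ((1 + (t - 0) ^ 2)⁻¹ + (1 + (t - w.im) ^ 2)⁻¹) / 2) := by
      gcongr
      linarith
    _ = _ := by ring

theorem norm_axisCauchy_le {w : ℂ} {δ : ℝ} (hδ : 0 < δ) (hw : δ ≤ |w.re|) :
    ‖axisCauchy T w‖ ≤ M / 2 * (1 + (δ ^ 2)⁻¹) := by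
  have h1 := MeasureTheory.norm_integral_le_of_norm_le
    (((integrable_inv_one_add_sub_sq 0).add (integrable_inv_one_add_sub_sq w.im)).const_mul _)
    (Eventually.of_forall fun t => h.norm_cauchy_integrand_le t hδ hw)
  have h2 : ∀ b : ℝ, ∫ t : ℝ, (1 + (t - b) ^ 2)⁻¹ = Real.pi := fun b => by
    rw [MeasureTheory.integral_sub_right_eq_self fun t : ℝ => (1 + t ^ 2)⁻¹,
      integral_univ_inv_one_add_sq]
  rw [MeasureTheory.integral_const_mul] at h1
  simp only [Pi.add_apply] at h1
  rw [MeasureTheory.integral_add (integrable_inv_one_add_sub_sq 0)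
    (integrable_inv_one_add_sub_sq w.im), h2, h2] at h1
  rw [axisCauchy, norm_smul, norm_inv, norm_mul, Complex.norm_real,
    Real.norm_of_nonneg Real.pi_pos.le, Complex.norm_ofNat,
    inv_mul_le_iff₀ (by positivity)]
  linarith

variable [CompleteSpace V]

theorem continuous_resolvent : Continuous fun t : ℝ => resolvent T ((t : ℂ) * Complex.I) :=
  continuous_resolvent_imaginary h.mem

theorem continuous_cauchy_integrand {w : ℂ} (hw : w.re ≠ 0) : Continuous fun t : ℝ =>
    ((t : ℂ) * Complex.I - w)⁻¹ • resolvent T ((t : ℂ) * Complex.I) :=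
  (Continuous.inv₀ (by fun_prop) fun t => axis_sub_ne_zero t hw).smul h.continuous_resolvent

theorem integrable_cauchy {w : ℂ} (hw : w.re ≠ 0) : MeasureTheory.Integrable fun t : ℝ =>
    ((t : ℂ) * Complex.I - w)⁻¹ • resolvent T ((t : ℂ) * Complex.I) :=
  MeasureTheory.Integrable.mono'
    (((integrable_inv_one_add_sub_sq 0).add (integrable_inv_one_add_sub_sq w.im)).const_mul _)
    (h.continuous_cauchy_integrand hw).aestronglyMeasurable
    (Eventually.of_forall fun t => h.norm_cauchy_integrand_le t (abs_pos.2 hw) le_rfl)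

theorem axisCauchy_apply {w : ℂ} (hw : w.re ≠ 0) (x : V) : axisCauchy T w x =
    (2 * Real.pi : ℂ)⁻¹ • ∫ t : ℝ,
      ((t : ℂ) * Complex.I - w)⁻¹ • resolvent T ((t : ℂ) * Complex.I) x := by
  rw [axisCauchy, smul_apply,
    ContinuousLinearMap.integral_apply (h.integrable_cauchy hw)]
  rfl

theorem commute_axisCauchy {L : V →L[ℂ] V} (hL : ∀ (t : ℝ) (v : V),
    L (resolvent T ((t : ℂ) * Complex.I) v) = resolvent T ((t : ℂ) * Complex.I) (L v))
    {w : ℂ} (hw : w.re ≠ 0) (x : V) : L (axisCauchy T w x) = axisCauchy T w (L x) := by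
  rw [h.axisCauchy_apply hw, h.axisCauchy_apply hw, map_smul, ← L.integral_comp_comm]
  · simp only [map_smul, hL]
  · exact (h.integrable_cauchy hw).apply_continuousLinearMap x

theorem commute_axisIntegral {L : V →L[ℂ] V} (hL : ∀ (t : ℝ) (v : V),
    L (resolvent T ((t : ℂ) * Complex.I) v) = resolvent T ((t : ℂ) * Complex.I) (L v)) (x : V) :
    L (Q x) = Q (L x) := by
  have h1 := (L.continuous.tendsto _).comp (h.lim x)
  have h2 := h.lim (L x)
  have h3 : (L ∘ fun N : ℝ => ∫ t in (-N)..N, resolvent T ((t : ℂ) * Complex.I) x) =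
      fun N : ℝ => ∫ t in (-N)..N, resolvent T ((t : ℂ) * Complex.I) (L x) := by
    funext N
    simp only [Function.comp_apply, ← hL]
    rw [ContinuousLinearMap.intervalIntegral_comp_comm]
    exact (h.continuous_resolvent.clm_apply continuous_const).intervalIntegrable _ _
  rw [h3] at h1
  have h4 := tendsto_nhds_unique h1 h2
  rw [map_smul] at h4
  exact smul_right_injective V (by exact_mod_cast Real.pi_ne_zero : (Real.pi : ℂ) ≠ 0) h4

theorem commute_resolvent (t : ℝ) (x : V) : Q (resolvent T ((t : ℂ) * Complex.I) x) =
    resolvent T ((t : ℂ) * Complex.I) (Q x) :=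
  (h.commute_axisIntegral (fun s v => (h.isResolventAt t).commute (h.isResolventAt s) v) x).symm

/-- This is `(T - w) F(w) x = (ε x + Q x) / 2` for the Cauchy integral `F`, with `(T - 0)⁻¹` applied
to it. The first resolvent identity against the point `0` and `it / (it - w) = 1 + w / (it - w)` put
the whole integrand under the bounded operator `(T - 0)⁻¹`, which commutes with integrals. Two of
the three integrals exist only as principal values. -/
theorem axisCauchy_eq {w ε : ℂ} (hw : w.re ≠ 0)
    (hε : Tendsto (fun N : ℝ => ∫ t in (-N)..N, ((t : ℂ) * Complex.I - w)⁻¹) atTop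
      (𝓝 (ε * Real.pi))) (x : V) :
    axisCauchy T w x = resolvent T 0 ((2 : ℂ)⁻¹ • (ε • x + Q x) + w • axisCauchy T w x) := by
  have h0 : IsResolventAt T 0 (resolvent T 0) := by simpa using h.isResolventAt 0
  have hi := (h.integrable_cauchy hw).apply_continuousLinearMap x
  have l1 := MeasureTheory.intervalIntegral_tendsto_integral hi tendsto_neg_atTop_atBot tendsto_id
  have hcF := (h.continuous_cauchy_integrand hw).clm_apply (continuous_const (y := x))
  have hcR := h.continuous_resolvent.clm_apply (continuous_const (y := x))
  have hcs : Continuous fun t : ℝ => ((t : ℂ) * Complex.I - w)⁻¹ :=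
    Continuous.inv₀ (by fun_prop) fun t => axis_sub_ne_zero t hw
  have hcx : Continuous fun t : ℝ => ((t : ℂ) * Complex.I - w)⁻¹ • x := hcs.smul continuous_const
  have hcxR : Continuous fun t : ℝ => ((t : ℂ) * Complex.I - w)⁻¹ • x +
    resolvent T ((t : ℂ) * Complex.I) x := hcx.add hcR
  have hcwF : Continuous fun t : ℝ => w • (((t : ℂ) * Complex.I - w)⁻¹ •
    resolvent T ((t : ℂ) * Complex.I)) x := hcF.const_smul w
  have hsum : Continuous fun t : ℝ => ((t : ℂ) * Complex.I - w)⁻¹ • x +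
    resolvent T ((t : ℂ) * Complex.I) x + w • (((t : ℂ) * Complex.I - w)⁻¹ •
    resolvent T ((t : ℂ) * Complex.I)) x := hcxR.add hcwF
  have key : ∀ N : ℝ, ∫ t in (-N)..(id N), (((t : ℂ) * Complex.I - w)⁻¹ •
      resolvent T ((t : ℂ) * Complex.I)) x = resolvent T 0
        ((∫ t in (-N)..N, ((t : ℂ) * Complex.I - w)⁻¹) • x +
          (∫ t in (-N)..N, resolvent T ((t : ℂ) * Complex.I) x) +
          w • ∫ t in (-N)..(id N), (((t : ℂ) * Complex.I - w)⁻¹ •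
            resolvent T ((t : ℂ) * Complex.I)) x) := by
    intro N
    rw [← intervalIntegral.integral_smul_const, ← intervalIntegral.integral_smul, id,
      ← intervalIntegral.integral_add (hcx.intervalIntegrable _ _) (hcR.intervalIntegrable _ _),
      ← intervalIntegral.integral_add (hcxR.intervalIntegrable _ _)
        (hcwF.intervalIntegrable _ _),
      ← ContinuousLinearMap.intervalIntegral_comp_comm _
        (hsum.intervalIntegrable _ _)]
    refine intervalIntegral.integral_congr fun t _ => ?_
    have h1 := (h.isResolventAt t).identity h0 x
    simp only [smul_apply, sub_zero] at h1 ⊢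
    set r := resolvent T ((t : ℂ) * Complex.I) x
    have h2 := axis_sub_ne_zero t hw
    conv_lhs => rw [h1]
    rw [← map_smul, ← map_add, ← map_smul]
    congr 1
    have h3 : ((t : ℂ) * Complex.I - w)⁻¹ * ((t : ℂ) * Complex.I) =
        1 + w * ((t : ℂ) * Complex.I - w)⁻¹ := by
      field_simp
      ring
    rw [smul_add, smul_smul, smul_smul, h3, add_smul, one_smul, add_assoc]
  have l2 := ((resolvent T 0).continuous.tendsto _).comp
    (((hε.smul_const x).add (h.lim x)).add (l1.const_smul w))
  have l3 := tendsto_nhds_unique (l1.congr key) l2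
  have e : ∫ t : ℝ, (((t : ℂ) * Complex.I - w)⁻¹ • resolvent T ((t : ℂ) * Complex.I)) x =
      (2 * Real.pi : ℂ) • axisCauchy T w x := by
    rw [h.axisCauchy_apply hw, smul_smul, mul_inv_cancel₀, one_smul]
    · rfl
    · exact_mod_cast (mul_pos two_pos Real.pi_pos).ne'
  rw [e] at l3
  have hp : (2 * Real.pi : ℂ) ≠ 0 := by exact_mod_cast (mul_pos two_pos Real.pi_pos).ne'
  refine smul_right_injective V hp ?_
  simp only
  rw [l3, ← map_smul (resolvent T 0)]
  congr 1
  module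

theorem axisCauchy_mem {w ε : ℂ} (hw : w.re ≠ 0)
    (hε : Tendsto (fun N : ℝ => ∫ t in (-N)..N, ((t : ℂ) * Complex.I - w)⁻¹) atTop
      (𝓝 (ε * Real.pi))) (x : V) :
    ∃ y : T.domain, (y : V) = axisCauchy T w x ∧
      T y - w • (y : V) = (2 : ℂ)⁻¹ • (ε • x + Q x) := by
  have h0 : IsResolventAt T 0 (resolvent T 0) := by simpa using h.isResolventAt 0
  have h1 := h.axisCauchy_eq hw hε x
  refine ⟨⟨_, h0.mem_domain ((2 : ℂ)⁻¹ • (ε • x + Q x) + w • axisCauchy T w x)⟩, h1.symm, ?_⟩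
  rw [h0.apply_eq, zero_smul, add_zero]
  simp only
  rw [← h1, add_sub_cancel_right]

theorem axisCauchy_left {w ε : ℂ} (hw : w.re ≠ 0)
    (hε : Tendsto (fun N : ℝ => ∫ t in (-N)..N, ((t : ℂ) * Complex.I - w)⁻¹) atTop
      (𝓝 (ε * Real.pi))) (x : T.domain) :
    axisCauchy T w (T x - w • (x : V)) = (2 : ℂ)⁻¹ • (ε • (x : V) + Q x) := by
  have h0 : IsResolventAt T 0 (resolvent T 0) := by simpa using h.isResolventAt 0
  have hx : resolvent T 0 (T x) = x := by simpa using h0.left_inv x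
  have hc : ∀ v, axisCauchy T w (resolvent T 0 v) = resolvent T 0 (axisCauchy T w v) := fun v =>
    (h.commute_axisCauchy (fun t u => h0.commute (h.isResolventAt t) u) hw v).symm
  have hQ : ∀ v, Q (resolvent T 0 v) = resolvent T 0 (Q v) := fun v => by
    simpa using h.commute_resolvent 0 v
  have h1 := h.axisCauchy_eq hw hε (T x)
  rw [map_sub, map_smul, h1]
  simp only [map_add, map_smul]
  rw [← hc, ← hQ, hx, add_sub_cancel_right]

end HasAxisIntegral

end Dichotomy

end Hamiltonian

end

/-! ### The involution `Q` and its spectral subspaces. -/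

noncomputable section

namespace Hamiltonian

section Dichotomy

variable {V : Type*} [NormedAddCommGroup V] [NormedSpace ℂ V] [CompleteSpace V]

namespace HasAxisIntegral

variable {T : V →ₗ.[ℂ] V} {M : ℝ} {Q : V →L[ℂ] V} (h : HasAxisIntegral T M Q)
include h

theorem differentiableAt_axisCauchy {w : ℂ} (hw : w.re ≠ 0) :
    DifferentiableAt ℂ (axisCauchy T) w := by
  have hpos : 0 < |w.re| := abs_pos.2 hw
  set δ := |w.re| / 2 with hδ
  have hδ0 : 0 < δ := by positivity
  have hball : ∀ v ∈ Metric.ball w δ, δ ≤ |v.re| := fun v hv => by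
    rw [mem_ball_iff_norm] at hv
    have h1 := (Complex.abs_re_le_norm (v - w)).trans hv.le
    have h2 := abs_sub_abs_le_abs_sub w.re v.re
    rw [Complex.sub_re, abs_sub_comm] at h1
    linarith
  have hne : ∀ v ∈ Metric.ball w δ, v.re ≠ 0 := fun v hv =>
    abs_pos.1 (hδ0.trans_le (hball v hv))
  have key := hasDerivAt_integral_of_dominated_loc_of_deriv_le
    (μ := MeasureTheory.volume)
    (F := fun (v : ℂ) (t : ℝ) => ((t : ℂ) * Complex.I - v)⁻¹ • resolvent T ((t : ℂ) * Complex.I))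
    (F' := fun (v : ℂ) (t : ℝ) =>
      (((t : ℂ) * Complex.I - v) ^ 2)⁻¹ • resolvent T ((t : ℂ) * Complex.I))
    (x₀ := w) (s := Metric.ball w δ)
    (bound := fun t => 4 * ((1 + (|w.re| ^ 2)⁻¹) * (1 + (t - w.im) ^ 2)⁻¹) * M)
    (Metric.ball_mem_nhds w hδ0)
    (by
      filter_upwards [Metric.ball_mem_nhds w hδ0] with v hv
      exact (h.continuous_cauchy_integrand (hne v hv)).aestronglyMeasurable)
    (h.integrable_cauchy hw)
    (by
      refine Continuous.aestronglyMeasurable ?_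
      exact (Continuous.inv₀ (by fun_prop) fun t =>
        pow_ne_zero 2 (axis_sub_ne_zero t hw)).smul h.continuous_resolvent)
    (by
      refine Eventually.of_forall fun t v hv => ?_
      rw [norm_smul, norm_inv, norm_pow]
      have h1 := inv_norm_axis_sub_sq_le t hpos (le_refl |w.re|)
      -- A ball of half the distance to the axis keeps the kernel comparable to its value at the
      -- centre; squaring gives the factor `4` in the dominating function.
      have h2 : ‖(t : ℂ) * Complex.I - w‖ / 2 ≤ ‖(t : ℂ) * Complex.I - v‖ := by
        have e1 : |w.re| ≤ ‖(t : ℂ) * Complex.I - w‖ := by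
          have := Complex.abs_re_le_norm ((t : ℂ) * Complex.I - w)
          simpa using this
        have e2 := norm_sub_norm_le ((t : ℂ) * Complex.I - w) ((t : ℂ) * Complex.I - v)
        rw [sub_sub_sub_cancel_left] at e2
        rw [mem_ball_iff_norm] at hv
        linarith
      have h3 : 0 < ‖(t : ℂ) * Complex.I - w‖ := norm_pos_iff.2 (axis_sub_ne_zero t hw)
      have h4 : ‖resolvent T ((t : ℂ) * Complex.I)‖ ≤ M := by
        refine (h.bound t).trans (div_le_self h.nonneg ?_)
        linarith [abs_nonneg t]
      have h5 : (‖(t : ℂ) * Complex.I - v‖ ^ 2)⁻¹ ≤ 4 * (‖(t : ℂ) * Complex.I - w‖ ^ 2)⁻¹ := by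
        calc (‖(t : ℂ) * Complex.I - v‖ ^ 2)⁻¹ ≤ ((‖(t : ℂ) * Complex.I - w‖ / 2) ^ 2)⁻¹ := by
              gcongr
          _ = 4 * (‖(t : ℂ) * Complex.I - w‖ ^ 2)⁻¹ := by field_simp; norm_num
      calc (‖(t : ℂ) * Complex.I - v‖ ^ 2)⁻¹ * ‖resolvent T ((t : ℂ) * Complex.I)‖
          ≤ (4 * (‖(t : ℂ) * Complex.I - w‖ ^ 2)⁻¹) * M := by gcongr
        _ ≤ _ := by gcongr; exact h.nonneg)
    ((((integrable_inv_one_add_sub_sq w.im).const_mul _).const_mul _).mul_const _)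
    (by
      refine Eventually.of_forall fun t v hv => ?_
      have h1 : HasDerivAt (fun v : ℂ => (t : ℂ) * Complex.I - v) (-1) v := by
        simpa using (hasDerivAt_id v).const_sub ((t : ℂ) * Complex.I)
      have h2 := (h1.inv (axis_sub_ne_zero t (hne v hv))).smul_const
        (resolvent T ((t : ℂ) * Complex.I))
      rwa [neg_neg, one_div] at h2)
  exact (key.2.const_smul (2 * Real.pi : ℂ)⁻¹).differentiableAt

/-- The axis bound is uniform, so the Neumann radius is too. The `M + 1` covers `M = 0`, and `|z.re|
* M ≤ 1 / 2` yields the resolvent bound `2 * M` by absorption. -/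
theorem exists_gap : ∃ δ : ℝ, 0 < δ ∧ ∃ K : ℝ, ∀ z : ℂ, |z.re| < δ →
    z ∈ resolventSet T ∧ ‖resolvent T z‖ ≤ K := by
  have hM := h.nonneg
  refine ⟨(2 * (M + 1))⁻¹, by positivity, 2 * M, fun z hz => ?_⟩
  have hR := h.isResolventAt z.im
  have hn : ‖resolvent T ((z.im : ℂ) * Complex.I)‖ ≤ M := by
    refine (h.bound _).trans (div_le_self hM ?_)
    linarith [abs_nonneg z.im]
  have hzn : ‖z - (z.im : ℂ) * Complex.I‖ = |z.re| := by
    rw [sub_eq_of_eq_add (Complex.re_add_im z).symm, Complex.norm_real, Real.norm_eq_abs]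
  have hlt : |z.re| * M ≤ 1 / 2 := by
    calc |z.re| * M ≤ (2 * (M + 1))⁻¹ * M := by gcongr
      _ ≤ (2 * (M + 1))⁻¹ * (M + 1) := by gcongr; linarith
      _ = 1 / 2 := by field_simp
  obtain ⟨U, -, hU⟩ := hR.nearby (w := z) (by
    rw [hzn]
    calc _ ≤ |z.re| * M := by gcongr
      _ < 1 := by linarith)
  refine ⟨hU.mem, ContinuousLinearMap.opNorm_le_bound _ (by positivity) fun v => ?_⟩
  have h1 := (isResolventAt_resolvent hU.mem).identity hR v
  have h2 : ‖resolvent T z v‖ ≤ M * ‖v‖ + |z.re| * (M * ‖resolvent T z v‖) := by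
    conv_lhs => rw [h1]
    refine (norm_add_le _ _).trans ?_
    rw [norm_smul, hzn]
    gcongr
    · exact ContinuousLinearMap.le_of_opNorm_le _ hn _
    · exact ContinuousLinearMap.le_of_opNorm_le _ hn _
  nlinarith [norm_nonneg (resolvent T z v)]

theorem axisCauchy_mem_neg {w : ℂ} (hw : w.re < 0) (x : V) :
    ∃ y : T.domain, (y : V) = axisCauchy T w x ∧ T y - w • (y : V) = (2 : ℂ)⁻¹ • (x + Q x) := by
  simpa using h.axisCauchy_mem (ε := 1) hw.ne
    (by simpa using tendsto_integral_inv_sub_of_neg hw) x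

theorem axisCauchy_mem_pos {w : ℂ} (hw : 0 < w.re) (x : V) :
    ∃ y : T.domain, (y : V) = axisCauchy T w x ∧ T y - w • (y : V) = (2 : ℂ)⁻¹ • (-x + Q x) := by
  simpa using h.axisCauchy_mem (ε := -1) hw.ne'
    (by simpa using tendsto_integral_inv_sub_of_pos hw) x

theorem axisCauchy_left_neg {w : ℂ} (hw : w.re < 0) (x : T.domain) :
    axisCauchy T w (T x - w • (x : V)) = (2 : ℂ)⁻¹ • ((x : V) + Q x) := by
  simpa using h.axisCauchy_left (ε := 1) hw.ne
    (by simpa using tendsto_integral_inv_sub_of_neg hw) x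

theorem axisCauchy_left_pos {w : ℂ} (hw : 0 < w.re) (x : T.domain) :
    axisCauchy T w (T x - w • (x : V)) = (2 : ℂ)⁻¹ • (-(x : V) + Q x) := by
  simpa using h.axisCauchy_left (ε := -1) hw.ne'
    (by simpa using tendsto_integral_inv_sub_of_pos hw) x

/-- `Q` is an involution: the projections `(1 ± Q) / 2` annihilate each other, since
`(T - w)⁻¹ (1 + Q) (1 - Q)` extends to a bounded entire function. -/
theorem involutive (x : V) : Q (Q x) = x := by
  obtain ⟨δ, hδ, K, hgap⟩ := h.exists_gap
  let P : V →L[ℂ] V := (2 : ℂ)⁻¹ • (1 + Q)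
  let P' : V →L[ℂ] V := (2 : ℂ)⁻¹ • (1 - Q)
  have hP : ∀ v, P v = (2 : ℂ)⁻¹ • (v + Q v) := fun v => rfl
  have hP' : ∀ v, P' v = (2 : ℂ)⁻¹ • (v - Q v) := fun v => rfl
  have hcomm : ∀ v, P (P' v) = P' (P v) := fun v => by
    rw [hP, hP', hP', hP]
    simp only [map_smul, map_add, map_sub]
    module
  have hneg : ∀ w : ℂ, w.re < 0 → |w.re| < δ → ∀ v, axisCauchy T w v = resolvent T w (P v) := by
    intro w hw hwδ v
    obtain ⟨y, hy, hy'⟩ := h.axisCauchy_mem_neg hw v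
    rw [hP, ← hy', ← hy, (isResolventAt_resolvent (hgap w hwδ).1).left_inv]
  have hpos : ∀ w : ℂ, 0 < w.re → |w.re| < δ → ∀ v,
      -axisCauchy T w v = resolvent T w (P' v) := by
    intro w hw hwδ v
    obtain ⟨y, hy, hy'⟩ := h.axisCauchy_mem_pos hw v
    have : P' v = -(T y - w • (y : V)) := by rw [hP', hy']; module
    rw [this, map_neg, ← hy, (isResolventAt_resolvent (hgap w hwδ).1).left_inv]
  -- Three expressions for `(T - w)⁻¹ P P'`. Inside the strip the Cauchy integral is `(T - w)⁻¹ P`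
  -- on the left and `-(T - w)⁻¹ P'` on the right, so they agree on overlaps and define an entire
  -- function.
  let Φ : ℂ → V →L[ℂ] V := fun w =>
    if |w.re| < δ then resolvent T w * (P * P')
    else if w.re < 0 then axisCauchy T w * P' else -(axisCauchy T w * P)
  have Φ_gap : ∀ w : ℂ, |w.re| < δ → Φ w = resolvent T w * (P * P') := fun w hw => if_pos hw
  have Φ_neg : ∀ w : ℂ, w.re < 0 → Φ w = axisCauchy T w * P' := fun w hw => by
    by_cases hwδ : |w.re| < δ
    · rw [Φ_gap w hwδ]
      ext v
      exact (hneg w hw hwδ (P' v)).symm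
    · simp only [Φ, if_neg hwδ, if_pos hw]
  have Φ_pos : ∀ w : ℂ, 0 < w.re → Φ w = -(axisCauchy T w * P) := fun w hw => by
    by_cases hwδ : |w.re| < δ
    · rw [Φ_gap w hwδ]
      ext v
      exact (congrArg _ (hcomm v)).trans (hpos w hw hwδ (P v)).symm
    · simp only [Φ, if_neg hwδ, if_neg hw.not_gt]
  have hdiff : Differentiable ℂ Φ := by
    intro w
    rcases lt_trichotomy w.re 0 with hw | hw | hw
    · have hev : Φ =ᶠ[𝓝 w] fun w => axisCauchy T w * P' := by
        filter_upwards [(isOpen_lt Complex.continuous_re continuous_const).mem_nhds hw] with v hv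
        exact Φ_neg v hv
      exact ((h.differentiableAt_axisCauchy hw.ne).mul_const P').congr_of_eventuallyEq hev
    · have hwδ : |w.re| < δ := by rwa [hw, abs_zero]
      have hev : Φ =ᶠ[𝓝 w] fun w => resolvent T w * (P * P') := by
        filter_upwards [(isOpen_lt Complex.continuous_re.abs continuous_const).mem_nhds hwδ]
          with v hv
        exact Φ_gap v hv
      exact ((differentiableAt_resolvent (hgap w hwδ).1).mul_const _).congr_of_eventuallyEq hev
    · have hev : Φ =ᶠ[𝓝 w] fun w => -(axisCauchy T w * P) := by
        filter_upwards [(isOpen_lt continuous_const Complex.continuous_re).mem_nhds hw] with v hv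
        exact Φ_pos v hv
      exact ((h.differentiableAt_axisCauchy hw.ne').mul_const P).neg.congr_of_eventuallyEq hev
  have hbdd : Bornology.IsBounded (Set.range Φ) := by
    rw [isBounded_iff_forall_norm_le]
    set K' := M / 2 * (1 + (δ ^ 2)⁻¹)
    refine ⟨max (K * ‖P * P'‖) (max (K' * ‖P'‖) (K' * ‖P‖)), ?_⟩
    rintro _ ⟨w, rfl⟩
    by_cases hwδ : |w.re| < δ
    · rw [Φ_gap w hwδ]
      refine le_max_of_le_left ((norm_mul_le _ _).trans ?_)
      gcongr
      exact (hgap w hwδ).2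
    · have hF := h.norm_axisCauchy_le hδ (not_lt.1 hwδ)
      rcases lt_or_ge w.re 0 with hw | hw
      · rw [Φ_neg w hw]
        refine le_max_of_le_right (le_max_of_le_left ((norm_mul_le _ _).trans ?_))
        gcongr
      · have hw' : 0 < w.re := lt_of_le_of_ne hw fun e => hwδ (by rwa [← e, abs_zero])
        rw [Φ_pos w hw', norm_neg]
        refine le_max_of_le_right (le_max_of_le_right ((norm_mul_le _ _).trans ?_))
        gcongr
  have hconst : ∀ t : ℝ, Φ 0 = Φ ((t : ℂ) * Complex.I) := fun t =>
    hdiff.apply_eq_apply_of_bounded hbdd _ _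
  -- By Liouville `Φ` is constant, and it decays along the imaginary axis.
  have hzero : Φ 0 = 0 := by
    have hl : Tendsto (fun t : ℝ => M * t⁻¹ * ‖P * P'‖) atTop (𝓝 0) := by
      simpa using (tendsto_inv_atTop_zero.const_mul M).mul_const ‖P * P'‖
    rw [← norm_le_zero_iff]
    refine ge_of_tendsto hl ?_
    filter_upwards [eventually_gt_atTop 0] with t ht
    rw [hconst t, Φ_gap _ (by simpa using hδ)]
    refine (norm_mul_le _ _).trans ?_
    gcongr
    refine (h.bound t).trans ?_
    rw [div_eq_mul_inv]
    have := h.nonneg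
    gcongr
    rw [abs_of_pos ht]; linarith
  have h0 : IsResolventAt T 0 (resolvent T 0) := by simpa using h.isResolventAt 0
  have hPP : P (P' x) = 0 := by
    apply h0.injective
    rw [map_zero]
    rw [Φ_gap 0 (by simpa using hδ)] at hzero
    exact congrArg (fun L : V →L[ℂ] V => L x) hzero
  rw [hP, hP'] at hPP
  have h4 : (4 : ℂ)⁻¹ • (x - Q (Q x)) = 0 := by
    rw [← hPP]
    simp only [map_smul, map_sub]
    module
  rw [smul_eq_zero_iff_right (by norm_num), sub_eq_zero] at h4
  exact h4.symm

end HasAxisIntegral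

/-- The eigenspace of a bounded operator. -/
def eigen (Q : V →L[ℂ] V) (τ : ℂ) : Submodule ℂ V := Module.End.eigenspace (Q : V →ₗ[ℂ] V) τ

omit [CompleteSpace V] in
theorem mem_eigen {Q : V →L[ℂ] V} {τ : ℂ} {x : V} : x ∈ eigen Q τ ↔ Q x = τ • x :=
  Module.End.mem_eigenspace_iff

omit [CompleteSpace V] in
theorem isClosed_eigen (Q : V →L[ℂ] V) (τ : ℂ) : IsClosed (eigen Q τ : Set V) := by
  have : (eigen Q τ : Set V) = {x | Q x = τ • x} := Set.ext fun x => mem_eigen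
  rw [this]
  exact isClosed_eq Q.continuous (continuous_const_smul τ)

namespace HasAxisIntegral

variable {T : V →ₗ.[ℂ] V} {M : ℝ} {Q : V →L[ℂ] V} (h : HasAxisIntegral T M Q)
include h

theorem isInvariant_eigen (τ : ℂ) : IsInvariant T (eigen Q τ) := by
  intro x hx
  rw [mem_eigen] at hx ⊢
  obtain ⟨y, hy, hy'⟩ := (h.isResolventAt 0).commute_apply (h.commute_resolvent 0) x
  rw [← hy', ← T.map_smul]
  congr 1
  exact Subtype.ext (hy.trans hx)

theorem resolvent_mem_eigen {τ : ℂ} (t : ℝ) {x : V} (hx : x ∈ eigen Q τ) :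
    resolvent T ((t : ℂ) * Complex.I) x ∈ eigen Q τ := by
  rw [mem_eigen] at hx ⊢
  rw [h.commute_resolvent, hx, map_smul]

theorem imaginary_mem_restrict (τ : ℂ) (t : ℝ) :
    (t : ℂ) * Complex.I ∈ resolventSet (restrict T (eigen Q τ) (h.isInvariant_eigen τ)) :=
  IsResolventAt.mem_restrict _ (fun _ hv => h.resolvent_mem_eigen t hv)
    (fun v _ => ⟨⟨_, (h.isResolventAt t).mem_domain v⟩, rfl, (h.isResolventAt t).right_inv v⟩)
    (fun x _ => (h.isResolventAt t).left_inv x)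

theorem commute_Q_axisCauchy {w : ℂ} (hw : w.re ≠ 0) (x : V) :
    Q (axisCauchy T w x) = axisCauchy T w (Q x) :=
  h.commute_axisCauchy (h.commute_resolvent) hw x

theorem axisCauchy_mem_eigen {τ w : ℂ} (hw : w.re ≠ 0) {x : V} (hx : x ∈ eigen Q τ) :
    axisCauchy T w x ∈ eigen Q τ := by
  rw [mem_eigen] at hx ⊢
  rw [h.commute_Q_axisCauchy hw, hx, map_smul]

/-- The projections are `(1 ± Q) / 2`. The Cauchy integral inverts `T - w` up to these projections:
it is the resolvent on the eigenspace of `1` for `w.re < 0`, and its negative is the resolvent on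
that of `-1` for `w.re > 0`. On the axis itself the resolvent of `T` restricts, as it commutes with
`Q`. -/
theorem isSpectralDecomposition (hd : Dense (T.domain : Set V)) :
    IsSpectralDecomposition T (eigen Q 1) (eigen Q (-1)) where
  dense := hd
  isClosed_pos := isClosed_eigen Q 1
  isClosed_neg := isClosed_eigen Q (-1)
  isCompl := by
    constructor
    · rw [Submodule.disjoint_def]
      intro x hx hx'
      rw [mem_eigen] at hx hx'
      rw [hx, one_smul, neg_smul, one_smul] at hx'
      have h2 : (2 : ℂ) • x = 0 := by rw [two_smul]; nth_rewrite 1 [hx']; exact neg_add_cancel x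
      simpa using h2
    · rw [codisjoint_iff, Submodule.eq_top_iff']
      intro x
      rw [Submodule.mem_sup]
      refine ⟨(2 : ℂ)⁻¹ • (x + Q x), ?_, (2 : ℂ)⁻¹ • (x - Q x), ?_, by module⟩
      · rw [mem_eigen, map_smul, map_add, h.involutive]; module
      · rw [mem_eigen, map_smul, map_sub, h.involutive]; module
  gap := by
    obtain ⟨δ, hδ, K, hgap⟩ := h.exists_gap
    exact ⟨δ, hδ, fun z hz => (hgap z hz).1⟩
  invariant_pos := h.isInvariant_eigen 1
  invariant_neg := h.isInvariant_eigen (-1)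
  spectrum_pos := by
    intro w hw
    by_contra hre
    refine hw ?_
    rcases (not_lt.1 (show ¬ 0 < w.re from hre)).lt_or_eq with hlt | heq
    · refine IsResolventAt.mem_restrict _ (L := axisCauchy T w)
        (fun v hv => h.axisCauchy_mem_eigen hlt.ne hv) (fun v hv => ?_) (fun x hx => ?_)
      · obtain ⟨y, hy, hy'⟩ := h.axisCauchy_mem_neg hlt v
        refine ⟨y, hy, hy'.trans ?_⟩
        rw [mem_eigen.1 hv]; module
      · rw [h.axisCauchy_left_neg hlt, mem_eigen.1 hx]; module
    · have : w = (w.im : ℂ) * Complex.I := by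
        apply Complex.ext <;> simp [heq]
      rw [this]
      exact h.imaginary_mem_restrict 1 w.im
  spectrum_neg := by
    intro w hw
    by_contra hre
    refine hw ?_
    rcases (not_lt.1 (show ¬ w.re < 0 from hre)).lt_or_eq with hlt | heq
    · refine IsResolventAt.mem_restrict _ (L := -axisCauchy T w)
        (fun v hv => Submodule.neg_mem _ (h.axisCauchy_mem_eigen hlt.ne' hv))
        (fun v hv => ?_) (fun x hx => ?_)
      · obtain ⟨y, hy, hy'⟩ := h.axisCauchy_mem_pos hlt v
        refine ⟨-y, by simp [hy], ?_⟩
        have : T (-y) - w • ((-y : T.domain) : V) = -(T y - w • (y : V)) := by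
          rw [T.map_neg, Submodule.coe_neg]; module
        rw [this, hy', mem_eigen.1 hv]; module
      · rw [neg_apply, h.axisCauchy_left_pos hlt, mem_eigen.1 hx]; module
    · have : w = (w.im : ℂ) * Complex.I := by
        apply Complex.ext <;> simp [← heq]
      rw [this]
      exact h.imaginary_mem_restrict (-1) w.im
  integral := by
    intro u hu v hv
    have h1 := (h.lim (u + v)).const_smul (Real.pi : ℂ)⁻¹
    have hpi : (Real.pi : ℂ) ≠ 0 := by exact_mod_cast Real.pi_ne_zero
    rw [map_add, mem_eigen.1 hu, mem_eigen.1 hv, smul_smul, inv_mul_cancel₀ hpi, one_smul, one_smul,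
      neg_smul, one_smul, ← sub_eq_add_neg] at h1
    refine h1.congr fun N => ?_
    rw [intervalIntegral.integral_smul, smul_smul]
    congr 1
    field_simp

end HasAxisIntegral

end Dichotomy

end Hamiltonian

end

/-! ### Axis integrals of sectorial operators, their negatives and adjoints. -/

noncomputable section

namespace Hamiltonian

section Axis

variable {V : Type*} [NormedAddCommGroup V] [NormedSpace ℂ V]

theorem IsResolventAt.neg {S : V →ₗ.[ℂ] V} {z : ℂ} {R : V →L[ℂ] V} (h : IsResolventAt S z R) :
    IsResolventAt (-S) (-z) (-R) := by
  have hm : ∀ v, (-R) v ∈ (-S).domain := fun v => S.domain.neg_mem (h.mem_domain v)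
  refine ⟨hm, fun v => ?_, fun x => ?_⟩
  · have h1 := S.map_neg ⟨R v, h.mem_domain v⟩
    have h2 : (-S) ⟨(-R) v, hm v⟩ = S ⟨R v, h.mem_domain v⟩ := by
      rw [LinearPMap.neg_apply]
      exact (congrArg Neg.neg h1).trans (neg_neg _)
    rw [h2, h.apply_eq, neg_apply]
    module
  · have h1 := h.left_inv x
    rw [LinearPMap.neg_apply, neg_apply, ← map_neg]
    refine Eq.trans ?_ h1
    congr 1
    module

theorem mem_resolventSet_neg {S : V →ₗ.[ℂ] V} {z : ℂ} (h : z ∈ resolventSet S) :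
    -z ∈ resolventSet (-S) :=
  (isResolventAt_resolvent h).neg.mem

theorem resolvent_neg {S : V →ₗ.[ℂ] V} {z : ℂ} (h : z ∈ resolventSet S) :
    resolvent (-S) (-z) = -resolvent S z :=
  (isResolventAt_resolvent h).neg.resolvent_eq

theorem HasAxisIntegral.neg {S : V →ₗ.[ℂ] V} {M : ℝ} {Q : V →L[ℂ] V}
    (h : HasAxisIntegral S M Q) : HasAxisIntegral (-S) M (-Q) := by
  have e : ∀ t : ℝ, (t : ℂ) * Complex.I = -(((-t : ℝ) : ℂ) * Complex.I) := fun t => by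
    push_cast; ring
  refine ⟨fun t => ?_, fun t => ?_, fun x => ?_⟩
  · rw [e]; exact mem_resolventSet_neg (h.mem _)
  · rw [e, resolvent_neg (h.mem _), norm_neg, ← abs_neg]
    exact h.bound _
  · have h1 := (h.lim x).neg
    rw [neg_apply, smul_neg]
    refine h1.congr fun N => ?_
    have h2 := intervalIntegral.integral_comp_neg (a := -N) (b := N)
      (fun t : ℝ => resolvent S ((t : ℂ) * Complex.I) x)
    rw [neg_neg] at h2
    rw [← h2, ← intervalIntegral.integral_neg]
    refine intervalIntegral.integral_congr fun t _ => ?_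
    rw [e t, resolvent_neg (h.mem _), neg_apply]

variable [CompleteSpace V]

/-- Decay `M / ‖z‖` says nothing near `0`, so continuity on the compact interval `|t| ≤ 1` supplies
the bound there; for `|t| ≥ 1` one has `1 + |t| ≤ 2 |t|`. -/
theorem hasAxisIntegral_of_left {S : V →ₗ.[ℂ] V} (hS : Dense (S.domain : Set V))
    (hρ : ∀ z : ℂ, z.re ≤ 0 → z ∈ resolventSet S) {M : ℝ}
    (hM : ∀ z : ℂ, z.re ≤ 0 → z ≠ 0 → ‖resolvent S z‖ ≤ M / ‖z‖) :
    ∃ M' : ℝ, HasAxisIntegral S M' 1 := by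
  have hmem : ∀ t : ℝ, (t : ℂ) * Complex.I ∈ resolventSet S := fun t => hρ _ (by simp)
  have hc := (continuous_resolvent_imaginary hmem).norm
  obtain ⟨K, hK⟩ := (isCompact_Icc (a := (-1 : ℝ)) (b := 1)).exists_bound_of_continuousOn
    hc.continuousOn
  refine ⟨2 * max K M, hmem, fun t => ?_, fun x => ?_⟩
  · have hpos : 0 < 1 + |t| := by positivity
    rw [le_div_iff₀ hpos]
    rcases le_total |t| 1 with ht | ht
    · have h1 := hK t (abs_le.1 ht)
      rw [norm_norm] at h1
      have h2 : 0 ≤ K := (norm_nonneg _).trans h1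
      calc _ ≤ K * 2 := by gcongr; linarith
        _ ≤ 2 * max K M := by linarith [le_max_left K M]
    · have h1 := hM ((t : ℂ) * Complex.I) (by simp) (by
        rw [← norm_pos_iff, norm_mul, Complex.norm_I, mul_one, Complex.norm_real]
        exact one_pos.trans_le ht)
      rw [norm_mul, Complex.norm_I, mul_one, Complex.norm_real, Real.norm_eq_abs,
        le_div_iff₀ (by linarith)] at h1
      have h2 := norm_nonneg (resolvent S ((t : ℂ) * Complex.I))
      calc _ ≤ ‖resolvent S ((t : ℂ) * Complex.I)‖ * (2 * |t|) := by gcongr; linarith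
        _ ≤ 2 * M := by linarith
        _ ≤ 2 * max K M := by linarith [le_max_right K M]
  · simpa using tendsto_integral_resolvent hS hρ hM x

omit [CompleteSpace V] in
/-- A sectorial operator of angle `< π / 2` with `iℝ ⊆ ϱ(S)`: its resolvent in the closed left
half-plane. -/
theorem IsSectorial.left {S : V →ₗ.[ℂ] V} {θ : ℝ} (hS : IsSectorial S θ) (hθ : θ < Real.pi / 2)
    (hI : ∀ t : ℝ, (t : ℂ) * Complex.I ∈ resolventSet S) :
    (∀ z : ℂ, z.re ≤ 0 → z ∈ resolventSet S) ∧ ∃ M : ℝ,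
      ∀ z : ℂ, z.re ≤ 0 → z ≠ 0 → ‖resolvent S z‖ ≤ M / ‖z‖ := by
  have harg : ∀ z : ℂ, z.re ≤ 0 → z ≠ 0 → Real.pi / 2 ≤ |Complex.arg z| := by
    intro z hz hz0
    rcases hz.lt_or_eq with hlt | heq
    · by_contra hcon
      exact absurd (Complex.abs_arg_le_pi_div_two_iff.1 (not_le.1 hcon).le) (not_le.2 hlt)
    · have him : z.im ≠ 0 := fun h => hz0 (Complex.ext heq h)
      rcases him.lt_or_gt with h | h
      · rw [Complex.arg_eq_neg_pi_div_two_iff.2 ⟨heq, h⟩, abs_neg]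
        exact le_abs_self _
      · rw [Complex.arg_eq_pi_div_two_iff.2 ⟨heq, h⟩]
        exact le_abs_self _
  constructor
  · intro z hz
    by_cases hz0 : z = 0
    · simpa [hz0] using hI 0
    · by_contra hcon
      have := hS.spectrum_subset hcon
      exact absurd (this.trans_lt hθ) (not_lt.2 (harg z hz hz0))
  · obtain ⟨M, -, hM⟩ := hS.resolvent_bound (Real.pi / 2) hθ (by linarith [Real.pi_pos])
    exact ⟨M, fun z hz hz0 => hM z (harg z hz hz0) (norm_pos_iff.2 hz0)⟩

end Axis

section Adjoint

variable {H : Type*} [NormedAddCommGroup H] [InnerProductSpace ℂ H] [CompleteSpace H]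

theorem IsResolventAt.adjoint {S : H →ₗ.[ℂ] H} (hS : Dense (S.domain : Set H)) {z : ℂ}
    {R : H →L[ℂ] H} (h : IsResolventAt S z R) :
    IsResolventAt S.adjoint (starRingEnd ℂ z) (ContinuousLinearMap.adjoint R) := by
  have hin : ∀ (v : H) (x : S.domain),
      inner ℂ (v + starRingEnd ℂ z • ContinuousLinearMap.adjoint R v) (x : H) =
        inner ℂ (ContinuousLinearMap.adjoint R v) (S x) := fun v x => by
    rw [inner_add_left, inner_smul_left, ContinuousLinearMap.adjoint_inner_left,
      ContinuousLinearMap.adjoint_inner_left, RCLike.conj_conj]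
    have h1 := h.left_inv x
    rw [map_sub, map_smul, sub_eq_iff_eq_add] at h1
    rw [h1, inner_add_right, inner_smul_right]
  have hm : ∀ v, ContinuousLinearMap.adjoint R v ∈ S.adjoint.domain := fun v =>
    LinearPMap.mem_adjoint_domain_of_exists _ ⟨_, hin v⟩
  refine ⟨hm, fun v => ?_, fun y => ?_⟩
  · rw [LinearPMap.adjoint_apply_eq hS _ (hin v), add_sub_cancel_right]
  · refine ext_inner_right ℂ fun v => ?_
    rw [ContinuousLinearMap.adjoint_inner_left, inner_sub_left, inner_smul_left, RCLike.conj_conj]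
    have h1 := LinearPMap.adjoint_isFormalAdjoint hS y ⟨R v, h.mem_domain v⟩
    rw [h1, ← inner_smul_right, ← inner_sub_right, h.right_inv]

theorem mem_resolventSet_adjoint {S : H →ₗ.[ℂ] H} (hS : Dense (S.domain : Set H)) {z : ℂ}
    (h : starRingEnd ℂ z ∈ resolventSet S) : z ∈ resolventSet S.adjoint := by
  have := ((isResolventAt_resolvent h).adjoint hS).mem
  rwa [Complex.conj_conj] at this

theorem resolvent_adjoint {S : H →ₗ.[ℂ] H} (hS : Dense (S.domain : Set H)) {z : ℂ}
    (h : starRingEnd ℂ z ∈ resolventSet S) :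
    resolvent S.adjoint z = ContinuousLinearMap.adjoint (resolvent S (starRingEnd ℂ z)) := by
  have := ((isResolventAt_resolvent h).adjoint hS).resolvent_eq
  rwa [Complex.conj_conj] at this

/-- One inclusion is formal; applied to `-S` it gives the other. -/
theorem adjoint_neg {S : H →ₗ.[ℂ] H} (hS : Dense (S.domain : Set H)) :
    (-S).adjoint = -S.adjoint := by
  have hS' : Dense ((-S).domain : Set H) := hS
  have aux : ∀ {S : H →ₗ.[ℂ] H}, Dense (S.domain : Set H) →
      (-S.adjoint) ≤ (-S).adjoint := fun {S} hS =>
    LinearPMap.IsFormalAdjoint.le_adjoint (T := -S) (S := -S.adjoint) (show Dense _ from hS)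
      (fun y x => by
        rw [LinearPMap.neg_apply, LinearPMap.neg_apply, inner_neg_left, inner_neg_right]
        exact congrArg Neg.neg ((LinearPMap.adjoint_isFormalAdjoint hS).symm y x))
  refine le_antisymm ?_ (aux hS)
  have h1 := aux hS'
  rw [neg_neg] at h1
  refine ⟨h1.1, fun x y hxy => ?_⟩
  have h2 := h1.2 (x := x) (y := y) hxy
  rw [LinearPMap.neg_apply] at h2
  rw [LinearPMap.neg_apply, ← h2, neg_neg]

/-- The resolvent of the adjoint at `z` is the adjoint of the resolvent at the conjugate of `z`. The
left half-plane is symmetric under conjugation, so the adjoint satisfies the same bounds and its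
negative gets the opposite sign. -/
theorem IsSectorial.axis {S : H →ₗ.[ℂ] H} {θ : ℝ} (hS : IsSectorial S θ) (hθ : θ < Real.pi / 2)
    (hI : ∀ t : ℝ, (t : ℂ) * Complex.I ∈ resolventSet S)
    (hS' : Dense (S.adjoint.domain : Set H)) :
    ∃ M : ℝ, HasAxisIntegral S M 1 ∧ HasAxisIntegral (-S.adjoint) M (-1) := by
  obtain ⟨hρ, M, hM⟩ := hS.left hθ hI
  obtain ⟨M₁, h1⟩ := hasAxisIntegral_of_left hS.dense hρ hM
  have hre : ∀ z : ℂ, z.re ≤ 0 → (starRingEnd ℂ z).re ≤ 0 := fun z hz => by simpa using hz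
  obtain ⟨M₂, h2⟩ := hasAxisIntegral_of_left hS'
    (fun z hz => mem_resolventSet_adjoint hS.dense (hρ _ (hre z hz))) (M := M)
    (fun z hz hz0 => by
      rw [resolvent_adjoint hS.dense (hρ _ (hre z hz)), LinearIsometryEquiv.norm_map,
        ← Complex.norm_conj z]
      exact hM _ (hre z hz) (by simpa using hz0))
  have mono : ∀ {S' : H →ₗ.[ℂ] H} {M' M'' : ℝ} {Q : H →L[ℂ] H}, M' ≤ M'' →
      HasAxisIntegral S' M' Q → HasAxisIntegral S' M'' Q := fun hle h =>
    ⟨h.mem, fun t => (h.bound t).trans (by gcongr), h.lim⟩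
  exact ⟨max M₁ M₂, mono (le_max_left _ _) h1, (mono (le_max_right _ _) h2).neg⟩

end Adjoint

end Hamiltonian

end

/-! ### Subordination, nonnegative forms and block diagonal operators. -/

noncomputable section

namespace Hamiltonian

section Subordinate

variable {V W : Type*} [NormedAddCommGroup V] [NormedSpace ℂ V]
  [NormedAddCommGroup W] [NormedSpace ℂ W]

/-- Along the imaginary axis, a `p`-subordinate operator is small relative to `S - it`. -/
theorem HasAxisIntegral.subordinate {S : V →ₗ.[ℂ] V} {M : ℝ} {Q : V →L[ℂ] V}
    (h : HasAxisIntegral S M Q) {R : V →ₗ.[ℂ] W} {p : ℝ} (hp0 : 0 ≤ p) (hp : p < 1)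
    (hR : IsSubordinate R S p) : ∃ k : ℝ, 0 < k ∧ ∀ (t : ℝ) (x : S.domain) (y : R.domain),
      (y : V) = x → ‖R y‖ ≤ k * (1 + |t|) ^ (p - 1) * ‖S x - ((t : ℂ) * Complex.I) • (x : V)‖ := by
  obtain ⟨hD, c, hc, hb⟩ := hR
  have hM := h.nonneg
  -- With `η = (S - it) x` one has `‖x‖ ≤ M / (1 + |t|) * ‖η‖` and `‖S x‖ ≤ (1 + M) * ‖η‖`;
  -- inserting both into the interpolation inequality gives the constant, and the `1` only makes it
  -- positive.
  refine ⟨c * M ^ (1 - p) * (1 + M) ^ p + 1, by positivity, fun t x y hxy => ?_⟩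
  have hy : y = ⟨(x : V), hD x.2⟩ := Subtype.ext hxy
  rw [hy]
  refine (hb x).trans ?_
  have h1 := (h.isResolventAt t).left_inv x
  set η := S x - ((t : ℂ) * Complex.I) • (x : V) with hη
  have ht : 0 < 1 + |t| := by positivity
  have h2 : ‖(x : V)‖ ≤ M / (1 + |t|) * ‖η‖ := by
    rw [← h1]
    exact ContinuousLinearMap.le_of_opNorm_le _ (h.bound t) _
  have h3 : ‖S x‖ ≤ (1 + M) * ‖η‖ := by
    have e : S x = η + ((t : ℂ) * Complex.I) • (x : V) := by rw [hη]; module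
    rw [e]
    refine (norm_add_le _ _).trans ?_
    rw [norm_smul, norm_mul, Complex.norm_I, mul_one, Complex.norm_real, Real.norm_eq_abs]
    have : |t| * ‖(x : V)‖ ≤ M * ‖η‖ := by
      calc |t| * ‖(x : V)‖ ≤ (1 + |t|) * (M / (1 + |t|) * ‖η‖) := by gcongr; linarith
        _ = M * ‖η‖ := by field_simp
    linarith
  have hsplit : ‖η‖ ^ (1 - p) * ‖η‖ ^ p = ‖η‖ := by
    rw [← Real.rpow_add_of_nonneg (norm_nonneg _) (by linarith) hp0, sub_add_cancel, Real.rpow_one]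
  have hinv : (1 + |t|) ^ (p - 1) = ((1 + |t|) ^ (1 - p))⁻¹ := by
    rw [← Real.rpow_neg ht.le, neg_sub]
  calc c * ‖(x : V)‖ ^ (1 - p) * ‖S x‖ ^ p
      ≤ c * (M / (1 + |t|) * ‖η‖) ^ (1 - p) * ((1 + M) * ‖η‖) ^ p := by
        have := sub_nonneg.2 hp.le
        gcongr
    _ = c * M ^ (1 - p) * (1 + M) ^ p * (1 + |t|) ^ (p - 1) * (‖η‖ ^ (1 - p) * ‖η‖ ^ p) := by
        rw [Real.mul_rpow (by positivity) (norm_nonneg _), Real.div_rpow hM ht.le,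
          Real.mul_rpow (by positivity) (norm_nonneg _), hinv]
        ring
    _ ≤ (c * M ^ (1 - p) * (1 + M) ^ p + 1) * (1 + |t|) ^ (p - 1) * ‖η‖ := by
        rw [hsplit]
        gcongr
        linarith

end Subordinate

section Form

variable {H : Type*} [NormedAddCommGroup H] [InnerProductSpace ℂ H]

/-- The Cauchy-Schwarz inequality for the form of a nonnegative symmetric operator, in its
arithmetic-geometric version. -/
theorem IsNonneg.two_mul_re_inner_le {B : H →ₗ.[ℂ] H} (hB : IsNonneg B)
    (hs : B.IsFormalAdjoint B) {l : ℝ} (hl : 0 < l) (x y : B.domain) :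
    2 * (inner ℂ (B x) (y : H)).re ≤
      l * (inner ℂ (B x) (x : H)).re + l⁻¹ * (inner ℂ (B y) (y : H)).re := by
  have h1 := hB ((l : ℂ) • x - y)
  have h2 : (inner ℂ (B y) (x : H)).re = (inner ℂ (B x) (y : H)).re := by
    rw [hs y x]
    exact inner_re_symm (𝕜 := ℂ) (y : H) (B x)
  have h3 : (inner ℂ (B ((l : ℂ) • x - y)) (((l : ℂ) • x - y : B.domain) : H)).re =
      l * (l * (inner ℂ (B x) (x : H)).re) - 2 * l * (inner ℂ (B x) (y : H)).re +
        (inner ℂ (B y) (y : H)).re := by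
    rw [B.map_sub, B.map_smul, Submodule.coe_sub, Submodule.coe_smul]
    simp only [inner_sub_left, inner_sub_right, inner_smul_left, inner_smul_right,
      Complex.conj_ofReal, Complex.sub_re, Complex.re_ofReal_mul, h2]
    ring
  rw [h3] at h1
  have h4 := mul_le_mul_of_nonneg_left h1 (inv_pos.2 hl).le
  have h5 : l⁻¹ * (l * (l * (inner ℂ (B x) (x : H)).re) - 2 * l * (inner ℂ (B x) (y : H)).re +
      (inner ℂ (B y) (y : H)).re) = l * (inner ℂ (B x) (x : H)).re -
      2 * (inner ℂ (B x) (y : H)).re + l⁻¹ * (inner ℂ (B y) (y : H)).re := by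
    field_simp
  rw [h5] at h4
  linarith

theorem IsNonneg.apply_eq_zero {B : H →ₗ.[ℂ] H} (hB : IsNonneg B) (hs : B.IsFormalAdjoint B)
    (hd : Dense (B.domain : Set H)) {x : B.domain} (hx : (inner ℂ (B x) (x : H)).re = 0) :
    B x = 0 := by
  have key : ∀ y : B.domain, (inner ℂ (B x) (y : H)).re ≤ 0 := by
    intro y
    set b := (inner ℂ (B y) (y : H)).re
    have hb : 0 ≤ b := hB y
    by_contra hcon
    have hr := not_le.1 hcon
    -- With `⟨B x, x⟩ = 0` the inequality reads `2 r ≤ b / l`; this `l` is large enough to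
    -- contradict `r > 0`.
    have h1 := hB.two_mul_re_inner_le hs (l := (b + 1) / (inner ℂ (B x) (y : H)).re)
      (by positivity) x y
    rw [hx, mul_zero, zero_add, inv_div, div_mul_eq_mul_div, le_div_iff₀ (by positivity)] at h1
    nlinarith
  have key' : ∀ y : H, (inner ℂ (B x) y).re ≤ 0 := by
    intro y
    have hcl : IsClosed {y : H | (inner ℂ (B x) y).re ≤ 0} :=
      isClosed_le (by fun_prop) continuous_const
    exact hcl.closure_subset_iff.2 (fun y hy => key ⟨y, hy⟩) (hd y)
  have h2 := key' (B x)
  rw [inner_self_eq_norm_sq_to_K] at h2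
  have h3 : ‖B x‖ ^ 2 ≤ 0 := by exact_mod_cast h2
  have h4 : ‖B x‖ = 0 := by nlinarith [norm_nonneg (B x)]
  exact norm_eq_zero.1 h4

/-- For `y = G (B x)` duality gives `‖y‖² = -⟨B x, G' y⟩`. Cauchy-Schwarz in the form of `B` bounds
this by `⟨B x, x⟩` and `⟨B G' y, G' y⟩ ≤ k g ‖y‖²`, and the latter is absorbed. With `G` and `G'`
resolvents, the form of `B` controls `(A - it)⁻¹ B` at the integrable rate `|t|^(p-2)`. -/
theorem IsNonneg.norm_sq_le {B : H →ₗ.[ℂ] H} (hB : IsNonneg B) (hs : B.IsFormalAdjoint B)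
    {G G' : H → H} (hG : ∀ x y : H, inner ℂ (G x) y = -inner ℂ x (G' y)) {k g μ : ℝ} (hk : 0 ≤ k)
    (hb : ∀ y, ∃ η : B.domain, (η : H) = G' y ∧ ‖B η‖ ≤ k * ‖y‖) (hg : ∀ y, ‖G' y‖ ≤ g * ‖y‖)
    (hμ : 0 < μ) (hkg : k * g ≤ μ) (x : B.domain) :
    ‖G (B x)‖ ^ 2 ≤ μ * (inner ℂ (B x) (x : H)).re := by
  set y := G (B x) with hy
  obtain ⟨η, hη, hη'⟩ := hb y
  have h1 : ‖y‖ ^ 2 = (inner ℂ (B x) ((-η : B.domain) : H)).re := by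
    have h2 : inner ℂ y y = -inner ℂ (B x) (G' y) := by
      conv_lhs => rw [hy]
      exact hG _ _
    rw [Submodule.coe_neg, inner_neg_right, hη, ← h2, inner_self_eq_norm_sq_to_K]
    norm_cast
  have h2 := hB.two_mul_re_inner_le hs hμ x (-η)
  rw [← h1, B.map_neg, Submodule.coe_neg, inner_neg_neg] at h2
  have h3 : (inner ℂ (B η) (η : H)).re ≤ μ * ‖y‖ ^ 2 := by
    calc (inner ℂ (B η) (η : H)).re ≤ ‖B η‖ * ‖(η : H)‖ := re_inner_le_norm (𝕜 := ℂ) _ _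
      _ ≤ (k * ‖y‖) * (g * ‖y‖) := by
        gcongr
        rw [hη]; exact hg y
      _ = (k * g) * ‖y‖ ^ 2 := by ring
      _ ≤ μ * ‖y‖ ^ 2 := by gcongr
  have h4 : μ⁻¹ * (inner ℂ (B η) (η : H)).re ≤ ‖y‖ ^ 2 := by
    rw [inv_mul_le_iff₀ hμ]; exact h3
  linarith

end Form

section Block

variable {H : Type*} [NormedAddCommGroup H] [InnerProductSpace ℂ H]

theorem IsResolventAt.blockDiagonal {A D : H →ₗ.[ℂ] H} {z : ℂ} {R R' : H →L[ℂ] H}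
    (h : IsResolventAt A z R) (h' : IsResolventAt D z R') :
    IsResolventAt (blockMatrix A 0 0 D) z (R.prodMap R') := by
  refine ⟨fun v => ⟨⟨h.mem_domain v.1, trivial⟩, ⟨trivial, h'.mem_domain v.2⟩⟩, fun v => ?_,
    fun x => ?_⟩
  · refine Prod.ext ?_ ?_
    · change A ⟨R v.1, h.mem_domain v.1⟩ + 0 - z • R v.1 = v.1
      rw [add_zero, h.right_inv]
    · change 0 + D ⟨R' v.2, h'.mem_domain v.2⟩ - z • R' v.2 = v.2
      rw [zero_add, h'.right_inv]
  · refine Prod.ext ?_ ?_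
    · change R (A ⟨(x : H × H).1, x.2.1.1⟩ + 0 - z • (x : H × H).1) = (x : H × H).1
      rw [add_zero, h.left_inv]
    · change R' (0 + D ⟨(x : H × H).2, x.2.2.2⟩ - z • (x : H × H).2) = (x : H × H).2
      rw [zero_add, h'.left_inv]

variable [CompleteSpace H]

theorem HasAxisIntegral.blockDiagonal {A D : H →ₗ.[ℂ] H} {M : ℝ} {Q Q' : H →L[ℂ] H}
    (h : HasAxisIntegral A M Q) (h' : HasAxisIntegral D M Q') :
    HasAxisIntegral (blockMatrix A 0 0 D) M (Q.prodMap Q') := by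
  have hr := fun t => (h.isResolventAt t).blockDiagonal (h'.isResolventAt t)
  have hM := h.nonneg
  refine ⟨fun t => (hr t).mem, fun t => ?_, fun x => ?_⟩
  · rw [(hr t).resolvent_eq]
    refine ContinuousLinearMap.opNorm_le_bound _ (by positivity) fun v => ?_
    rw [Prod.norm_def]
    refine max_le ?_ ?_
    · refine (ContinuousLinearMap.le_of_opNorm_le _ (h.bound t) _).trans ?_
      gcongr
      exact norm_fst_le v
    · refine (ContinuousLinearMap.le_of_opNorm_le _ (h'.bound t) _).trans ?_
      gcongr
      exact norm_snd_le v
  · refine ((h.lim x.1).prodMk_nhds (h'.lim x.2)).congr fun N => ?_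
    have hc : Continuous fun t : ℝ =>
        resolvent (blockMatrix A 0 0 D) ((t : ℂ) * Complex.I) x :=
      (continuous_resolvent_imaginary fun t => (hr t).mem).clm_apply continuous_const
    refine Prod.ext ?_ ?_
    · refine Eq.trans ?_ ((ContinuousLinearMap.fst ℂ H H).intervalIntegral_comp_comm
        (hc.intervalIntegrable _ _))
      refine intervalIntegral.integral_congr fun t _ => ?_
      simp only [(hr t).resolvent_eq]
      rfl
    · refine Eq.trans ?_ ((ContinuousLinearMap.snd ℂ H H).intervalIntegral_comp_comm
        (hc.intervalIntegrable _ _))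
      refine intervalIntegral.integral_congr fun t _ => ?_
      simp only [(hr t).resolvent_eq]
      rfl

end Block

end Hamiltonian

end

/-! ### The Hamiltonian on the imaginary axis: a priori bound and resolvent integral. -/

noncomputable section

namespace Hamiltonian

variable {H : Type*} [NormedAddCommGroup H] [InnerProductSpace ℂ H] [CompleteSpace H]

/-- A nonnegative Hamiltonian whose diagonal entries have resolvents with principal value integrals
`± π σ` along the imaginary axis, with explicit constants for the subordination. -/
structure AxisHamiltonian (A B C : H →ₗ.[ℂ] H) (p M k : ℝ) (σ : ℂ) : Prop
    extends IsNonnegHamiltonian A B C p where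
  p_lt : p < 1
  M_pos : 0 < M
  k_pos : 0 < k
  axis_A : HasAxisIntegral A M (σ • (1 : H →L[ℂ] H))
  axis_D : HasAxisIntegral (-A.adjoint) M (-(σ • (1 : H →L[ℂ] H)))
  sub_C : ∀ (t : ℝ) (x : A.domain) (y : C.domain), (y : H) = x →
    ‖C y‖ ≤ k * (1 + |t|) ^ (p - 1) * ‖A x - ((t : ℂ) * Complex.I) • (x : H)‖
  sub_B : ∀ (t : ℝ) (x : (-A.adjoint).domain) (y : B.domain), (y : H) = x →
    ‖B y‖ ≤ k * (1 + |t|) ^ (p - 1) * ‖(-A.adjoint) x - ((t : ℂ) * Complex.I) • (x : H)‖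

omit [CompleteSpace H] in
theorem HasAxisIntegral.mono {S : H →ₗ.[ℂ] H} {M M' : ℝ} {Q : H →L[ℂ] H}
    (h : HasAxisIntegral S M Q) (hM : M ≤ M') : HasAxisIntegral S M' Q :=
  ⟨h.mem, fun t => (h.bound t).trans (by gcongr), h.lim⟩

theorem IsNonnegHamiltonian.axis {A B C : H →ₗ.[ℂ] H} {p M : ℝ} {σ : ℂ}
    (hT : IsNonnegHamiltonian A B C p) (hp : p < 1)
    (hA : HasAxisIntegral A M (σ • (1 : H →L[ℂ] H)))
    (hD : HasAxisIntegral (-A.adjoint) M (-(σ • (1 : H →L[ℂ] H)))) :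
    ∃ M k : ℝ, AxisHamiltonian A B C p M k σ := by
  obtain ⟨k₁, hk₁, h₁⟩ := hA.subordinate hT.dominant.exponent_nonneg hp hT.dominant.subordinate_C
  obtain ⟨k₂, hk₂, h₂⟩ := hD.subordinate hT.dominant.exponent_nonneg hp hT.dominant.subordinate_B
  exact ⟨max M 1, max k₁ k₂, hT, hp, by positivity, by positivity, hA.mono (le_max_left _ _),
    hD.mono (le_max_left _ _), fun t x y hxy => (h₁ t x y hxy).trans (by
      gcongr; exact le_max_left _ _), fun t x y hxy => (h₂ t x y hxy).trans (by
      gcongr; exact le_max_right _ _)⟩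

theorem rate_eq (p M k t : ℝ) :
    k * (1 + |t|) ^ (p - 1) * (M / (1 + |t|)) = k * M * (1 + |t|) ^ (p - 2) := by
  have ht : 0 < 1 + |t| := by positivity
  rw [show p - 2 = (p - 1) - 1 by ring, Real.rpow_sub_one ht.ne' (p - 1)]
  ring

theorem hamiltonian_apply (A B C : H →ₗ.[ℂ] H) (x : (hamiltonian A B C).domain) :
    hamiltonian A B C x = (A ⟨(x : H × H).1, x.2.1.1⟩ + B ⟨(x : H × H).2, x.2.2.1⟩,
      C ⟨(x : H × H).1, x.2.1.2⟩ + (-A.adjoint) ⟨(x : H × H).2, x.2.2.2⟩) := rfl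

namespace AxisHamiltonian

variable {A B C : H →ₗ.[ℂ] H} {p M k : ℝ} {σ : ℂ} (h : AxisHamiltonian A B C p M k σ)
include h

theorem dense_A : Dense (A.domain : Set H) := h.dominant.dense_A

theorem domain_le_C : A.domain ≤ C.domain := h.dominant.subordinate_C.choose

theorem domain_le_B : A.adjoint.domain ≤ B.domain := h.dominant.subordinate_B.choose

theorem domain_eq : (blockMatrix A 0 0 (-A.adjoint)).domain = (hamiltonian A B C).domain := by
  ext x
  exact ⟨fun hx => ⟨⟨hx.1.1, h.domain_le_C hx.1.1⟩, ⟨h.domain_le_B hx.2.2, hx.2.2⟩⟩,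
    fun hx => ⟨⟨hx.1.1, trivial⟩, ⟨trivial, hx.2.2⟩⟩⟩

theorem mem_domain {x : H × H} (h1 : x.1 ∈ A.domain) (h2 : x.2 ∈ A.adjoint.domain) :
    x ∈ (hamiltonian A B C).domain :=
  ⟨⟨h1, h.domain_le_C h1⟩, ⟨h.domain_le_B h2, h2⟩⟩

theorem dense_domain : Dense ((hamiltonian A B C).domain : Set (H × H)) := by
  have h1 : Dense ((A.domain : Set H) ×ˢ (A.adjoint.domain : Set H)) :=
    h.dense_A.prod h.dominant.dense_D
  exact h1.mono fun x hx => h.mem_domain hx.1 hx.2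

theorem rpow_le_one (t : ℝ) : (1 + |t|) ^ (p - 1) ≤ 1 :=
  Real.rpow_le_one_of_one_le_of_nonpos (by linarith [abs_nonneg t]) (by linarith [h.p_lt])

theorem inner_resolvent (t : ℝ) (x y : H) :
    inner ℂ (resolvent A ((t : ℂ) * Complex.I) x) y =
      -inner ℂ x (resolvent (-A.adjoint) ((t : ℂ) * Complex.I) y) := by
  have h1 := (h.axis_A.isResolventAt t).apply_eq x
  have h2 := (h.axis_D.isResolventAt t).apply_eq y
  have hm1 := (h.axis_A.isResolventAt t).mem_domain x
  have hm2 := (h.axis_D.isResolventAt t).mem_domain y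
  set u := resolvent A ((t : ℂ) * Complex.I) x
  set v := resolvent (-A.adjoint) ((t : ℂ) * Complex.I) y
  have h3 := (LinearPMap.adjoint_isFormalAdjoint h.dense_A).symm ⟨u, hm1⟩ ⟨v, hm2⟩
  rw [LinearPMap.neg_apply] at h2
  have h4 : A.adjoint ⟨v, hm2⟩ = -(y + ((t : ℂ) * Complex.I) • v) := by rw [← h2, neg_neg]
  rw [h4, h1] at h3
  simp only [inner_add_left, inner_neg_right, inner_add_right, inner_smul_left, inner_smul_right,
    map_mul, Complex.conj_ofReal, Complex.conj_I] at h3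
  linear_combination h3

theorem inner_resolvent' (t : ℝ) (x y : H) :
    inner ℂ (resolvent (-A.adjoint) ((t : ℂ) * Complex.I) x) y =
      -inner ℂ x (resolvent A ((t : ℂ) * Complex.I) y) := by
  have h1 := congrArg (starRingEnd ℂ) (h.inner_resolvent t y x)
  rw [map_neg, inner_conj_symm, inner_conj_symm] at h1
  rw [h1, neg_neg]

theorem norm_C_resolvent_le (t : ℝ) (y : H) : ∃ η : C.domain,
    (η : H) = resolvent A ((t : ℂ) * Complex.I) y ∧ ‖C η‖ ≤ k * (1 + |t|) ^ (p - 1) * ‖y‖ := by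
  have hm := (h.axis_A.isResolventAt t).mem_domain y
  have h1 := h.sub_C t ⟨_, hm⟩ ⟨_, h.domain_le_C hm⟩ rfl
  rw [(h.axis_A.isResolventAt t).right_inv] at h1
  exact ⟨_, rfl, h1⟩

theorem norm_B_resolvent_le (t : ℝ) (y : H) : ∃ η : B.domain,
    (η : H) = resolvent (-A.adjoint) ((t : ℂ) * Complex.I) y ∧
      ‖B η‖ ≤ k * (1 + |t|) ^ (p - 1) * ‖y‖ := by
  have hm := (h.axis_D.isResolventAt t).mem_domain y
  have h1 := h.sub_B t ⟨_, hm⟩ ⟨_, h.domain_le_B hm⟩ rfl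
  rw [(h.axis_D.isResolventAt t).right_inv] at h1
  exact ⟨_, rfl, h1⟩

theorem rate_pos (t : ℝ) : 0 < k * M * (1 + |t|) ^ (p - 2) := by
  have := h.k_pos
  have := h.M_pos
  positivity

theorem rate_le (t : ℝ) : k * M * (1 + |t|) ^ (p - 2) ≤ k * (M / (1 + |t|)) := by
  have := h.k_pos
  have := h.M_pos
  rw [← rate_eq]
  calc k * (1 + |t|) ^ (p - 1) * (M / (1 + |t|)) ≤ k * 1 * (M / (1 + |t|)) := by
        gcongr; exact h.rpow_le_one t
    _ = _ := by ring

theorem norm_resolvent_B_sq_le (t : ℝ) (b : B.domain) :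
    ‖resolvent A ((t : ℂ) * Complex.I) (B b)‖ ^ 2 ≤
      k * M * (1 + |t|) ^ (p - 2) * (inner ℂ (B b) (b : H)).re := by
  have := h.k_pos
  refine h.nonneg_B.norm_sq_le h.symmetric_B (h.inner_resolvent t) (by positivity)
    (h.norm_B_resolvent_le t) (fun y => ContinuousLinearMap.le_of_opNorm_le _ (h.axis_D.bound t) y)
    (h.rate_pos t) (rate_eq p M k t).le b

theorem norm_resolvent_C_sq_le (t : ℝ) (c : C.domain) :
    ‖resolvent (-A.adjoint) ((t : ℂ) * Complex.I) (C c)‖ ^ 2 ≤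
      k * M * (1 + |t|) ^ (p - 2) * (inner ℂ (C c) (c : H)).re := by
  have := h.k_pos
  refine h.nonneg_C.norm_sq_le h.symmetric_C (h.inner_resolvent' t) (by positivity)
    (h.norm_C_resolvent_le t) (fun y => ContinuousLinearMap.le_of_opNorm_le _ (h.axis_A.bound t) y)
    (h.rate_pos t) (rate_eq p M k t).le c

/-- Accretivity of the Hamiltonian with respect to `(u, v) ↦ 2 Re ⟨u, v⟩`. -/
theorem form_eq (t : ℝ) (x : (hamiltonian A B C).domain) {f g : H}
    (hfg : hamiltonian A B C x - ((t : ℂ) * Complex.I) • (x : H × H) = (f, g)) :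
    (inner ℂ (B ⟨(x : H × H).2, x.2.2.1⟩) (x : H × H).2).re +
      (inner ℂ (C ⟨(x : H × H).1, x.2.1.2⟩) (x : H × H).1).re =
      (inner ℂ f (x : H × H).2).re + (inner ℂ g (x : H × H).1).re := by
  rw [hamiltonian_apply] at hfg
  have hf := (congrArg Prod.fst hfg).symm
  have hg := (congrArg Prod.snd hfg).symm
  simp only [Prod.fst_sub, Prod.snd_sub, Prod.smul_fst, Prod.smul_snd] at hf hg
  have h3 := (LinearPMap.adjoint_isFormalAdjoint h.dense_A)
    ⟨(x : H × H).2, x.2.2.2⟩ ⟨(x : H × H).1, x.2.1.1⟩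
  simp only at h3
  have h4 : (inner ℂ (A ⟨(x : H × H).1, x.2.1.1⟩) (x : H × H).2).re =
      (inner ℂ (x : H × H).2 (A ⟨(x : H × H).1, x.2.1.1⟩)).re := inner_re_symm (𝕜 := ℂ) _ _
  have h5 : (inner ℂ (x : H × H).2 (x : H × H).1).re = (inner ℂ (x : H × H).1 (x : H × H).2).re :=
    inner_re_symm (𝕜 := ℂ) _ _
  have h6 : (inner ℂ (x : H × H).2 (x : H × H).1).im =
      -(inner ℂ (x : H × H).1 (x : H × H).2).im := inner_im_symm (𝕜 := ℂ) _ _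
  rw [hf, hg, LinearPMap.neg_apply]
  -- The contributions of `A` and `-A*` cancel in the real part, and so do those of the purely
  -- imaginary spectral parameter.
  simp only [inner_add_left, inner_sub_left, inner_neg_left, inner_smul_left, Complex.add_re,
    Complex.sub_re, Complex.neg_re, h3, h4, map_mul, Complex.conj_ofReal, Complex.conj_I,
    Complex.mul_re, Complex.mul_im, h5, h6, Complex.ofReal_re, Complex.ofReal_im, Complex.neg_im,
    Complex.I_re, Complex.I_im]
  ring

/-- For `(f, g) = (T - it)(u, v)` one has `u = (A - it)⁻¹ (f - B v)`, and symmetrically for `v`. The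
form identity bounds `⟨B v, v⟩` and `⟨C u, u⟩` by `2 ‖(f, g)‖ ‖(u, v)‖`, so the coupling terms are
estimated through the forms. No smallness is needed, hence all `t` are covered. -/
theorem norm_le (t : ℝ) (x : (hamiltonian A B C).domain) : ‖(x : H × H)‖ ≤
    2 * (1 + k) * M / (1 + |t|) *
      ‖hamiltonian A B C x - ((t : ℂ) * Complex.I) • (x : H × H)‖ := by
  obtain ⟨⟨f, g⟩, hfg⟩ : ∃ y : H × H,
    hamiltonian A B C x - ((t : ℂ) * Complex.I) • (x : H × H) = y := ⟨_, rfl⟩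
  have hform := h.form_eq t x hfg
  have hBn := h.nonneg_B ⟨(x : H × H).2, x.2.2.1⟩
  have hCn := h.nonneg_C ⟨(x : H × H).1, x.2.1.2⟩
  have hB2 := h.norm_resolvent_B_sq_le t ⟨(x : H × H).2, x.2.2.1⟩
  have hC2 := h.norm_resolvent_C_sq_le t ⟨(x : H × H).1, x.2.1.2⟩
  have hA1 := (h.axis_A.isResolventAt t).left_inv ⟨(x : H × H).1, x.2.1.1⟩
  have hD1 := (h.axis_D.isResolventAt t).left_inv ⟨(x : H × H).2, x.2.2.2⟩
  rw [hfg]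
  rw [hamiltonian_apply] at hfg
  have hf := congrArg Prod.fst hfg
  have hg := congrArg Prod.snd hfg
  simp only [Prod.fst_sub, Prod.snd_sub, Prod.smul_fst, Prod.smul_snd] at hf hg hA1 hD1 hBn hCn hB2 hC2
  set b := B ⟨(x : H × H).2, x.2.2.1⟩
  set c := C ⟨(x : H × H).1, x.2.1.2⟩
  set a := A ⟨(x : H × H).1, x.2.1.1⟩
  set d := (-A.adjoint) ⟨(x : H × H).2, x.2.2.2⟩
  set n := ‖(x : H × H)‖ with hn
  set F := ‖(f, g)‖ with hF
  have hn1 : ‖(x : H × H).1‖ ≤ n := norm_fst_le _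
  have hn2 : ‖(x : H × H).2‖ ≤ n := norm_snd_le _
  have hF1 : ‖f‖ ≤ F := norm_fst_le (f, g)
  have hF2 : ‖g‖ ≤ F := norm_snd_le (f, g)
  have hn0 : 0 ≤ n := norm_nonneg _
  have hF0 : 0 ≤ F := norm_nonneg _
  have e1 : (inner ℂ f (x : H × H).2).re ≤ F * n :=
    (re_inner_le_norm (𝕜 := ℂ) _ _).trans (by gcongr)
  have e2 : (inner ℂ g (x : H × H).1).re ≤ F * n :=
    (re_inner_le_norm (𝕜 := ℂ) _ _).trans (by gcongr)
  set μ := k * M * (1 + |t|) ^ (p - 2) with hμ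
  have hμ0 : 0 < μ := h.rate_pos t
  have hμ1 : μ ≤ k * (M / (1 + |t|)) := h.rate_le t
  -- `2 μ F n ≤ (μ F + n / 2)²`; the summand `n / 2` is absorbed at the end.
  have step : ∀ s : ℝ, 0 ≤ s → s ^ 2 ≤ μ * (2 * (F * n)) → s ≤ μ * F + n / 2 := by
    intro s hs hs2
    refine le_of_sq_le_sq ?_ (by positivity)
    nlinarith [sq_nonneg (μ * F - n / 2)]
  have s1 := step _ (norm_nonneg _) (hB2.trans (by gcongr; linarith))
  have s2 := step _ (norm_nonneg _) (hC2.trans (by gcongr; linarith))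
  have m1 : ‖(x : H × H).1‖ ≤ M / (1 + |t|) * F + (μ * F + n / 2) := by
    have e : a - ((t : ℂ) * Complex.I) • (x : H × H).1 = f - b := by rw [← hf]; module
    rw [← hA1, e, map_sub]
    refine (norm_sub_le _ _).trans (add_le_add ?_ s1)
    exact (ContinuousLinearMap.le_of_opNorm_le _ (h.axis_A.bound t) _).trans
      (by have := h.M_pos; gcongr)
  have m2 : ‖(x : H × H).2‖ ≤ M / (1 + |t|) * F + (μ * F + n / 2) := by
    have e : d - ((t : ℂ) * Complex.I) • (x : H × H).2 = g - c := by rw [← hg]; module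
    rw [← hD1, e, map_sub]
    refine (norm_sub_le _ _).trans (add_le_add ?_ s2)
    exact (ContinuousLinearMap.le_of_opNorm_le _ (h.axis_D.bound t) _).trans
      (by have := h.M_pos; gcongr)
  have m3 : n ≤ M / (1 + |t|) * F + (μ * F + n / 2) := max_le m1 m2
  have m4 : μ * F ≤ k * (M / (1 + |t|)) * F := by gcongr
  have m5 : 2 * (1 + k) * M / (1 + |t|) * F =
      2 * (M / (1 + |t|) * F + k * (M / (1 + |t|)) * F) := by ring
  rw [m5]
  linarith

theorem sub_le (t : ℝ) (x : (blockMatrix A 0 0 (-A.adjoint)).domain) :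
    ‖hamiltonian A B C ⟨x, h.domain_eq.le x.2⟩ - blockMatrix A 0 0 (-A.adjoint) x‖ ≤
      k * (1 + |t|) ^ (p - 1) *
        ‖blockMatrix A 0 0 (-A.adjoint) x - ((t : ℂ) * Complex.I) • (x : H × H)‖ := by
  have hk := h.k_pos
  set y := blockMatrix A 0 0 (-A.adjoint) x - ((t : ℂ) * Complex.I) • (x : H × H) with hy
  have h1 : y.1 = A ⟨(x : H × H).1, x.2.1.1⟩ - ((t : ℂ) * Complex.I) • (x : H × H).1 := by
    change A ⟨(x : H × H).1, x.2.1.1⟩ + 0 - _ = _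
    rw [add_zero]; rfl
  have h2 : y.2 = (-A.adjoint) ⟨(x : H × H).2, x.2.2.2⟩ -
      ((t : ℂ) * Complex.I) • (x : H × H).2 := by
    change 0 + (-A.adjoint) ⟨(x : H × H).2, x.2.2.2⟩ - _ = _
    rw [zero_add]; rfl
  have e : hamiltonian A B C ⟨x, h.domain_eq.le x.2⟩ - blockMatrix A 0 0 (-A.adjoint) x =
      (B ⟨(x : H × H).2, h.domain_le_B x.2.2.2⟩, C ⟨(x : H × H).1, h.domain_le_C x.2.1.1⟩) := by
    refine Prod.ext ?_ ?_
    · change A ⟨(x : H × H).1, x.2.1.1⟩ + B ⟨(x : H × H).2, h.domain_le_B x.2.2.2⟩ -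
        (A ⟨(x : H × H).1, x.2.1.1⟩ + 0) = B ⟨(x : H × H).2, h.domain_le_B x.2.2.2⟩
      abel
    · change C ⟨(x : H × H).1, h.domain_le_C x.2.1.1⟩ + (-A.adjoint) ⟨(x : H × H).2, x.2.2.2⟩ -
        (0 + (-A.adjoint) ⟨(x : H × H).2, x.2.2.2⟩) = C ⟨(x : H × H).1, h.domain_le_C x.2.1.1⟩
      abel
  rw [e]
  refine max_le ?_ ?_
  · refine (h.sub_B t ⟨_, x.2.2.2⟩ ⟨_, h.domain_le_B x.2.2.2⟩ rfl).trans ?_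
    rw [← h2]
    gcongr
    exact norm_snd_le y
  · refine (h.sub_C t ⟨_, x.2.1.1⟩ ⟨_, h.domain_le_C x.2.1.1⟩ rfl).trans ?_
    rw [← h1]
    gcongr
    exact norm_fst_le y

theorem tendsto_rate_zero : Tendsto (fun t : ℝ => k * (1 + |t|) ^ (p - 1)) atTop (𝓝 0) := by
  have h1 : Tendsto (fun t : ℝ => 1 + |t|) atTop atTop :=
    tendsto_atTop_add_const_left _ _ tendsto_abs_atTop_atTop
  have h2 := ((tendsto_rpow_neg_atTop (sub_pos.2 h.p_lt)).comp h1).const_mul k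
  rw [mul_zero] at h2
  refine h2.congr fun t => ?_
  simp only [Function.comp_apply, neg_sub]

theorem diag_axis : HasAxisIntegral (blockMatrix A 0 0 (-A.adjoint)) M
    ((σ • (1 : H →L[ℂ] H)).prodMap (-(σ • (1 : H →L[ℂ] H)))) :=
  h.axis_A.blockDiagonal h.axis_D

/-- For one large `t₀` the Hamiltonian is a small perturbation of its diagonal; the a priori bound
carries invertibility along the entire axis. -/
theorem imaginary_mem (t : ℝ) : (t : ℂ) * Complex.I ∈ resolventSet (hamiltonian A B C) := by
  obtain ⟨t₀, ht₀⟩ := (h.tendsto_rate_zero.eventually_lt_const one_pos).exists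
  have hk := h.k_pos
  have hM := h.M_pos
  obtain ⟨L, hL, -⟩ := (h.diag_axis.isResolventAt t₀).perturb h.domain_eq (by positivity) ht₀
    (h.sub_le t₀)
  refine imaginary_mem_resolventSet (M := 2 * (1 + k) * M) (by positivity) (fun t x => ?_) hL.mem t
  refine (h.norm_le t x).trans ?_
  gcongr
  refine div_le_self (by positivity) ?_
  linarith [abs_nonneg t]

theorem norm_resolvent_le (t : ℝ) :
    ‖resolvent (hamiltonian A B C) ((t : ℂ) * Complex.I)‖ ≤ 2 * (1 + k) * M / (1 + |t|) := by
  have hk := h.k_pos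
  have hM := h.M_pos
  exact (isResolventAt_resolvent (h.imaginary_mem t)).norm_le (by positivity) (h.norm_le t)

/-- The difference is minus the resolvent of `T`, times the off-diagonal part, times the diagonal
resolvent: decay of order `1` from the first factor and `1 - p` from the other two. -/
theorem norm_resolvent_sub_le (t : ℝ) :
    ‖resolvent (hamiltonian A B C) ((t : ℂ) * Complex.I) -
      resolvent (blockMatrix A 0 0 (-A.adjoint)) ((t : ℂ) * Complex.I)‖ ≤
      2 * (1 + k) * M * k * (1 + ‖t‖) ^ (-(2 - p)) := by
  have hk := h.k_pos
  have hM := h.M_pos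
  have hR := isResolventAt_resolvent (h.imaginary_mem t)
  have hS := h.diag_axis.isResolventAt t
  have ht : 0 < 1 + |t| := by positivity
  refine ContinuousLinearMap.opNorm_le_bound _ (by positivity) fun v => ?_
  set r := resolvent (blockMatrix A 0 0 (-A.adjoint)) ((t : ℂ) * Complex.I) v
  have h1 := h.sub_le t ⟨r, hS.mem_domain v⟩
  rw [hS.right_inv] at h1
  have h2 := hR.left_inv ⟨r, h.domain_eq.le (hS.mem_domain v)⟩
  set w := hamiltonian A B C ⟨r, h.domain_eq.le (hS.mem_domain v)⟩ -
    blockMatrix A 0 0 (-A.adjoint) ⟨r, hS.mem_domain v⟩ with hw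
  have h3 : hamiltonian A B C ⟨r, h.domain_eq.le (hS.mem_domain v)⟩ -
      ((t : ℂ) * Complex.I) • r = v + w := by
    rw [hw, hS.apply_eq]; module
  simp only at h2
  rw [h3, map_add] at h2
  rw [sub_apply]
  change ‖_ - r‖ ≤ _
  rw [← h2, sub_add_cancel_left, norm_neg]
  calc ‖resolvent (hamiltonian A B C) ((t : ℂ) * Complex.I) w‖
      ≤ 2 * (1 + k) * M / (1 + |t|) * (k * (1 + |t|) ^ (p - 1) * ‖v‖) := by
        refine (ContinuousLinearMap.le_of_opNorm_le _ (h.norm_resolvent_le t) _).trans ?_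
        gcongr
    _ = _ := by
      rw [Real.norm_eq_abs, show -(2 - p) = (p - 1) - 1 by ring, Real.rpow_sub_one ht.ne' (p - 1)]
      ring

/-- Because `2 - p > 1` the resolvent difference is absolutely integrable, so the principal value
for the diagonal carries over to `T`. -/
theorem exists_axis : ∃ Q : H × H →L[ℂ] H × H,
    HasAxisIntegral (hamiltonian A B C) (2 * (1 + k) * M) Q := by
  have hcT := continuous_resolvent_imaginary h.imaginary_mem
  have hcS := h.diag_axis.continuous_resolvent
  have hint : MeasureTheory.Integrable fun t : ℝ =>
      resolvent (hamiltonian A B C) ((t : ℂ) * Complex.I) -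
        resolvent (blockMatrix A 0 0 (-A.adjoint)) ((t : ℂ) * Complex.I) := by
    refine MeasureTheory.Integrable.mono'
      ((integrable_one_add_norm (E := ℝ) (r := 2 - p) ?_).const_mul _)
      (hcT.sub hcS).aestronglyMeasurable (Eventually.of_forall h.norm_resolvent_sub_le)
    have := h.p_lt
    simp only [Module.finrank_self, Nat.cast_one]
    linarith
  have hpi : (Real.pi : ℂ) ≠ 0 := by exact_mod_cast Real.pi_ne_zero
  refine ⟨(σ • (1 : H →L[ℂ] H)).prodMap (-(σ • (1 : H →L[ℂ] H))) + (Real.pi : ℂ)⁻¹ • ∫ t : ℝ,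
    (resolvent (hamiltonian A B C) ((t : ℂ) * Complex.I) -
        resolvent (blockMatrix A 0 0 (-A.adjoint)) ((t : ℂ) * Complex.I)),
    h.imaginary_mem, h.norm_resolvent_le, fun x => ?_⟩
  have hi := hint.apply_continuousLinearMap x
  have l1 := MeasureTheory.intervalIntegral_tendsto_integral hi tendsto_neg_atTop_atBot tendsto_id
  have l2 := (h.diag_axis.lim x).add l1
  rw [add_apply, smul_apply, smul_add, smul_smul, mul_inv_cancel₀ hpi, one_smul,
    ContinuousLinearMap.integral_apply hint]
  refine l2.congr fun N => ?_
  simp only [sub_apply, id]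
  rw [← intervalIntegral.integral_add]
  · refine intervalIntegral.integral_congr fun t _ => ?_
    abel
  · exact (hcS.clm_apply continuous_const).intervalIntegrable _ _
  · exact ((hcT.clm_apply continuous_const).sub
      (hcS.clm_apply continuous_const)).intervalIntegrable _ _

end AxisHamiltonian

end Hamiltonian

end

/-! ### Lagrangian spectral subspaces and their graphs. -/

noncomputable section

namespace Hamiltonian

section Functional

variable {V : Type*} [NormedAddCommGroup V] [NormedSpace ℂ V] [CompleteSpace V]

theorem HasAxisIntegral.lim_functional {T : V →ₗ.[ℂ] V} {M : ℝ} {Q : V →L[ℂ] V}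
    (h : HasAxisIntegral T M Q) {E : Type*} [NormedAddCommGroup E] [NormedSpace ℝ E]
    [CompleteSpace E] (l : V →L[ℝ] E) (x : V) :
    Tendsto (fun N : ℝ => ∫ t in (-N)..N, l (resolvent T ((t : ℂ) * Complex.I) x)) atTop
      (𝓝 (Real.pi • l (Q x))) := by
  have h1 := (l.continuous.tendsto _).comp (h.lim x)
  rw [Complex.coe_smul, map_smul] at h1
  refine h1.congr fun N => ?_
  rw [Function.comp_apply, ContinuousLinearMap.intervalIntegral_comp_comm]
  exact (h.continuous_resolvent.clm_apply continuous_const).intervalIntegrable _ _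

theorem integral_le_of_tendsto {f : ℝ → ℝ} (hf : Continuous f) (h0 : ∀ t, 0 ≤ f t) {L : ℝ}
    (hl : Tendsto (fun N : ℝ => ∫ t in (-N)..N, f t) atTop (𝓝 L)) {N : ℝ} (hN : 0 ≤ N) :
    ∫ t in (-N)..N, f t ≤ L := by
  refine ge_of_tendsto hl ?_
  filter_upwards [eventually_ge_atTop N] with N' hN'
  exact intervalIntegral.integral_mono_interval (by linarith) (by linarith) hN'
    (Eventually.of_forall h0) (hf.intervalIntegrable _ _)

theorem eq_zero_of_tendsto_integral {f : ℝ → ℝ} (hf : Continuous f) (h0 : ∀ t, 0 ≤ f t)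
    (hl : Tendsto (fun N : ℝ => ∫ t in (-N)..N, f t) atTop (𝓝 0)) (t : ℝ) : f t = 0 := by
  by_contra hne
  have hpos : 0 < f t := lt_of_le_of_ne (h0 t) (Ne.symm hne)
  have h1 : 0 < ∫ s in (-(|t| + 1))..(|t| + 1), f s :=
    intervalIntegral.integral_pos (by linarith [abs_nonneg t]) hf.continuousOn
      (fun s _ => h0 s)
      ⟨t, ⟨by linarith [neg_abs_le t], by linarith [le_abs_self t]⟩, hpos⟩
  exact absurd (integral_le_of_tendsto hf h0 hl (by positivity)) (not_le.2 h1)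

end Functional

variable {H : Type*} [NormedAddCommGroup H] [InnerProductSpace ℂ H]

/-- The functional `y ↦ ⟨x₁, y₂⟩ - ⟨x₂, y₁⟩`. -/
def sympl (x : H × H) : H × H →L[ℂ] ℂ :=
  (innerSL ℂ x.1).comp (ContinuousLinearMap.snd ℂ H H) -
    (innerSL ℂ x.2).comp (ContinuousLinearMap.fst ℂ H H)

theorem sympl_apply (x y : H × H) : sympl x y = inner ℂ x.1 y.2 - inner ℂ x.2 y.1 := rfl

theorem conj_sympl (x y : H × H) : starRingEnd ℂ (sympl x y) = -sympl y x := by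
  rw [sympl_apply, sympl_apply, map_sub, inner_conj_symm, inner_conj_symm, neg_sub]

/-- The functional `y ↦ Re (⟨x₁, y₂⟩ + ⟨x₂, y₁⟩)`. -/
def symForm (x : H × H) : H × H →L[ℝ] ℝ :=
  Complex.reCLM.comp (((innerSL ℂ x.1).comp (ContinuousLinearMap.snd ℂ H H) +
    (innerSL ℂ x.2).comp (ContinuousLinearMap.fst ℂ H H)).restrictScalars ℝ)

theorem symForm_apply (x y : H × H) :
    symForm x y = (inner ℂ x.1 y.2).re + (inner ℂ x.2 y.1).re := rfl

theorem symForm_self (x : H × H) : symForm x x = 2 * (inner ℂ x.1 x.2).re := by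
  have h : (inner ℂ x.2 x.1).re = (inner ℂ x.1 x.2).re := inner_re_symm (𝕜 := ℂ) _ _
  rw [symForm_apply, h]
  ring

variable [CompleteSpace H]

theorem mem_riccatiDomain {A X : H →ₗ.[ℂ] H} {u : H} : u ∈ riccatiDomain A X ↔
    u ∈ A.domain ∧ ∃ y, (u, y) ∈ X.graph ∧ y ∈ A.adjoint.domain := by
  constructor
  · rintro ⟨h1, x, hx, rfl⟩
    exact ⟨h1, X x, X.mem_graph x, hx⟩
  · rintro ⟨h1, y, hy, hy'⟩
    obtain ⟨x, rfl, rfl⟩ := X.mem_graph_iff.1 hy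
    exact ⟨h1, x, hy', rfl⟩

namespace AxisHamiltonian

variable {A B C : H →ₗ.[ℂ] H} {p M k : ℝ} {σ : ℂ} (h : AxisHamiltonian A B C p M k σ)
include h

theorem symForm_resolvent (t : ℝ) (x : H × H) : ∃ (b : B.domain) (c : C.domain),
    (b : H) = (resolvent (hamiltonian A B C) ((t : ℂ) * Complex.I) x).2 ∧
    (c : H) = (resolvent (hamiltonian A B C) ((t : ℂ) * Complex.I) x).1 ∧
    symForm x (resolvent (hamiltonian A B C) ((t : ℂ) * Complex.I) x) =
      (inner ℂ (B b) (b : H)).re + (inner ℂ (C c) (c : H)).re := by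
  have hR := isResolventAt_resolvent (h.imaginary_mem t)
  exact ⟨⟨_, (hR.mem_domain x).2.1⟩, ⟨_, (hR.mem_domain x).1.2⟩, rfl, rfl,
    (h.form_eq t ⟨_, hR.mem_domain x⟩ (hR.right_inv x)).symm⟩

theorem symForm_resolvent_nonneg (t : ℝ) (x : H × H) :
    0 ≤ symForm x (resolvent (hamiltonian A B C) ((t : ℂ) * Complex.I) x) := by
  obtain ⟨b, c, -, -, e⟩ := h.symForm_resolvent t x
  rw [e]
  exact add_nonneg (h.nonneg_B b) (h.nonneg_C c)

theorem sympl_hamiltonian (a b : (hamiltonian A B C).domain) :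
    sympl (hamiltonian A B C a) (b : H × H) = -sympl (a : H × H) (hamiltonian A B C b) := by
  have eB := h.symmetric_B ⟨(a : H × H).2, a.2.2.1⟩ ⟨(b : H × H).2, b.2.2.1⟩
  have eC := h.symmetric_C ⟨(a : H × H).1, a.2.1.2⟩ ⟨(b : H × H).1, b.2.1.2⟩
  have hf := LinearPMap.adjoint_isFormalAdjoint h.dense_A
  have e1 := hf ⟨(a : H × H).2, a.2.2.2⟩ ⟨(b : H × H).1, b.2.1.1⟩
  have e2 := hf.symm ⟨(a : H × H).1, a.2.1.1⟩ ⟨(b : H × H).2, b.2.2.2⟩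
  simp only at eB eC e1 e2
  rw [hamiltonian_apply, hamiltonian_apply, sympl_apply, sympl_apply]
  simp only [inner_add_left, inner_add_right, LinearPMap.neg_apply, inner_neg_left, inner_neg_right,
    eB, eC, e1, e2]
  ring

/-- `T` is skew for `sympl`, and the reflection `z ↦ -conj z` fixes the imaginary axis, so the same
resolvent appears on both sides. -/
theorem sympl_resolvent (t : ℝ) (x y : H × H) :
    sympl x (resolvent (hamiltonian A B C) ((t : ℂ) * Complex.I) y) =
      starRingEnd ℂ (sympl y (resolvent (hamiltonian A B C) ((t : ℂ) * Complex.I) x)) := by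
  have hR := isResolventAt_resolvent (h.imaginary_mem t)
  have key := h.sympl_hamiltonian ⟨_, hR.mem_domain x⟩ ⟨_, hR.mem_domain y⟩
  rw [hR.apply_eq, hR.apply_eq] at key
  rw [conj_sympl]
  simp only [sympl_apply, Prod.fst_add, Prod.snd_add, Prod.smul_fst, Prod.smul_snd, inner_add_left,
    inner_add_right, inner_smul_left, inner_smul_right, map_mul, Complex.conj_ofReal,
    Complex.conj_I] at key ⊢
  linear_combination key

variable {M' : ℝ} {Q : H × H →L[ℂ] H × H} (hQ : HasAxisIntegral (hamiltonian A B C) M' Q)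
include hQ

theorem sympl_Q (x y : H × H) : sympl x (Q y) = starRingEnd ℂ (sympl y (Q x)) := by
  have h1 := hQ.lim_functional ((sympl x).restrictScalars ℝ) y
  have h2 := hQ.lim_functional
    ((Complex.conjCLE : ℂ →L[ℝ] ℂ).comp ((sympl y).restrictScalars ℝ)) x
  have h3 := tendsto_nhds_unique (h1.congr fun N => intervalIntegral.integral_congr fun t _ =>
    h.sympl_resolvent t x y) h2
  exact smul_right_injective ℂ Real.pi_ne_zero h3

variable {s : ℝ} (hs : s * s = 1)
include hs

/-- The symmetry of `Q` yields `s * sympl x y = -s * sympl x y`. -/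
theorem sympl_eq_zero {x y : H × H} (hx : x ∈ eigen Q (s : ℂ)) (hy : y ∈ eigen Q (s : ℂ)) :
    sympl x y = 0 := by
  have hs' : (s : ℂ) * s = 1 := by exact_mod_cast hs
  have h1 := h.sympl_Q hQ x y
  rw [mem_eigen.1 hx, mem_eigen.1 hy, map_smul, map_smul, smul_eq_mul, smul_eq_mul, map_mul,
    Complex.conj_ofReal, conj_sympl] at h1
  have h2 : (2 * (s : ℂ)) * sympl x y = 0 := by linear_combination h1
  have h3 : 2 * sympl x y = 0 := by linear_combination s * h2 - 2 * sympl x y * hs'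
  simpa using h3

omit h in
theorem proj_mem_eigen (x : H × H) : (2 : ℂ)⁻¹ • (x + (s : ℂ) • Q x) ∈ eigen Q (s : ℂ) := by
  have hs' : (s : ℂ) * s = 1 := by exact_mod_cast hs
  rw [mem_eigen, map_smul, map_add, map_smul, hQ.involutive, smul_comm (s : ℂ) (2 : ℂ)⁻¹, smul_add,
    smul_add, smul_add, smul_smul (s : ℂ), hs', one_smul, add_comm]

/-- Maximality: the component `z` of `y` in the other eigenspace is orthogonal to both isotropic
eigenspaces, hence to everything, and `sympl` is nondegenerate. -/
theorem mem_eigen_of_sympl {y : H × H} (hy : ∀ x ∈ eigen Q (s : ℂ), sympl x y = 0) :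
    y ∈ eigen Q (s : ℂ) := by
  set z := (2 : ℂ)⁻¹ • (y + ((-s : ℝ) : ℂ) • Q y) with hz
  have hzm : z ∈ eigen Q ((-s : ℝ) : ℂ) := proj_mem_eigen hQ (by linarith) y
  have hyz : y - z ∈ eigen Q (s : ℂ) := by
    have : y - z = (2 : ℂ)⁻¹ • (y + (s : ℂ) • Q y) := by
      rw [hz]; push_cast; module
    rw [this]
    exact proj_mem_eigen hQ hs y
  have hadd : ∀ x x' w : H × H, sympl (x + x') w = sympl x w + sympl x' w := fun x x' w => by
    simp only [sympl_apply, Prod.fst_add, Prod.snd_add, inner_add_left]; ring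
  have h1 : ∀ x, sympl x z = 0 := by
    intro x
    have e1 : x = (2 : ℂ)⁻¹ • (x + (s : ℂ) • Q x) + (2 : ℂ)⁻¹ • (x + ((-s : ℝ) : ℂ) • Q x) := by
      push_cast; module
    have m1 := proj_mem_eigen hQ hs x
    rw [e1, hadd, h.sympl_eq_zero hQ (by linarith : (-s) * (-s) = 1)
      (proj_mem_eigen hQ (by linarith) x) hzm, add_zero,
      show z = y - (y - z) by abel, map_sub, hy _ m1, h.sympl_eq_zero hQ hs m1 hyz, sub_zero]
  have hz0 : z = 0 := by
    refine Prod.ext ?_ ?_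
    · have := h1 (0, z.1)
      rw [sympl_apply, inner_zero_left, zero_sub, neg_eq_zero] at this
      exact inner_self_eq_zero.1 this
    · have := h1 (z.2, 0)
      rw [sympl_apply, inner_zero_left, sub_zero] at this
      exact inner_self_eq_zero.1 this
  rwa [hz0, sub_zero] at hyz

omit hs h in
theorem lim_symForm {x : H × H} (hx : x ∈ eigen Q (s : ℂ)) :
    Tendsto (fun N : ℝ => ∫ t in (-N)..N,
      symForm x (resolvent (hamiltonian A B C) ((t : ℂ) * Complex.I) x)) atTop
      (𝓝 (2 * Real.pi * (s * (inner ℂ x.1 x.2).re))) := by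
  have h1 := hQ.lim_functional (symForm x) x
  have e : Real.pi • symForm x (Q x) = 2 * Real.pi * (s * (inner ℂ x.1 x.2).re) := by
    rw [mem_eigen.1 hx, Complex.coe_smul, map_smul, symForm_self, smul_eq_mul, smul_eq_mul]
    ring
  rwa [e] at h1

omit hs h in
theorem continuous_symForm (x : H × H) : Continuous fun t : ℝ =>
    symForm x (resolvent (hamiltonian A B C) ((t : ℂ) * Complex.I) x) :=
  (symForm x).continuous.comp (hQ.continuous_resolvent.clm_apply continuous_const)

omit hs in
-- The limit of the integrals of a nonnegative function dominates each truncation; the one over the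
-- degenerate interval `N = 0` suffices.
theorem eigen_form_nonneg {x : H × H} (hx : x ∈ eigen Q (s : ℂ)) :
    0 ≤ s * (inner ℂ x.1 x.2).re := by
  have h1 := integral_le_of_tendsto (continuous_symForm hQ x)
    (fun t => h.symForm_resolvent_nonneg t x) (lim_symForm hQ hx) le_rfl
  rw [neg_zero, intervalIntegral.integral_same] at h1
  exact nonneg_of_mul_nonneg_right h1 (by positivity)

omit hs in
/-- On isotropic vectors of a spectral subspace, the Hamiltonian acts like its diagonal part. -/
theorem isotropic {x : H × H} (hx : x ∈ eigen Q (s : ℂ)) (h0 : (inner ℂ x.1 x.2).re = 0) (t : ℝ) :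
    resolvent (hamiltonian A B C) ((t : ℂ) * Complex.I) x =
      (resolvent A ((t : ℂ) * Complex.I) x.1,
        resolvent (-A.adjoint) ((t : ℂ) * Complex.I) x.2) ∧
    ∃ b : B.domain, (b : H) = resolvent (-A.adjoint) ((t : ℂ) * Complex.I) x.2 ∧ B b = 0 := by
  have hl := lim_symForm hQ hx
  rw [h0, mul_zero, mul_zero] at hl
  -- A continuous nonnegative integrand with integral zero vanishes everywhere, so both forms vanish
  -- along the resolvent; for nonnegative symmetric operators this means that `B` and `C` themselves
  -- vanish there.
  have hz := eq_zero_of_tendsto_integral (continuous_symForm hQ x)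
    (fun t => h.symForm_resolvent_nonneg t x) hl t
  obtain ⟨b, c, hb, hc, e⟩ := h.symForm_resolvent t x
  rw [hz] at e
  have hb0 := h.nonneg_B b
  have hc0 := h.nonneg_C c
  have hBb := h.nonneg_B.apply_eq_zero h.symmetric_B h.dominant.dense_B (x := b) (by linarith)
  have hCc := h.nonneg_C.apply_eq_zero h.symmetric_C h.dominant.dense_C (x := c) (by linarith)
  have hR := isResolventAt_resolvent (h.imaginary_mem t)
  have hm := hR.mem_domain x
  have hTx := hR.apply_eq x
  rw [hamiltonian_apply] at hTx
  set w := resolvent (hamiltonian A B C) ((t : ℂ) * Complex.I) x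
  have b' : b = ⟨w.2, hm.2.1⟩ := Subtype.ext hb
  have c' : c = ⟨w.1, hm.1.2⟩ := Subtype.ext hc
  rw [b'] at hBb
  rw [c'] at hCc
  have x1 := congrArg Prod.fst hTx
  have x2 := congrArg Prod.snd hTx
  simp only [Prod.fst_add, Prod.snd_add, Prod.smul_fst, Prod.smul_snd] at x1 x2
  rw [hBb, add_zero, ← sub_eq_iff_eq_add] at x1
  rw [hCc, zero_add, ← sub_eq_iff_eq_add] at x2
  have w1 := (h.axis_A.isResolventAt t).left_inv ⟨w.1, hm.1.1⟩
  have w2 := (h.axis_D.isResolventAt t).left_inv ⟨w.2, hm.2.2⟩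
  simp only at w1 w2
  rw [x1] at w1
  rw [x2] at w2
  refine ⟨Prod.ext w1.symm w2.symm, ⟨w.2, hm.2.1⟩, w2.symm, hBb⟩

omit hs in
theorem eq_zero_of_fst_eq_zero (hker : (⋂ t : ℝ, kernelAt A B t) = {0}) {x : H × H}
    (hx : x ∈ eigen Q (s : ℂ)) (h1 : x.1 = 0) : x.2 = 0 := by
  have key : x.2 ∈ ⋂ t : ℝ, kernelAt A B t := by
    rw [Set.mem_iInter]
    intro t
    obtain ⟨-, b, hb, hBb⟩ := h.isotropic hQ hx (by rw [h1, inner_zero_left]; rfl) t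
    -- `kernelAt` uses `(A* + it)⁻¹`, the negative of the resolvent of `-A*` at `it`.
    have e := resolvent_neg (h.axis_D.mem t)
    rw [neg_neg] at e
    refine ⟨-b, ?_, by rw [B.map_neg, hBb, neg_zero]⟩
    rw [e, neg_apply, Submodule.coe_neg, hb]
  rw [hker] at key
  exact key

/-- The operator whose graph is a spectral subspace of the Hamiltonian. -/
theorem exists_graph (hker : (⋂ t : ℝ, kernelAt A B t) = {0}) : ∃ X : H →ₗ.[ℂ] H,
    X.graph = eigen Q (s : ℂ) ∧ IsSelfAdjoint X ∧
    (∀ x : X.domain, 0 ≤ s * (inner ℂ (X x) (x : H)).re) ∧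
    X.HasCore (riccatiDomain A X) ∧ SolvesRiccati A B C X := by
  let X := (eigen Q (s : ℂ)).toLinearPMap
  have hX : X.graph = eigen Q (s : ℂ) := Submodule.toLinearPMap_graph_eq _
    fun x hx h1 => h.eq_zero_of_fst_eq_zero hQ hker hx h1
  have hmem : ∀ x : X.domain, ((x : H), X x) ∈ eigen Q (s : ℂ) := fun x => hX ▸ X.mem_graph x
  -- If `y` is orthogonal to the domain, `(0, y)` is symplectically orthogonal to the graph, hence
  -- lies in it by maximality.
  have hdense : Dense (X.domain : Set H) := by
    rw [Submodule.dense_iff_topologicalClosure_eq_top, Submodule.topologicalClosure_eq_top_iff,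
      Submodule.eq_bot_iff]
    intro y hy
    have h1 : ((0 : H), y) ∈ eigen Q (s : ℂ) := by
      refine h.mem_eigen_of_sympl hQ hs fun x hx => ?_
      rw [← hX, LinearPMap.mem_graph_iff] at hx
      obtain ⟨u, hu, -⟩ := hx
      rw [sympl_apply, inner_zero_right, sub_zero, ← hu]
      exact hy u u.2
    exact h.eq_zero_of_fst_eq_zero hQ hker h1 rfl
  -- Isotropy of the graph is symmetry of `X`; maximality gives the inclusion of the adjoint in `X`.
  have hsa : IsSelfAdjoint X := by
    rw [LinearPMap.isSelfAdjoint_def]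
    refine le_antisymm ?_ (LinearPMap.IsFormalAdjoint.le_adjoint hdense fun x y => ?_)
    · refine LinearPMap.le_of_le_graph fun z hz => ?_
      obtain ⟨y, hy1, hy2⟩ := LinearPMap.mem_graph_iff _ |>.1 hz
      rw [hX]
      refine h.mem_eigen_of_sympl hQ hs fun x hx => ?_
      rw [← hX, LinearPMap.mem_graph_iff] at hx
      obtain ⟨u, hu1, hu2⟩ := hx
      rw [sympl_apply, ← hu1, ← hu2, ← hy1, ← hy2, sub_eq_zero]
      exact ((LinearPMap.adjoint_isFormalAdjoint hdense).symm u y).symm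
    · have h1 := h.sympl_eq_zero hQ hs (hmem x) (hmem y)
      rw [sympl_apply, sub_eq_zero] at h1
      exact h1.symm
  refine ⟨X, hX, hsa, fun x => ?_, ⟨?_, ?_⟩, ?_⟩
  · have h1 := h.eigen_form_nonneg hQ (hmem x)
    have h2 : (inner ℂ (X x) (x : H)).re = (inner ℂ (x : H) (X x)).re :=
      inner_re_symm (𝕜 := ℂ) _ _
    rwa [h2]
  · rintro u ⟨-, x, -, rfl⟩
    exact x.2
  · have hclos : (X.domRestrict (riccatiDomain A X)).IsClosable :=
      hsa.isClosed.isClosable.leIsClosable LinearPMap.domRestrict_le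
    refine LinearPMap.eq_of_eq_graph ?_
    rw [← hclos.graph_closure_eq_closure_graph]
    refine le_antisymm (Submodule.topologicalClosure_minimal _
      (LinearPMap.le_graph_of_le LinearPMap.domRestrict_le) hsa.isClosed) fun x hx => ?_
    rw [hX] at hx
    have h1 := h.dense_domain x
    have h2 : Continuous fun x : H × H => (2 : ℂ)⁻¹ • (x + (s : ℂ) • Q x) := by fun_prop
    have h3 : (2 : ℂ)⁻¹ • (x + (s : ℂ) • Q x) = x := by
      have hs' : (s : ℂ) * s = 1 := by exact_mod_cast hs
      rw [mem_eigen.1 hx, smul_smul, hs', one_smul]; module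
    -- The spectral projection is continuous, fixes `x` and maps `D(T)` into itself, since it
    -- commutes with a resolvent. The image of the dense set `D(T)` thus approximates `x` by points
    -- of the graph over `riccatiDomain A X`.
    have h4 := map_mem_closure h2 h1
      (t := ((X.domRestrict (riccatiDomain A X)).graph : Set (H × H))) (fun y hy => by
        have hc := hQ.commute_resolvent 0
        obtain ⟨z, hz, -⟩ := (hQ.isResolventAt 0).commute_apply hc ⟨y, hy⟩
        have hm : (2 : ℂ)⁻¹ • (y + (s : ℂ) • Q y) ∈ (hamiltonian A B C).domain :=
          Submodule.smul_mem _ _ (Submodule.add_mem _ hy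
            (Submodule.smul_mem _ _ (hz ▸ z.2)))
        have hv := proj_mem_eigen hQ hs y
        set w := (2 : ℂ)⁻¹ • (y + (s : ℂ) • Q y)
        rw [← hX] at hv
        have hd : w.1 ∈ riccatiDomain A X :=
          mem_riccatiDomain.2 ⟨hm.1.1, w.2, hv, hm.2.2⟩
        obtain ⟨x, hx1, hx2⟩ := X.mem_graph_iff.1 hv
        refine (LinearPMap.mem_graph_iff _).2 ⟨⟨w.1, hd, hx1 ▸ x.2⟩, rfl, ?_⟩
        rw [← hx2]
        exact LinearPMap.domRestrict_apply hx1.symm)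
    rwa [h3] at h4
  · intro u x y hxu hxy
    have hm : ((u : H), (y : H)) ∈ (hamiltonian A B C).domain := h.mem_domain u.2 y.2
    -- Invariance says that `T (u, X u)` is again in the graph; comparing its two components gives
    -- the Riccati equation.
    have h1 := hQ.isInvariant_eigen (s : ℂ) ⟨_, hm⟩ (by
      rw [← hX, LinearPMap.mem_graph_iff]
      exact ⟨x, hxu, hxy⟩)
    rw [hamiltonian_apply, ← hX, LinearPMap.mem_graph_iff] at h1
    obtain ⟨w, hw1, hw2⟩ := h1
    refine ⟨⟨y, h.domain_le_B y.2⟩, ⟨u, h.domain_le_C u.2⟩, w, hxy.symm, rfl, hw1, ?_⟩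
    rw [hw2]
    change A.adjoint y + (C ⟨u, h.domain_le_C u.2⟩ + -A.adjoint y) - C ⟨u, h.domain_le_C u.2⟩ = 0
    abel

end AxisHamiltonian

end Hamiltonian

end

/-! ### The bounded solution and its uniqueness. -/

noncomputable section

namespace Hamiltonian

variable {H : Type*} [NormedAddCommGroup H] [InnerProductSpace ℂ H] [CompleteSpace H]

/-- The operator `A + B L` with domain `{u ∈ D(A) | L u ∈ D(A*)}`. -/
def closedLoop (A B : H →ₗ.[ℂ] H) (hle : A.adjoint.domain ≤ B.domain) (L : H →L[ℂ] H) :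
    H →ₗ.[ℂ] H where
  domain := A.domain ⊓ A.adjoint.domain.comap (L : H →ₗ[ℂ] H)
  toFun :=
    { toFun := fun u => A ⟨u, u.2.1⟩ + B ⟨L u, hle u.2.2⟩
      map_add' := fun u v => by
        have hA := A.map_add ⟨u, u.2.1⟩ ⟨v, v.2.1⟩
        have hB := B.map_add ⟨L u, hle u.2.2⟩ ⟨L v, hle v.2.2⟩
        simp only [AddMemClass.mk_add_mk, ← map_add] at hA hB
        rw [add_add_add_comm, ← hA, ← hB]
        rfl
      map_smul' := fun c u => by
        have hA := A.map_smul c ⟨u, u.2.1⟩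
        have hB := B.map_smul c ⟨L u, hle u.2.2⟩
        simp only [SetLike.mk_smul_mk, ← map_smul] at hA hB
        rw [RingHom.id_apply, smul_add, ← hA, ← hB]
        rfl }

theorem closedLoop_apply (A B : H →ₗ.[ℂ] H) (hle : A.adjoint.domain ≤ B.domain) (L : H →L[ℂ] H)
    (u : (closedLoop A B hle L).domain) :
    closedLoop A B hle L u = A ⟨u, u.2.1⟩ + B ⟨L u, hle u.2.2⟩ := rfl

namespace AxisHamiltonian

variable {A B C : H →ₗ.[ℂ] H} {p M k s : ℝ} (h : AxisHamiltonian A B C p M k (s : ℂ))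
include h

theorem integrable_rate :
    MeasureTheory.Integrable fun t : ℝ => k * M * (1 + |t|) ^ (p - 2) := by
  have h1 := (integrable_one_add_norm (E := ℝ) (μ := MeasureTheory.volume) (r := 2 - p) (by
    have := h.p_lt
    simp only [Module.finrank_self, Nat.cast_one]
    linarith)).const_mul (k * M)
  simpa only [neg_sub, Real.norm_eq_abs] using h1

omit h [CompleteSpace H] in
theorem continuous_rate (k M p : ℝ) : Continuous fun t : ℝ => k * M * (1 + |t|) ^ (p - 2) := by
  refine continuous_const.mul (Continuous.rpow_const (by fun_prop) fun t => Or.inl ?_)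
  positivity

variable {M' : ℝ} {Q : H × H →L[ℂ] H × H} (hQ : HasAxisIntegral (hamiltonian A B C) M' Q)
  (hs : s * s = 1)
include hQ

/-- The second components of the diagonal and full resolvents at `x` differ by `(-A* - it)⁻¹ C c`,
whose squared norm is at most `μ t * φ t`. Here `μ` is the integrable rate and `φ` has principal
value `2π s Re ⟨x.1, x.2⟩`. As `A` and the eigenspace carry the same sign `s`, the two principal
values add up instead of cancelling. The weight `ε` stays free. -/
theorem norm_snd_bound (hs : s * s = 1) {x : H × H} (hx : x ∈ eigen Q (s : ℂ)) {ε : ℝ}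
    (hε : 0 < ε) :
    2 * Real.pi * ‖x.2‖ ≤ ε⁻¹ / 2 * (∫ t : ℝ, k * M * (1 + |t|) ^ (p - 2)) +
      ε * Real.pi * (s * (inner ℂ x.1 x.2).re) := by
  set φ : ℝ → ℝ := fun t => symForm x (resolvent (hamiltonian A B C) ((t : ℂ) * Complex.I) x)
  set μ : ℝ → ℝ := fun t => k * M * (1 + |t|) ^ (p - 2)
  have hφc : Continuous φ := continuous_symForm hQ x
  have hφ0 : ∀ t, 0 ≤ φ t := fun t => h.symForm_resolvent_nonneg t x
  have hμc : Continuous μ := continuous_rate k M p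
  have hμ0 : ∀ t, 0 ≤ μ t := fun t => (h.rate_pos t).le
  set g : ℝ → H := fun t => resolvent (-A.adjoint) ((t : ℂ) * Complex.I) x.2 -
    (resolvent (hamiltonian A B C) ((t : ℂ) * Complex.I) x).2
  have hc1 : Continuous fun t : ℝ => resolvent (-A.adjoint) ((t : ℂ) * Complex.I) x.2 :=
    h.axis_D.continuous_resolvent.clm_apply continuous_const
  have hc2 : Continuous fun t : ℝ =>
      (resolvent (hamiltonian A B C) ((t : ℂ) * Complex.I) x).2 :=
    continuous_snd.comp (hQ.continuous_resolvent.clm_apply continuous_const)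
  have hg : ∀ t, ‖g t‖ ≤ ε⁻¹ / 2 * μ t + ε / 2 * φ t := by
    intro t
    obtain ⟨b, c, hb, hc, e⟩ := h.symForm_resolvent t x
    have hR := isResolventAt_resolvent (h.imaginary_mem t)
    have hm := hR.mem_domain x
    have hTx := congrArg Prod.snd (hR.apply_eq x)
    rw [hamiltonian_apply] at hTx
    have h1 := (h.axis_D.isResolventAt t).left_inv ⟨_, hm.2.2⟩
    have h2 := h.norm_resolvent_C_sq_le t c
    have c' : c = ⟨_, hm.1.2⟩ := Subtype.ext hc
    have hgt : g t = resolvent (-A.adjoint) ((t : ℂ) * Complex.I) (C c) := by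
      have h3 : (-A.adjoint) ⟨_, hm.2.2⟩ - ((t : ℂ) * Complex.I) •
          (resolvent (hamiltonian A B C) ((t : ℂ) * Complex.I) x).2 = x.2 - C c := by
        rw [c', sub_eq_sub_iff_add_eq_add, add_comm]
        exact hTx
      simp only at h1
      rw [h3, map_sub] at h1
      change _ - (resolvent (hamiltonian A B C) ((t : ℂ) * Complex.I) x).2 = _
      rw [← h1]
      abel
    rw [hgt]
    have h4 : (inner ℂ (C c) (c : H)).re ≤ φ t := by
      change _ ≤ symForm x _
      rw [e]
      linarith [h.nonneg_B b]
    have h5 : ‖resolvent (-A.adjoint) ((t : ℂ) * Complex.I) (C c)‖ ^ 2 ≤ μ t * φ t :=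
      h2.trans (by gcongr; exact hμ0 t)
    refine le_of_sq_le_sq (h5.trans ?_) (by have := hμ0 t; have := hφ0 t; positivity)
    have h6 : (ε⁻¹ / 2 * μ t + ε / 2 * φ t) ^ 2 - μ t * φ t =
        (ε⁻¹ / 2 * μ t - ε / 2 * φ t) ^ 2 := by
      field_simp
      ring
    linarith [sq_nonneg (ε⁻¹ / 2 * μ t - ε / 2 * φ t)]
  have hlim : Tendsto (fun N : ℝ => ∫ t in (-N)..N, g t) atTop
      (𝓝 (-((2 * Real.pi * s : ℝ) : ℂ) • x.2)) := by
    have l1 := h.axis_D.lim x.2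
    have l2 := hQ.lim_functional ((ContinuousLinearMap.snd ℂ H H).restrictScalars ℝ) x
    have l3 := l1.sub l2
    have e : (Real.pi : ℂ) • (-((s : ℂ) • (1 : H →L[ℂ] H))) x.2 -
        Real.pi • ((ContinuousLinearMap.snd ℂ H H).restrictScalars ℝ) (Q x) =
        -((2 * Real.pi * s : ℝ) : ℂ) • x.2 := by
      rw [mem_eigen.1 hx]
      change (Real.pi : ℂ) • (-((s : ℂ) • x.2)) - Real.pi • ((s : ℂ) • x.2) = _
      rw [← Complex.coe_smul]
      push_cast
      module
    rw [e] at l3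
    refine l3.congr fun N => ?_
    exact (intervalIntegral.integral_sub (hc1.intervalIntegrable _ _)
      (hc2.intervalIntegrable _ _)).symm
  have hnorm := hlim.norm
  have hval : ‖-((2 * Real.pi * s : ℝ) : ℂ) • x.2‖ = 2 * Real.pi * ‖x.2‖ := by
    have habs : |s| = 1 := by
      rw [← abs_one, ← sq_eq_sq_iff_abs_eq_abs]; linarith
    rw [norm_smul, norm_neg, Complex.norm_real, Real.norm_eq_abs, abs_mul, habs, mul_one,
      abs_of_pos (by positivity)]
  rw [hval] at hnorm
  refine le_of_tendsto hnorm ?_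
  filter_upwards [eventually_ge_atTop 0] with N hN
  have i1 := integral_le_of_tendsto hμc hμ0 (MeasureTheory.intervalIntegral_tendsto_integral
    h.integrable_rate tendsto_neg_atTop_atBot tendsto_id) hN
  have i2 := integral_le_of_tendsto hφc hφ0 (lim_symForm hQ hx) hN
  have i3 : ‖∫ t in (-N)..N, g t‖ ≤ ∫ t in (-N)..N, (ε⁻¹ / 2 * μ t + ε / 2 * φ t) :=
    intervalIntegral.norm_integral_le_of_norm_le (by linarith)
      (Eventually.of_forall fun t _ => hg t)
      (((hμc.const_mul _).add (hφc.const_mul _)).intervalIntegrable _ _)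
  rw [intervalIntegral.integral_add ((hμc.const_mul _).intervalIntegrable _ _)
    ((hφc.const_mul _).intervalIntegrable _ _), intervalIntegral.integral_const_mul (ε⁻¹ / 2) μ,
    intervalIntegral.integral_const_mul (ε / 2) φ] at i3
  calc _ ≤ _ := i3
    _ ≤ ε⁻¹ / 2 * (∫ t : ℝ, μ t) + ε / 2 * (2 * Real.pi * (s * (inner ℂ x.1 x.2).re)) := by
      gcongr
    _ = _ := by ring

include hs in
-- Choosing `ε = ‖x.1‖⁻¹` makes the form term at most `π ‖x.2‖`, half of the left-hand side, and the
-- remaining term linear in `‖x.1‖`.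
theorem exists_norm_snd_le (hker : (⋂ t : ℝ, kernelAt A B t) = {0}) :
    ∃ K : ℝ, ∀ x ∈ eigen Q (s : ℂ), ‖x.2‖ ≤ K * ‖x.1‖ := by
  set K := ∫ t : ℝ, k * M * (1 + |t|) ^ (p - 2)
  refine ⟨K / (2 * Real.pi), fun x hx => ?_⟩
  by_cases h1 : x.1 = 0
  · rw [h.eq_zero_of_fst_eq_zero hQ hker hx h1, h1, norm_zero, mul_zero]
  have hpos : 0 < ‖x.1‖ := norm_pos_iff.2 h1
  have h2 := h.norm_snd_bound hQ hs hx (inv_pos.2 hpos)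
  rw [inv_inv] at h2
  have habs : |s| = 1 := by
    rw [← abs_one, ← sq_eq_sq_iff_abs_eq_abs]; linarith
  have h3 : s * (inner ℂ x.1 x.2).re ≤ ‖x.1‖ * ‖x.2‖ := by
    refine (le_abs_self _).trans ?_
    rw [abs_mul, habs, one_mul]
    exact (Complex.abs_re_le_norm _).trans (norm_inner_le_norm _ _)
  have h4 : ‖x.1‖⁻¹ * Real.pi * (s * (inner ℂ x.1 x.2).re) ≤ Real.pi * ‖x.2‖ := by
    calc _ ≤ ‖x.1‖⁻¹ * Real.pi * (‖x.1‖ * ‖x.2‖) := by gcongr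
      _ = Real.pi * ‖x.2‖ := by field_simp
  rw [div_mul_eq_mul_div, le_div_iff₀ (by positivity)]
  linarith

omit hQ in
-- With `f = (A + B L - it) u`, `b = B L u`, `c = C u`, the Riccati equation couples `‖b‖ ≤ κ (‖L‖
-- ‖f‖ + ‖c‖)` and `‖c‖ ≤ κ (‖f‖ + ‖b‖)`; for large `t`, `κ (1 + ‖L‖)` is below `1 / 8` and the
-- system can be solved for `‖b‖`. A constant below `1 / 2` also keeps `B L` small relative to `A -
-- it`.
theorem closedLoop_small {L : H →L[ℂ] H}
    (hric : ∀ u : (closedLoop A B h.domain_le_B L).domain,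
      C ⟨u, h.domain_le_C u.2.1⟩ + (-A.adjoint) ⟨L u, u.2.2⟩ =
        L (closedLoop A B h.domain_le_B L u)) :
    ∃ t : ℝ, ∀ u : (closedLoop A B h.domain_le_B L).domain,
      ‖B ⟨L u, h.domain_le_B u.2.2⟩‖ ≤
        1 / 3 * ‖closedLoop A B h.domain_le_B L u - ((t : ℂ) * Complex.I) • (u : H)‖ := by
  have hev := h.tendsto_rate_zero.eventually_lt_const
    (show (0 : ℝ) < 1 / (8 * (1 + ‖L‖)) by positivity)
  obtain ⟨t, ht⟩ := hev.exists
  have hk := h.k_pos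
  set κ := k * (1 + |t|) ^ (p - 1) with hκ
  have hκ0 : 0 ≤ κ := by positivity
  rw [lt_div_iff₀ (by positivity)] at ht
  refine ⟨t, fun u => ?_⟩
  have h1 := h.sub_B t ⟨L u, u.2.2⟩ ⟨L u, h.domain_le_B u.2.2⟩ rfl
  have h2 := h.sub_C t ⟨u, u.2.1⟩ ⟨u, h.domain_le_C u.2.1⟩ rfl
  have h3 := hric u
  have e1 : A ⟨u, u.2.1⟩ - ((t : ℂ) * Complex.I) • (u : H) =
      (closedLoop A B h.domain_le_B L u - ((t : ℂ) * Complex.I) • (u : H)) -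
        B ⟨L u, h.domain_le_B u.2.2⟩ := by
    rw [closedLoop_apply]; abel
  have e2 : (-A.adjoint) ⟨L u, u.2.2⟩ - ((t : ℂ) * Complex.I) • L u =
      L (closedLoop A B h.domain_le_B L u - ((t : ℂ) * Complex.I) • (u : H)) -
        C ⟨u, h.domain_le_C u.2.1⟩ := by
    rw [map_sub, map_smul, ← h3]; abel
  simp only at h1 h2
  rw [e2] at h1
  rw [e1] at h2
  set f := closedLoop A B h.domain_le_B L u - ((t : ℂ) * Complex.I) • (u : H)
  set b := B ⟨L u, h.domain_le_B u.2.2⟩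
  set c := C ⟨u, h.domain_le_C u.2.1⟩
  have h4 : ‖b‖ ≤ κ * (‖L‖ * ‖f‖ + ‖c‖) := h1.trans (by
    gcongr
    exact (norm_sub_le _ _).trans (by gcongr; exact L.le_opNorm f))
  have h5 : ‖c‖ ≤ κ * (‖f‖ + ‖b‖) := h2.trans (by gcongr; exact norm_sub_le _ _)
  have hL := norm_nonneg L
  have hf := norm_nonneg f
  have hb := norm_nonneg b
  have hc := norm_nonneg c
  have k1 : κ ≤ 1 / 8 := by nlinarith
  have k2 : κ * ‖L‖ ≤ 1 / 8 := by nlinarith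
  have k3 : κ * ‖L‖ * ‖f‖ ≤ 1 / 8 * ‖f‖ := by gcongr
  have k4 : κ * ‖c‖ ≤ 1 / 8 * ‖c‖ := by gcongr
  have k5 : κ * ‖f‖ ≤ 1 / 8 * ‖f‖ := by gcongr
  have k6 : κ * ‖b‖ ≤ 1 / 8 * ‖b‖ := by gcongr
  nlinarith

omit hQ in
theorem hamiltonian_closedLoop {L : H →L[ℂ] H}
    (hric : ∀ u : (closedLoop A B h.domain_le_B L).domain,
      C ⟨u, h.domain_le_C u.2.1⟩ + (-A.adjoint) ⟨L u, u.2.2⟩ =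
        L (closedLoop A B h.domain_le_B L u)) (z : ℂ)
    (u : (closedLoop A B h.domain_le_B L).domain) :
    hamiltonian A B C ⟨((u : H), L u), h.mem_domain u.2.1 u.2.2⟩ - z • ((u : H), L u) =
      (closedLoop A B h.domain_le_B L u - z • (u : H),
        L (closedLoop A B h.domain_le_B L u - z • (u : H))) := by
  rw [hamiltonian_apply]
  refine Prod.ext rfl ?_
  rw [map_sub, map_smul, ← hric u]
  rfl

/-- If the graph of the bounded operator `L` is a spectral subspace, then `L D(A) ⊆ D(A*)`. -/
theorem mem_adjoint_domain {τ : ℂ} {L : H →L[ℂ] H}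
    (hL : ∀ x : H × H, x ∈ eigen Q τ ↔ L x.1 = x.2) (u : A.domain) : L u ∈ A.adjoint.domain := by
  have hric : ∀ u : (closedLoop A B h.domain_le_B L).domain,
      C ⟨u, h.domain_le_C u.2.1⟩ + (-A.adjoint) ⟨L u, u.2.2⟩ =
        L (closedLoop A B h.domain_le_B L u) := fun u =>
    ((hL _).1 (hQ.isInvariant_eigen τ ⟨((u : H), L u), h.mem_domain u.2.1 u.2.2⟩
      ((hL _).2 rfl))).symm
  obtain ⟨t, ht⟩ := h.closedLoop_small hric
  have hR := hQ.isResolventAt t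
  have hmem : ∀ f : H, L (resolvent (hamiltonian A B C) ((t : ℂ) * Complex.I) (f, L f)).1 =
      (resolvent (hamiltonian A B C) ((t : ℂ) * Complex.I) (f, L f)).2 := fun f =>
    (hL _).1 (hQ.resolvent_mem_eigen t ((hL _).2 rfl))
  -- The closed loop operator is the restriction of `T` to the graph of `L`, seen in the first
  -- coordinate.
  have hE : IsResolventAt (closedLoop A B h.domain_le_B L) ((t : ℂ) * Complex.I)
      ((ContinuousLinearMap.fst ℂ H H).comp
        ((resolvent (hamiltonian A B C) ((t : ℂ) * Complex.I)).comp
          ((ContinuousLinearMap.id ℂ H).prod L))) := by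
    have hm : ∀ f : H, (resolvent (hamiltonian A B C) ((t : ℂ) * Complex.I) (f, L f)).1 ∈
        (closedLoop A B h.domain_le_B L).domain := fun f => by
      refine ⟨(hR.mem_domain (f, L f)).1.1, ?_⟩
      change L _ ∈ A.adjoint.domain
      rw [hmem f]
      exact (hR.mem_domain (f, L f)).2.2
    refine ⟨hm, fun f => ?_, fun u => ?_⟩
    · have h1 := h.hamiltonian_closedLoop hric ((t : ℂ) * Complex.I) ⟨_, hm f⟩
      have h2 := hR.right_inv (f, L f)
      have h3 : (⟨resolvent (hamiltonian A B C) ((t : ℂ) * Complex.I) (f, L f),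
          hR.mem_domain (f, L f)⟩ : (hamiltonian A B C).domain) =
          ⟨((resolvent (hamiltonian A B C) ((t : ℂ) * Complex.I) (f, L f)).1,
            L (resolvent (hamiltonian A B C) ((t : ℂ) * Complex.I) (f, L f)).1),
            h.mem_domain (hm f).1 (hm f).2⟩ := Subtype.ext (Prod.ext rfl (hmem f).symm)
      have h4 : ((resolvent (hamiltonian A B C) ((t : ℂ) * Complex.I) (f, L f)).1,
          L (resolvent (hamiltonian A B C) ((t : ℂ) * Complex.I) (f, L f)).1) =
          resolvent (hamiltonian A B C) ((t : ℂ) * Complex.I) (f, L f) :=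
        Prod.ext rfl (hmem f)
      rw [← h3, h4, h2] at h1
      exact (congrArg Prod.fst h1).symm
    · have h1 := h.hamiltonian_closedLoop hric ((t : ℂ) * Complex.I) u
      have h2 := hR.left_inv ⟨((u : H), L u), h.mem_domain u.2.1 u.2.2⟩
      simp only at h2
      rw [h1] at h2
      exact congrArg Prod.fst h2
  -- Removing `B L` from the closed loop operator leaves `A` on the possibly smaller domain, and `A'
  -- - it` is still onto. As `A - it` is injective on `D(A)`, the two domains coincide.
  let A' := A.domRestrict (closedLoop A B h.domain_le_B L).domain
  have hD : (closedLoop A B h.domain_le_B L).domain = A'.domain := by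
    ext v
    exact ⟨fun hv => ⟨hv, hv.1⟩, fun hv => hv.1⟩
  have hA' : ∀ v : A'.domain, A' v = A ⟨v, v.2.2⟩ := fun v => LinearPMap.domRestrict_apply rfl
  obtain ⟨K, hK, -⟩ := hE.perturb hD (k := 1 / 3) (by norm_num) (by norm_num) (fun v => by
    refine le_trans (le_of_eq ?_) (ht v)
    rw [hA', closedLoop_apply, sub_add_cancel_left, norm_neg])
  have h1 := hK.right_inv (A u - ((t : ℂ) * Complex.I) • (u : H))
  have hm := hK.mem_domain (A u - ((t : ℂ) * Complex.I) • (u : H))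
  rw [hA'] at h1
  have h2 := (h.axis_A.isResolventAt t).left_inv ⟨_, hm.2⟩
  have h3 := (h.axis_A.isResolventAt t).left_inv u
  simp only at h1 h2
  rw [h1, h3] at h2
  rw [h2]
  exact hm.1.2

include hs in
/-- A bounded solution of the Riccati equation with the sign of `s` has its graph in the spectral
subspace belonging to `s`. -/
theorem graph_subset_eigen {Y : H →L[ℂ] H} (hY0 : ∀ u, 0 ≤ s * (inner ℂ (Y u) u).re)
    (hY : IsBoundedSolution A B C Y) (f : H) : ((f, Y f) : H × H) ∈ eigen Q (s : ℂ) := by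
  have hs' : (s : ℂ) * s = 1 := by exact_mod_cast hs
  have hric : ∀ u : (closedLoop A B h.domain_le_B Y).domain,
      C ⟨u, h.domain_le_C u.2.1⟩ + (-A.adjoint) ⟨Y u, u.2.2⟩ =
        Y (closedLoop A B h.domain_le_B Y u) := by
    intro u
    obtain ⟨b, c, hb, hc, e⟩ := hY.riccati ⟨u, u.2.1⟩
    have hb' : b = ⟨Y u, h.domain_le_B u.2.2⟩ := Subtype.ext hb
    have hc' : c = ⟨u, h.domain_le_C u.2.1⟩ := Subtype.ext hc
    rw [closedLoop_apply, map_add, LinearPMap.neg_apply, ← hb', ← hc', ← sub_eq_zero, ← neg_eq_zero,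
      ← e]
    abel
  obtain ⟨t₀, ht₀⟩ := h.closedLoop_small hric
  have hD : A.domain = (closedLoop A B h.domain_le_B Y).domain := by
    ext v
    exact ⟨fun hv => ⟨hv, hY.mem_adjoint_domain ⟨v, hv⟩⟩, fun hv => hv.1⟩
  obtain ⟨K, hK, -⟩ := (h.axis_A.isResolventAt t₀).perturb hD (k := 1 / 2) (by norm_num)
    (by norm_num) (fun v => by
      have h1 := ht₀ ⟨v, hD.le v.2⟩
      set b := B ⟨Y v, h.domain_le_B (hD.le v.2).2⟩ with hb
      have e : closedLoop A B h.domain_le_B Y ⟨v, hD.le v.2⟩ = A v + b := rfl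
      rw [e] at h1 ⊢
      rw [add_sub_cancel_left]
      have h2 : ‖A v + b - ((t₀ : ℂ) * Complex.I) • (v : H)‖ ≤
          ‖A v - ((t₀ : ℂ) * Complex.I) • (v : H)‖ + ‖b‖ := by
        rw [add_sub_right_comm]
        exact norm_add_le _ _
      linarith)
  have hM' := hQ.nonneg
  -- On the graph of `Y` the bound for `T - it` becomes a bound below for the closed loop operator,
  -- uniform in `t`, so one point of its resolvent set gives the whole axis.
  have hall := imaginary_mem_resolventSet (S := closedLoop A B h.domain_le_B Y)
    (M := (M' + 1) * (1 + ‖Y‖)) (by positivity) (fun t u => by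
      have h1 := (hQ.isResolventAt t).left_inv ⟨((u : H), Y u), h.mem_domain u.2.1 u.2.2⟩
      simp only at h1
      rw [h.hamiltonian_closedLoop hric] at h1
      set w := closedLoop A B h.domain_le_B Y u - ((t : ℂ) * Complex.I) • (u : H)
      have h2 : ‖(u : H)‖ ≤ M' * ‖(w, Y w)‖ := by
        refine (norm_fst_le ((u : H), Y u)).trans ?_
        rw [← h1]
        refine ContinuousLinearMap.le_of_opNorm_le _ ((hQ.bound t).trans (div_le_self hM' ?_)) _
        linarith [abs_nonneg t]
      have h3 : ‖(w, Y w)‖ ≤ (1 + ‖Y‖) * ‖w‖ := by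
        refine max_le ?_ ?_
        · change ‖w‖ ≤ _
          nlinarith [norm_nonneg w, norm_nonneg Y]
        · exact (Y.le_opNorm w).trans (by gcongr; linarith)
      calc ‖(u : H)‖ ≤ M' * ((1 + ‖Y‖) * ‖w‖) := h2.trans (by gcongr)
        _ ≤ (M' + 1) * ((1 + ‖Y‖) * ‖w‖) := by gcongr; linarith
        _ = _ := by ring) hK.mem
  -- The closed loop resolvent, lifted to the graph of `Y`, solves the resolvent equation of `T`;
  -- the graph is thus invariant under the resolvents and, after integration, under `Q`.
  have hinv : ∀ (g : H) (t : ℝ),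
      (resolvent (hamiltonian A B C) ((t : ℂ) * Complex.I) (g, Y g)).2 =
      Y (resolvent (hamiltonian A B C) ((t : ℂ) * Complex.I) (g, Y g)).1 := by
    intro g t
    have hE := isResolventAt_resolvent (hall t)
    have h1 := h.hamiltonian_closedLoop hric ((t : ℂ) * Complex.I) ⟨_, hE.mem_domain g⟩
    have h2 := (hQ.isResolventAt t).left_inv
      ⟨(resolvent (closedLoop A B h.domain_le_B Y) ((t : ℂ) * Complex.I) g, Y _),
        h.mem_domain (hE.mem_domain g).1 (hE.mem_domain g).2⟩
    simp only at h1 h2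
    rw [h1, hE.right_inv] at h2
    rw [h2]
  have hQY : ∀ g : H, (Q (g, Y g)).2 = Y (Q (g, Y g)).1 := by
    intro g
    let l : H × H →L[ℝ] H := (ContinuousLinearMap.snd ℂ H H -
      Y.comp (ContinuousLinearMap.fst ℂ H H)).restrictScalars ℝ
    have hl : ∀ w, l w = w.2 - Y w.1 := fun w => rfl
    have h1 := hQ.lim_functional l (g, Y g)
    have h2 : ∀ t : ℝ, l (resolvent (hamiltonian A B C) ((t : ℂ) * Complex.I) (g, Y g)) = 0 :=
      fun t => by rw [hl, hinv, sub_self]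
    simp only [h2, intervalIntegral.integral_zero] at h1
    have h3 := tendsto_nhds_unique h1 tendsto_const_nhds
    rw [smul_eq_zero_iff_right Real.pi_ne_zero, hl, sub_eq_zero] at h3
    exact h3
  set x : H × H := (f, Y f) with hx
  -- The component of `x` in the opposite spectral subspace, to be shown zero. It lies on the graph
  -- of `Y`, where the form has the sign of `s`, and in the eigenspace of `-s`, where it has the
  -- other.
  set z := (2 : ℂ)⁻¹ • (x + ((-s : ℝ) : ℂ) • Q x) with hz
  have hzm : z ∈ eigen Q ((-s : ℝ) : ℂ) := proj_mem_eigen hQ (by linarith) x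
  have hzY : z.2 = Y z.1 := by
    rw [hz]
    simp only [Prod.smul_snd, Prod.snd_add, Prod.smul_fst, Prod.fst_add, map_smul, map_add]
    rw [hx, hQY f]
  have h1 := h.eigen_form_nonneg hQ hzm
  have h2 := hY0 z.1
  have h3 : (inner ℂ (Y z.1) z.1).re = (inner ℂ z.1 z.2).re := by
    rw [hzY]
    exact inner_re_symm (𝕜 := ℂ) _ _
  rw [h3] at h2
  have h4 : (inner ℂ z.1 z.2).re = 0 := by
    have h5 : s * (inner ℂ z.1 z.2).re = 0 := by linarith
    have h6 : s ≠ 0 := fun h0 => by rw [h0] at hs; norm_num at hs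
    exact (mul_eq_zero.1 h5).resolve_left h6
  have hiso := fun t => (h.isotropic hQ hzm h4 t).1
  have l1 := hQ.lim_functional ((ContinuousLinearMap.fst ℂ H H).restrictScalars ℝ) z
  have l2 := l1.congr fun N => intervalIntegral.integral_congr (g := fun t : ℝ =>
    resolvent A ((t : ℂ) * Complex.I) z.1) fun t _ => congrArg Prod.fst (hiso t)
  -- On isotropic `z` the first component of the resolvent is that of `A`, with principal value `π s
  -- z.1`; but `Q z = -s z` requires `-π s z.1`.
  have h5 := tendsto_nhds_unique l2 (h.axis_A.lim z.1)
  rw [mem_eigen.1 hzm, Complex.coe_smul] at h5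
  have h6 := smul_right_injective H Real.pi_ne_zero h5
  have h7 : ((-s : ℝ) : ℂ) • z.1 = (s : ℂ) • z.1 := h6
  have h8 : z.1 = 0 := by
    have h9 : (2 : ℂ) • z.1 = (s : ℂ) • ((s : ℂ) • z.1 - ((-s : ℝ) : ℂ) • z.1) := by
      rw [smul_sub, smul_smul, smul_smul]
      push_cast
      rw [mul_neg, hs']
      module
    rw [h7, sub_self, smul_zero] at h9
    simpa using h9
  have h9 : z = 0 := Prod.ext h8 (by rw [hzY, h8, map_zero]; rfl)
  have h10 : x = (2 : ℂ)⁻¹ • (x + (s : ℂ) • Q x) := by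
    have h11 : x = (2 : ℂ)⁻¹ • (x + (s : ℂ) • Q x) + z := by
      rw [hz]; push_cast; module
    rwa [h9, add_zero] at h11
  rw [h10]
  exact proj_mem_eigen hQ hs x

include hs in
/-- The spectral subspace on which the Hamiltonian has the spectrum of its diagonal entry `A` is the
graph of a bounded operator, the only bounded solution of the Riccati equation of its sign. -/
theorem exists_bounded (hker : (⋂ t : ℝ, kernelAt A B t) = {0}) {X : H →ₗ.[ℂ] H}
    (hX : X.graph = eigen Q (s : ℂ)) (hsa : IsSelfAdjoint X)
    (hpos : ∀ x : X.domain, 0 ≤ s * (inner ℂ (X x) (x : H)).re) (hric : SolvesRiccati A B C X) :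
    ∃ L : H →L[ℂ] H, X = (L : H →ₗ[ℂ] H).toPMap ⊤ ∧ ((s : ℂ) • L).IsPositive ∧
      IsBoundedSolution A B C L ∧
      ∀ Y : H →L[ℂ] H, ((s : ℂ) • Y).IsPositive → IsBoundedSolution A B C Y → Y = L := by
  obtain ⟨K, hK⟩ := h.exists_norm_snd_le hQ hs hker
  have hbd : ∀ x : X.domain, ‖X x‖ ≤ K * ‖(x : H)‖ := fun x => hK _ (hX ▸ X.mem_graph x)
  -- Boundedness of `X` on its domain makes every vector belong to the domain of the adjoint, which
  -- is `X`.
  have hdom : X.domain = ⊤ := by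
    rw [eq_top_iff]
    intro y _
    have h1 : y ∈ X.adjoint.domain := by
      rw [LinearPMap.mem_adjoint_domain_iff]
      exact (innerSL ℂ y).continuous.comp
        (AddMonoidHomClass.continuous_of_bound X.toFun K hbd)
    rwa [LinearPMap.isSelfAdjoint_def.1 hsa] at h1
  have hm : ∀ u, u ∈ X.domain := fun u => hdom.ge trivial
  let L₀ : H →ₗ[ℂ] H :=
    { toFun := fun u => X ⟨u, hm u⟩
      map_add' := fun u v => X.map_add ⟨u, hm u⟩ ⟨v, hm v⟩
      map_smul' := fun c u => X.map_smul c ⟨u, hm u⟩ }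
  let L : H →L[ℂ] H := L₀.mkContinuous K fun u => hbd ⟨u, hm u⟩
  have hL : ∀ u : X.domain, L u = X u := fun u => rfl
  have hXL : X = (L : H →ₗ[ℂ] H).toPMap ⊤ := LinearPMap.ext hdom fun u _ _ => rfl
  have hgraph : ∀ x : H × H, x ∈ eigen Q (s : ℂ) ↔ L x.1 = x.2 := by
    intro x
    rw [← hX, LinearPMap.mem_graph_iff]
    constructor
    · rintro ⟨y, hy1, hy2⟩
      rw [← hy1, ← hy2, hL]
    · intro e
      exact ⟨⟨x.1, hm x.1⟩, rfl, e⟩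
  have hmem := h.mem_adjoint_domain hQ hgraph
  refine ⟨L, hXL, ?_, ⟨hmem, fun u => ?_⟩, fun Y hY hY' => ?_⟩
  · rw [ContinuousLinearMap.isPositive_def]
    have hadj : X.adjoint = X := LinearPMap.isSelfAdjoint_def.1 hsa
    have hform := LinearPMap.adjoint_isFormalAdjoint hsa.dense_domain
    rw [hadj] at hform
    have hsymm : ∀ u v : H, inner ℂ (L u) v = inner ℂ u (L v) := fun u v =>
      hform ⟨u, hm u⟩ ⟨v, hm v⟩
    refine ⟨fun u v => ?_, fun u => ?_⟩
    · change inner ℂ ((s : ℂ) • L u) v = inner ℂ u ((s : ℂ) • L v)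
      rw [inner_smul_left, inner_smul_right, Complex.conj_ofReal, hsymm]
    · change 0 ≤ (inner ℂ ((s : ℂ) • L u) u).re
      rw [inner_smul_left, Complex.conj_ofReal, Complex.re_ofReal_mul]
      exact hpos ⟨u, hm u⟩
  · obtain ⟨b, c, w, hb, hc, hw, e⟩ := hric u ⟨u, hm u⟩ ⟨L u, hmem u⟩ rfl rfl
    refine ⟨b, c, hb, hc, ?_⟩
    rw [← hL, hw, map_add] at e
    rw [← e]
    abel
  · ext f
    refine ((hgraph (f, Y f)).1 (h.graph_subset_eigen hQ hs (fun u => ?_) hY' f)).symm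
    have h1 : 0 ≤ (inner ℂ ((s : ℂ) • Y u) u).re := hY.2 u
    rwa [inner_smul_left, Complex.conj_ofReal, Complex.re_ofReal_mul] at h1

end AxisHamiltonian

end Hamiltonian

end

/-! ### Assembling the theorem. -/

noncomputable section

namespace Hamiltonian

variable {H : Type*} [NormedAddCommGroup H] [InnerProductSpace ℂ H] [CompleteSpace H]

theorem AxisHamiltonian.exists_isRiccatiPair {A B C : H →ₗ.[ℂ] H} {p M k M' : ℝ} {σ : ℂ}
    (h : AxisHamiltonian A B C p M k σ) {Q : H × H →L[ℂ] H × H}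
    (hQ : HasAxisIntegral (hamiltonian A B C) M' Q) (hker : (⋂ t : ℝ, kernelAt A B t) = {0}) :
    ∃ Xp Xm : H →ₗ.[ℂ] H, IsRiccatiPair A B C Xp Xm ∧
      Xp.graph = eigen Q ((1 : ℝ) : ℂ) ∧ Xm.graph = eigen Q ((-1 : ℝ) : ℂ) := by
  obtain ⟨Xp, g1, a1, n1, c1, r1⟩ := h.exists_graph hQ (s := 1) (by norm_num) hker
  obtain ⟨Xm, g2, a2, n2, c2, r2⟩ := h.exists_graph hQ (s := -1) (by norm_num) hker
  refine ⟨Xp, Xm, ⟨?_, a1, a2, fun x => ?_, fun x => ?_, c1, c2, r1, r2⟩, g1, g2⟩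
  · rw [g1, g2, Complex.ofReal_neg, Complex.ofReal_one]
    exact hQ.isSpectralDecomposition h.dense_domain
  · simpa only [one_mul] using n1 x
  · simpa only [neg_one_mul, Left.nonneg_neg_iff] using n2 x

end Hamiltonian

end

theorem mainTheorem2 {H : Type*} [NormedAddCommGroup H] [InnerProductSpace ℂ H] [CompleteSpace H]
    (A B C : H →ₗ.[ℂ] H) (p : ℝ)
    (hT : Hamiltonian.IsNonnegHamiltonian A B C p) (hp : p < 1)
    (hA : ∀ t : ℝ, (t : ℂ) * Complex.I ∈ Hamiltonian.resolventSet A)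
    (hker : (⋂ t : ℝ, Hamiltonian.kernelAt A B t) = {0}) :
    (∀ θ : ℝ, θ < Real.pi / 2 → Hamiltonian.IsSectorial A θ →
      ∃ Xp Xm : H →ₗ.[ℂ] H, Hamiltonian.IsRiccatiPair A B C Xp Xm ∧
        ∃ X : H →L[ℂ] H, Xp = (X : H →ₗ[ℂ] H).toPMap ⊤ ∧
          X.IsPositive ∧ Hamiltonian.IsBoundedSolution A B C X ∧
          ∀ Y : H →L[ℂ] H, Y.IsPositive → Hamiltonian.IsBoundedSolution A B C Y → Y = X) ∧
    (∀ θ : ℝ, θ < Real.pi / 2 → Hamiltonian.IsSectorial (-A) θ →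
      ∃ Xp Xm : H →ₗ.[ℂ] H, Hamiltonian.IsRiccatiPair A B C Xp Xm ∧
        ∃ X : H →L[ℂ] H, Xm = (X : H →ₗ[ℂ] H).toPMap ⊤ ∧
          (-X).IsPositive ∧ Hamiltonian.IsBoundedSolution A B C X ∧
          ∀ Y : H →L[ℂ] H, (-Y).IsPositive → Hamiltonian.IsBoundedSolution A B C Y → Y = X) := by
  have hD : Dense (A.adjoint.domain : Set H) := hT.dominant.dense_D
  refine ⟨fun θ hθ hS => ?_, fun θ hθ hS => ?_⟩
  · obtain ⟨M₀, h1, h2⟩ := hS.axis hθ hA hD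
    obtain ⟨M, k, h⟩ := hT.axis (σ := ((1 : ℝ) : ℂ)) hp
      (by rwa [Complex.ofReal_one, one_smul]) (by rwa [Complex.ofReal_one, one_smul])
    obtain ⟨Q, hQ⟩ := h.exists_axis
    obtain ⟨Xp, Xm, hX, gp, gm⟩ := h.exists_isRiccatiPair hQ hker
    obtain ⟨L, e, hL, hL', hu⟩ := h.exists_bounded hQ (by norm_num) hker gp hX.selfAdjoint_pos
      (fun x => by rw [one_mul]; exact hX.nonneg x) hX.riccati_pos
    simp only [Complex.ofReal_one, one_smul] at hL hu
    exact ⟨Xp, Xm, hX, L, e, hL, hL', hu⟩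
  · have e := Hamiltonian.adjoint_neg hT.dominant.dense_A
    obtain ⟨M₀, h1, h2⟩ := hS.axis hθ (fun t => by
      have h := Hamiltonian.mem_resolventSet_neg (hA (-t))
      rwa [Complex.ofReal_neg, neg_mul, neg_neg] at h) (by rw [e]; exact hD)
    -- Applied to `-A`, the sectorial case gives sign `1` for `-A` and `-1` for `A*`; negating both
    -- yields the axis data of `A` and `-A*` with `σ = -1`, so that the bounded operator is now
    -- `Xm`.
    have h1' := h1.neg
    have h2' := h2
    rw [neg_neg] at h1'
    rw [e, neg_neg] at h2'
    have h2'' := h2'.neg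
    rw [neg_neg] at h2''
    obtain ⟨M, k, h⟩ := hT.axis (σ := ((-1 : ℝ) : ℂ)) hp
      (by rwa [Complex.ofReal_neg, Complex.ofReal_one, neg_one_smul])
      (by rwa [Complex.ofReal_neg, Complex.ofReal_one, neg_one_smul, neg_neg])
    obtain ⟨Q, hQ⟩ := h.exists_axis
    obtain ⟨Xp, Xm, hX, gp, gm⟩ := h.exists_isRiccatiPair hQ hker
    obtain ⟨L, e, hL, hL', hu⟩ := h.exists_bounded hQ (by norm_num) hker gm hX.selfAdjoint_neg
      (fun x => by rw [neg_one_mul]; exact neg_nonneg.2 (hX.nonpos x)) hX.riccati_neg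
    simp only [Complex.ofReal_neg, Complex.ofReal_one, neg_one_smul] at hL hu
    exact ⟨Xp, Xm, hX, L, e, hL, hL', hu⟩
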